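/- Let $G$ be a locally compact (Hausdorff) group with left Haar measure $dx$ and modular function $\Delta$, and let $\omega$ be a weight on $G$ with $\omega\ge 1$, i.e. a measurable function $\omega:G\to[1,\infty)$ with $\omega(e)=1$, $\omega(x^{-1})=\omega(x)$ and $\omega(xy)\le\omega(x)\omega(y)$ for all $x,y\in G$. Let $1\le p<\infty$ and let $q\in(1,\infty]$ be the index conjugate to $p$, $\frac1p+\frac1q=1$. Suppose that there exist a bounded measurable function $u:G\to[0,\infty)$ and real numbers $s<q$ and $r>0$ such that $\sigma=\omega u$ is bounded away from zero, $$\frac{\omega(xy)}{\omega(x)\omega(y)}\le u(x)+u(y)\quad(x,y\in G),\qquad\text{and}\qquad \int_G u(x)^s\,\omega(x)^r\,dx<\infty .$$ Let $L^p(G,\omega)$ be the space of (classes of) complex functions $f$ with $f\omega\in L^p(G)$, with norm $\|f\|_{p,\omega}=\|f\omega\|_p$, and let $\mathcal A=L^p(G,\omega)\cap L^2(G)$ with the norm $\|f\|_{\mathcal A}=\max\{\|f\|_{p,\omega},\|f\|_2\}$. Then: (a) $\mathcal A$ is a Banach $*$-algebra under the convolution $(f*g)(x)=\int_G f(y)g(y^{-1}x)\,dy$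 (the integral converging absolutely for almost every $x$) and the involution $f^*(x)=\Delta(x^{-1})\overline{f(x^{-1})}$. That is, $\mathcal A$ is complete, it is an associative $*$-algebra under these operations, the involution is isometric, and $\|f*g\|_{\mathcal A}\le C\|f\|_{\mathcal A}\|g\|_{\mathcal A}$ for all $f,g\in\mathcal A$, with a constant $C$ independent of $f,g$. (b) For $f\in\mathcal A$, convolution $T_f g=f*g$ is a bounded operator on $L^2(G)$, and $f\mapsto T_f$ is an injective continuous $*$-homomorphism $\mathcal A\to B(L^2(G))$, by which $\mathcal A$ is regarded as a subalgebra of $B(L^2(G))$. It is quasi-inverse closed there: if $f\in\mathcal A$ and $S\in B(L^2(G))$ satisfy $T_f+S-T_fS=T_f+S-ST_f=0$, then $S=T_g$ for some $g\in\mathcal A$, and $g$ is a quasi-inverse of $f$ in $\mathcal A$, i.e. $f+g-f*g=f+g-g*f=0$. (c) $\rho_{\mathcal A}(f)=\rho_{B(L^2(G))}(T_f)$ for every $f\in\mathcal A$. Here $\rho_{\mathcal A}(f)=\sup\{|\lambda|:\lambda\in\sigma_{\mathcal A}(f)\}$, where $\sigma_{\mathcal A}(f)$ consists of $0$ and of all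 $\lambda\in\mathbb C\setminus\{0\}$ such that $\lambda^{-1}f$ has no quasi-inverse in $\mathcal A$, and $\rho_{B(L^2(G))}$ is the usual spectral radius. -/

import Mathlib

open MeasureTheory Filter Topology
open scoped ENNReal NNReal ComplexConjugate

namespace WeightedConv

noncomputable section

/-! ### Algebraic notions -/

/-- The quasi-product `a ∘ b = a + b - ab` with respect to a multiplication `mul`. -/
def quasiProd {V : Type*} [AddCommGroup V] (mul : V → V → V) (a b : V) : V :=
  a + b - mul a b

/-- `a₀` is a quasi-inverse of `a`: `a ∘ a₀ = a₀ ∘ a = 0`. -/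
def IsQuasiInverse {V : Type*} [AddCommGroup V] (mul : V → V → V) (a a₀ : V) : Prop :=
  quasiProd mul a a₀ = 0 ∧ quasiProd mul a₀ a = 0

/-- The spectrum of `a` in a (possibly non-unital) complex algebra: `0` together with all
`z ≠ 0` for which `z⁻¹ a` is quasi-singular. -/
def quasiSpectrum {V : Type*} [AddCommGroup V] [Module ℂ V] (mul : V → V → V) (a : V) : Set ℂ :=
  {0} ∪ {z : ℂ | z ≠ 0 ∧ ¬ ∃ b : V, IsQuasiInverse mul (z⁻¹ • a) b}

/-- The spectral radius `sup {|z| : z ∈ σ(a)}`. -/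
def quasiSpectralRadius {V : Type*} [AddCommGroup V] [Module ℂ V] (mul : V → V → V)
    (a : V) : ℝ≥0∞ :=
  ⨆ z ∈ quasiSpectrum mul a, (‖z‖₊ : ℝ≥0∞)

/-- `N` is a complete norm on the complex vector space `V`, and `V` is an associative algebra
under `mul` with `N (a b) ≤ C N(a) N(b)` for a constant `C`, and `star` is an isometric
involution. -/
structure IsBanachStarAlgebra {V : Type*} [AddCommGroup V] [Module ℂ V] (N : V → ℝ)
    (mul : V → V → V) (star : V → V) : Prop where
  norm_nonneg : ∀ a, 0 ≤ N a
  norm_eq_zero : ∀ a, N a = 0 ↔ a = 0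
  norm_add_le : ∀ a b, N (a + b) ≤ N a + N b
  norm_smul : ∀ (c : ℂ) (a : V), N (c • a) = ‖c‖ * N a
  complete : ∀ a : ℕ → V,
    (∀ ε : ℝ, 0 < ε → ∃ K : ℕ, ∀ m n : ℕ, K ≤ m → K ≤ n → N (a m - a n) < ε) →
    ∃ b : V, Tendsto (fun n => N (a n - b)) atTop (𝓝 0)
  add_mul : ∀ a b c, mul (a + b) c = mul a c + mul b c
  mul_add : ∀ a b c, mul a (b + c) = mul a b + mul a c
  smul_mul : ∀ (z : ℂ) (a b : V), mul (z • a) b = z • mul a b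
  mul_smul : ∀ (z : ℂ) (a b : V), mul a (z • b) = z • mul a b
  mul_assoc : ∀ a b c, mul (mul a b) c = mul a (mul b c)
  norm_mul_le : ∃ C : ℝ, ∀ a b, N (mul a b) ≤ C * N a * N b
  star_star : ∀ a, star (star a) = a
  star_add : ∀ a b, star (a + b) = star a + star b
  star_smul : ∀ (z : ℂ) (a : V), star (z • a) = conj z • star a
  star_mul : ∀ a b, star (mul a b) = mul (star b) (star a)
  norm_star : ∀ a, N (star a) = N a

/-- `T` embeds the normed `*`-algebra `V` continuously, as a `*`-subalgebra, into the bounded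
operators on the Hilbert space `H`. -/
structure IsStarEmbedding {V : Type*} [AddCommGroup V] [Module ℂ V] (N : V → ℝ)
    (mul : V → V → V) (star : V → V)
    {H : Type*} [NormedAddCommGroup H] [InnerProductSpace ℂ H] [CompleteSpace H]
    (T : V → (H →L[ℂ] H)) : Prop where
  map_add : ∀ a b, T (a + b) = T a + T b
  map_smul : ∀ (z : ℂ) (a : V), T (z • a) = z • T a
  map_mul : ∀ a b, T (mul a b) = T a * T b
  map_star : ∀ a, T (star a) = ContinuousLinearMap.adjoint (T a)
  injective : Function.Injective T
  bounded : ∃ C : ℝ, ∀ a, ‖T a‖ ≤ C * N a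

/-- `V`, regarded as a subalgebra of `B` through `T`, is quasi-inverse closed in `B`: if
`a ∈ V` has a quasi-inverse `b` in `B`, then `b` belongs to `V` (and is a quasi-inverse of `a`
there). -/
def IsQuasiInverseClosed {V : Type*} [AddCommGroup V] (mul : V → V → V)
    {B : Type*} [Ring B] (T : V → B) : Prop :=
  ∀ (a : V) (b : B), IsQuasiInverse (fun x y : B => x * y) (T a) b →
    ∃ a₀ : V, T a₀ = b ∧ IsQuasiInverse mul a a₀

/-! ### Weights and weighted spaces -/

/-- A weight on the group `G` with (left) Haar measure `μ`. -/
structure IsWeight {G : Type*} [Group G] [MeasurableSpace G] (μ : Measure G)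
    (ω : G → ℝ) : Prop where
  aemeasurable : AEMeasurable ω μ
  nonneg : ∀ x, 0 ≤ ω x
  map_one : ω 1 = 1
  map_inv : ∀ x, ω x⁻¹ = ω x
  submul : ∀ x y, ω (x * y) ≤ ω x * ω y

/-- `L^p(G, ω)`: the (classes of) functions `f` with `f ω ∈ L^p(G)`. -/
def weightedLp {G : Type*} [MeasurableSpace G] (μ : Measure G) (ω : G → ℝ) (p : ℝ≥0∞) :
    Submodule ℂ (G →ₘ[μ] ℂ) where
  carrier := {f | MemLp (fun x => f x * (ω x : ℂ)) p μ}
  zero_mem' := by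
    refine (memLp_congr_ae ?_).mpr (MemLp.zero (ε := ℂ))
    filter_upwards [AEEqFun.coeFn_zero (α := G) (β := ℂ) (μ := μ)] with x hx
    simp [hx]
  add_mem' := by
    intro f g hf hg
    refine (memLp_congr_ae ?_).mpr (MemLp.add hf hg)
    filter_upwards [AEEqFun.coeFn_add f g] with x hx
    simp [hx, _root_.add_mul]
  smul_mem' := by
    intro c f hf
    refine (memLp_congr_ae ?_).mpr (MemLp.const_smul hf c)
    filter_upwards [AEEqFun.coeFn_smul c f] with x hx
    simp [hx, _root_.mul_assoc]

/-- `L^p(G, ω) ∩ L^2(G)`. -/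
def weightedLpInterL2 {G : Type*} [MeasurableSpace G] (μ : Measure G) (ω : G → ℝ)
    (p : ℝ≥0∞) : Submodule ℂ (G →ₘ[μ] ℂ) :=
  weightedLp μ ω p ⊓ Lp.LpSubmodule ℂ ℂ 2 μ

/-- `max (‖f‖_{p,ω}, ‖f‖_2)`, where `‖f‖_{p,ω} = ‖f ω‖_p`. -/
def interNorm {G : Type*} [MeasurableSpace G] (μ : Measure G) (ω : G → ℝ) (p : ℝ≥0∞)
    (f : weightedLpInterL2 μ ω p) : ℝ :=
  max (eLpNorm (fun x => (f : G →ₘ[μ] ℂ) x * (ω x : ℂ)) p μ).toReal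
    (eLpNorm (f : G →ₘ[μ] ℂ) 2 μ).toReal

/-! ### Convolution and involution of functions on a group -/

/-- `h` is the convolution `f * g`: for almost every `x` the integral
`∫ f(y) g(y⁻¹ x) dy` converges absolutely and equals `h x`. -/
def IsConvolution {G : Type*} [Group G] [MeasurableSpace G] (μ : Measure G)
    (f g h : G → ℂ) : Prop :=
  ∀ᵐ x ∂μ, Integrable (fun y => f y * g (y⁻¹ * x)) μ ∧ h x = ∫ y, f y * g (y⁻¹ * x) ∂μ

/-- The involution `f^*(x) = Δ(x⁻¹) conj (f (x⁻¹))`, where `Δ` is the modular function given by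
`μ (E x) = Δ(x) μ (E)`. Mathlib's `modularCharacter x` is `μ (E x⁻¹) / μ (E)`, that is,
`Δ(x⁻¹)`. -/
def groupStar {G : Type*} [Group G] [TopologicalSpace G] [IsTopologicalGroup G]
    [LocallyCompactSpace G] (f : G → ℂ) (x : G) : ℂ :=
  (((Measure.modularCharacter x : ℝ≥0) : ℝ) : ℂ) * conj (f x⁻¹)

end

end WeightedConv

namespace WeightedConv

/-! ### Spectral radius comparison from a norm inequality for squares -/

section Gelfand

variable {A : Type*} [NormedRing A] [NormedAlgebra ℂ A] [CompleteSpace A]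

/-! Everything rests on a majorant `σ`, bounded below, with `ω(xy) ≤ σ(x)ω(y) + ω(x)σ(y)` and an
interpolation bound `‖fσ‖₁ ≤ K ‖f‖₂^θ ‖fω‖_p^(1-θ)` for some `0 < θ < 1` (`IsMajorant`). Young's
inequality gives `‖f*g‖_{p,ω} ≤ ‖fσ‖₁ ‖g‖_{p,ω} + ‖f‖_{p,ω} ‖gσ‖₁`. Hence the space is a Banach
algebra contained in `L¹`, it acts on `L²`, and `‖f*f‖ ≤ C ‖f‖₂^θ ‖f‖^(2-θ)`
(`IsMajorant.interNorm_sq_le`).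

Since `‖f*g‖₂ ≤ ‖T_f‖ ‖g‖₂`, applying the last inequality to powers of `f` bounds the spectral
radius in the algebra by that of `T_f` (`spectralRadius_inr_le`). This bound forces quasi-inverse
closedness: if `w = 1 - f` is invertible as an operator, a polynomial in `w*w` without scalar part
has operator norm below 1, so its spectral radius in the algebra is below 1 too, and a Neumann-type
argument inverts `w*w` (`isUnit_star_mul_self_of_spectralRadius_le`).

For `p > 1` one takes `σ = ωu`; a three-function Hölder inequality with small `θ` works because `s <
q` and `r > 0` leave room. For `p = 1` the exponents leave a fixed factor `ω²` to be integrated, so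
a better majorant is needed. By Markov's inequality `u ≤ K ω^(-δ)` off a set of small measure, and
writing `xy = (xv)(v⁻¹y)` with a suitable `v` where `ω` is bounded avoids that set. So `C ω^(1-δ)`
is a majorant (`exists_weight_mul_le`).

The group turns out to be unimodular (`modularCharacter_le_one`): integrability of `ω^(-t)` gives `Δ
≤ ω^t`, whereas approximate squaring doubles `log Δ` and multiplies `log ω` only by `2 - δ`, up to
constants.

Without second countability, multiplication need not be measurable for the product of the Borel
`σ`-algebras. Fubini is therefore carried out on the Baire `σ`-algebra and transferred back
(`IsMeasurableModel`). -/

lemma eventually_norm_pow_le_of_spectralRadius_lt {a : A} {c : ℝ} (hc : 0 < c)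
    (h : spectralRadius ℂ a < ENNReal.ofReal c) : ∀ᶠ n : ℕ in atTop, ‖a ^ n‖ ≤ c ^ n := by
  filter_upwards [(spectrum.pow_norm_pow_one_div_tendsto_nhds_spectralRadius a).eventually_lt_const h,
    eventually_gt_atTop 0] with n hn hn0
  rw [ENNReal.ofReal_lt_ofReal_iff hc] at hn
  have h2 := pow_le_pow_left₀ (by positivity) hn.le n
  rwa [one_div, Real.rpow_inv_natCast_pow (norm_nonneg _) hn0.ne'] at h2

lemma pow_le_norm_pow_of_le_spectralRadius (h1 : ‖(1 : A)‖ = 1) {a : A} {r : ℝ}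
    (h : ENNReal.ofReal r ≤ spectralRadius ℂ a) (hr : 0 ≤ r) (n : ℕ) :
    r ^ (n + 1) ≤ ‖a ^ (n + 1)‖ := by
  have h2 := h.trans (spectrum.spectralRadius_le_pow_nnnorm_pow_one_div ℂ a n)
  have h3 : ‖(1 : A)‖₊ = 1 := by ext; simpa using h1
  rw [h3, ENNReal.coe_one, ENNReal.one_rpow, mul_one, one_div] at h2
  have h4 := ENNReal.rpow_le_rpow h2 (z := (n + 1 : ℝ)) (by positivity)
  rw [ENNReal.rpow_inv_rpow (by positivity), ← Nat.cast_add_one, ENNReal.rpow_natCast,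
    ← ENNReal.ofReal_pow hr] at h4
  rw [← enorm_eq_nnnorm, ← ofReal_norm] at h4
  exact (ENNReal.ofReal_le_ofReal_iff (norm_nonneg _)).1 h4

end Gelfand

section Abstract

/-- The powers `a ^ (n + 1)` in a non-unital ring. -/
def succPow {R : Type*} [Mul R] (a : R) : ℕ → R
  | 0 => a
  | n + 1 => succPow a n * a

lemma inr_succPow {A : Type*} [NonUnitalRing A] [Module ℂ A] [IsScalarTower ℂ A A]
    [SMulCommClass ℂ A A] (a : A) (n : ℕ) :
    ((succPow a n : A) : Unitization ℂ A) = (a : Unitization ℂ A) ^ (n + 1) := by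
  induction n with
  | zero => simp [succPow]
  | succ n ih => rw [succPow, Unitization.inr_mul, ih, pow_succ _ (n + 1)]

lemma map_succPow {A B : Type*} [NonUnitalRing A] [Module ℂ A] [Ring B] [Algebra ℂ B]
    (φ : A →ₙₐ[ℂ] B) (a : A) (n : ℕ) : φ (succPow a n) = φ a ^ (n + 1) := by
  induction n with
  | zero => simp [succPow]
  | succ n ih => rw [succPow, map_mul, ih, pow_succ _ (n + 1)]

variable {A : Type*} [NonUnitalNormedRing A] [NormedSpace ℂ A] [IsScalarTower ℂ A A]
  [SMulCommClass ℂ A A] [CompleteSpace A]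
variable {B : Type*} [NormedRing B] [NormedAlgebra ℂ B] [CompleteSpace B]

/-- Applied to the power `a ^ (n+2)`, the estimate for squares bounds `‖a ^ (2n+4)‖` by a quantity
of growth rate `b^θ c^(2-θ)` per unit of `n`, with `b` just above the spectral radius of `φ a` and
`c` just above that of `a`. A gap between the two radii makes this rate smaller than the square of
the larger one. -/
lemma spectralRadius_inr_le (φ : A →ₙₐ[ℂ] B) (ν : A → ℝ) (hν0 : ∀ a, 0 ≤ ν a)
    (hν : ∀ a b, ν (a * b) ≤ ‖φ a‖ * ν b) (C θ : ℝ) (hC : 0 ≤ C) (hθ0 : 0 < θ) (hθ1 : θ < 1)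
    (hest : ∀ a, ‖a * a‖ ≤ C * ν a ^ θ * ‖a‖ ^ (2 - θ)) (a : A) :
    spectralRadius ℂ (a : Unitization ℂ A) ≤ spectralRadius ℂ (φ a) := by
  set x : WithLp 1 (Unitization ℂ A) := WithLp.toLp 1 (a : Unitization ℂ A) with hx
  have hsp : spectralRadius ℂ (a : Unitization ℂ A) = spectralRadius ℂ x := by
    unfold spectralRadius
    rw [← AlgEquiv.spectrum_eq (WithLp.unitizationAlgEquiv (𝕜 := ℂ) (A := A) ℂ) x]
    rfl
  have hone : ‖(1 : WithLp 1 (Unitization ℂ A))‖ = 1 := by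
    rw [WithLp.unitization_norm_def]
    have : (WithLp.ofLp (1 : WithLp 1 (Unitization ℂ A))) = (1 : Unitization ℂ A) := rfl
    simp [this]
  have hxn : ∀ n, ‖x ^ (n + 1)‖ = ‖succPow a n‖ := fun n => by
    rw [← WithLp.unitization_norm_inr (𝕜 := ℂ) (succPow a n), inr_succPow]
    rfl
  rw [hsp]
  by_contra! hlt
  have hxtop : spectralRadius ℂ x ≠ ∞ := by
    have : NormOneClass (WithLp 1 (Unitization ℂ A)) := ⟨hone⟩
    exact ne_top_of_le_ne_top ENNReal.coe_ne_top (spectrum.spectralRadius_le_nnnorm (𝕜 := ℂ) x)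
  set r := (spectralRadius ℂ x).toReal with hr
  have hrx : ENNReal.ofReal r = spectralRadius ℂ x := ENNReal.ofReal_toReal hxtop
  obtain ⟨b', hb1, hb2⟩ := exists_between hlt
  set b := b'.toReal with hb
  have hbb : ENNReal.ofReal b = b' := ENNReal.ofReal_toReal (hb2.trans_le le_top).ne
  have hb0 : 0 < b := ENNReal.toReal_pos (bot_le.trans_lt hb1).ne' (hb2.trans_le le_top).ne
  have hbr : b < r := by
    rw [← hbb, ← hrx] at hb2
    exact (ENNReal.ofReal_lt_ofReal_iff_of_nonneg hb0.le).1 hb2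
  have hr0 : 0 < r := hb0.trans hbr
  -- At `c = r` the inequality is strict because `b < r` and `θ > 0`. Continuity then allows some `c
  -- > r`, which is needed because Gelfand's formula bounds the powers only strictly above the
  -- spectral radius.
  obtain ⟨c, hrc, hc⟩ : ∃ c, r < c ∧ b ^ θ * c ^ (2 - θ) < r ^ 2 := by
    have hcont : Tendsto (fun c : ℝ => b ^ θ * c ^ (2 - θ)) (𝓝[>] r) (𝓝 (b ^ θ * r ^ (2 - θ))) :=
      ((Real.continuousAt_rpow_const r (2 - θ) (Or.inl hr0.ne')).tendsto.mono_left
        nhdsWithin_le_nhds).const_mul _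
    have hlt' : b ^ θ * r ^ (2 - θ) < r ^ 2 := by
      calc b ^ θ * r ^ (2 - θ) < r ^ θ * r ^ (2 - θ) := by
            have := Real.rpow_lt_rpow hb0.le hbr hθ0
            have h3 := Real.rpow_pos_of_pos hr0 (2 - θ)
            gcongr
        _ = r ^ 2 := by rw [← Real.rpow_add hr0]; norm_num
    obtain ⟨c, h1, h2⟩ := ((hcont.eventually_lt_const hlt').and self_mem_nhdsWithin).exists
    exact ⟨c, h2, h1⟩
  have hc0 : 0 < c := hr0.trans hrc
  have e1 := eventually_norm_pow_le_of_spectralRadius_lt hc0 (a := x)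
    (by rw [← hrx]; exact (ENNReal.ofReal_lt_ofReal_iff hc0).2 hrc)
  have e2 := eventually_norm_pow_le_of_spectralRadius_lt hb0 (a := φ a) (by rwa [hbb])
  set k := r ^ 2 / (b ^ θ * c ^ (2 - θ)) with hk
  have hbc : 0 < b ^ θ * c ^ (2 - θ) :=
    mul_pos (Real.rpow_pos_of_pos hb0 _) (Real.rpow_pos_of_pos hc0 _)
  have hk1 : 1 < k := (one_lt_div hbc).2 hc
  -- `succPow a (n + 1)` is `a ^ (n+2)`; one factor `a` is split off for `ν`, so only `φ a ^ (n+1)`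
  -- is estimated, and the missing factor `b` appears as `ν a / b`.
  have key : ∀ᶠ n : ℕ in atTop, k ^ (n + 2) ≤ C * (ν a / b) ^ θ := by
    have e1' := (tendsto_add_atTop_nat 2).eventually e1
    have e2' := (tendsto_add_atTop_nat 1).eventually e2
    filter_upwards [e1', e2'] with n h1 h2
    rw [hxn] at h1
    rw [← map_succPow] at h2
    have h3 : r ^ (n + 1 + n + 2 + 1) ≤ ‖x ^ (n + 1 + n + 2 + 1)‖ :=
      pow_le_norm_pow_of_le_spectralRadius hone hrx.le hr0.le _
    have h4 : ‖x ^ (n + 1 + n + 2 + 1)‖ = ‖succPow a (n + 1) * succPow a (n + 1)‖ := by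
      rw [← WithLp.unitization_norm_inr (𝕜 := ℂ) (_ * _), Unitization.inr_mul, inr_succPow,
        ← pow_add,
        show n + 1 + 1 + (n + 1 + 1) = n + 1 + n + 2 + 1 by ring]
      rfl
    have h5 : ν (succPow a (n + 1)) ≤ b ^ (n + 2) * (ν a / b) := by
      calc ν (succPow a (n + 1)) ≤ ‖φ (succPow a n)‖ * ν a := hν _ _
        _ ≤ b ^ (n + 1) * ν a := by gcongr; exact hν0 a
        _ = b ^ (n + 2) * (ν a / b) := by rw [pow_succ b (n + 1)]; field_simp
    have h6 : r ^ (n + 1 + n + 2 + 1)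
        ≤ C * (b ^ (n + 2) * (ν a / b)) ^ θ * (c ^ (n + 2)) ^ (2 - θ) := by
      rw [h4] at h3
      refine h3.trans ((hest _).trans ?_)
      have h7 : 0 ≤ 2 - θ := by linarith
      gcongr
      · have := div_nonneg (hν0 a) hb0.le
        positivity
      · exact hν0 _
    have h8 : ∀ (y z : ℝ), 0 ≤ y → (y ^ (n + 2)) ^ z = (y ^ z) ^ (n + 2) := fun y z hy => by
      rw [← Real.rpow_natCast, ← Real.rpow_natCast, ← Real.rpow_mul hy, ← Real.rpow_mul hy, mul_comm]
    rw [Real.mul_rpow (by positivity) (div_nonneg (hν0 a) hb0.le), h8 _ _ hb0.le,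
      h8 _ _ hc0.le] at h6
    rw [hk, div_pow, div_le_iff₀ (by positivity)]
    calc (r ^ 2) ^ (n + 2) = r ^ (n + 1 + n + 2 + 1) := by ring
      _ ≤ _ := h6
      _ = _ := by rw [mul_pow]; ring
  have h9 : Tendsto (fun n : ℕ => k ^ (n + 2)) atTop atTop :=
    (tendsto_pow_atTop_atTop_of_one_lt hk1).comp (tendsto_add_atTop_nat 2)
  obtain ⟨n, hn1, hn2⟩ := (key.and (h9.eventually_gt_atTop (C * (ν a / b) ^ θ))).exists
  exact absurd hn1 (not_le.2 hn2)

end Abstract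

/-! ### Invertibility transferred from a C*-algebra -/

section CStar

variable {A : Type*} [NonUnitalRing A] [StarRing A] [Module ℂ A] [IsScalarTower ℂ A A]
  [SMulCommClass ℂ A A]
variable {B : Type*} [CStarAlgebra B]

/-- On the spectrum `(1 - ηt)^n` lies strictly between 0 and 1, and `α < 1/2` keeps `((1 - ηt)^n -
α)/(1 - α)` above `-1`. -/
lemma norm_smul_pow_sub_lt_one {b : B} (hb : IsSelfAdjoint b) {η α : ℝ} (hη : 0 < η) {n : ℕ}
    (hn : n ≠ 0) (hα : 0 < α ∧ α < 1 / 2) (h : ∀ t ∈ spectrum ℝ b, 0 < t ∧ η * t < 1) :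
    ‖(1 - α)⁻¹ • ((1 - η • b) ^ n - algebraMap ℝ B α)‖ < 1 := by
  have hcfc : (1 - α)⁻¹ • ((1 - η • b) ^ n - algebraMap ℝ B α)
      = cfc (fun t : ℝ => (1 - α)⁻¹ * ((1 - η * t) ^ n - α)) b := by
    have h1 := cfc_polynomial (R := ℝ) (Polynomial.C (1 - α)⁻¹ *
      ((1 - Polynomial.C η * Polynomial.X) ^ n - Polynomial.C α)) b hb
    have h2 : ∀ t : ℝ, (Polynomial.C (1 - α)⁻¹ *
      ((1 - Polynomial.C η * Polynomial.X) ^ n - Polynomial.C α)).eval t =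
        (1 - α)⁻¹ * ((1 - η * t) ^ n - α) := fun t => by simp
    simp only [h2] at h1
    rw [h1]
    simp [Algebra.smul_def]
  rw [hcfc]
  refine norm_cfc_lt one_pos fun t ht => ?_
  obtain ⟨ht0, h1⟩ := h t ht
  have h2 : 0 < η * t := by positivity
  have h3 : 0 < (1 - η * t) ^ n := pow_pos (by linarith) n
  have h4 : (1 - η * t) ^ n < 1 := pow_lt_one₀ (by linarith) (by linarith) hn
  obtain ⟨h5, h6⟩ := hα
  rw [Real.norm_eq_abs, abs_mul, abs_of_pos (by rw [inv_pos]; linarith),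
    inv_mul_lt_iff₀ (by linarith), abs_lt]
  constructor <;> linarith

/-- The hypothesis `hρ` concerns only elements without scalar part. So `1 - η y` is raised to a
power and its scalar part subtracted: the result `P` lies in `A`, has small image by functional
calculus, and `1 - P` is a multiple of `y`. -/
lemma isUnit_star_mul_self_of_spectralRadius_le (φ : A →⋆ₙₐ[ℂ] B)
    (hρ : ∀ a : A, spectralRadius ℂ (a : Unitization ℂ A) ≤ spectralRadius ℂ (φ a))
    (w : Unitization ℂ A) (hw1 : w.fst = 1) (hw : IsUnit (Unitization.starLift φ w)) :
    IsUnit (star w * w) := by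
  set Φ := Unitization.starLift φ with hΦ
  set y := star w * w with hy
  set b := Φ y with hb
  have hbw : b = star (Φ w) * Φ w := by rw [hb, hy, map_mul, map_star]
  have hbsa : IsSelfAdjoint b := by rw [hbw]; exact IsSelfAdjoint.star_mul_self _
  have hbu : IsUnit b := by rw [hbw]; exact hw.star.mul hw
  have hpos : ∀ t ∈ spectrum ℝ b, 0 < t := by
    intro t ht
    have h0 : 0 ≤ t := by
      rw [hbw] at ht
      exact spectrum_star_mul_self_nonneg _ ht
    refine lt_of_le_of_ne h0 ?_
    rintro rfl
    exact spectrum.zero_notMem ℝ hbu ht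
  -- `R` bounds the spectrum of `b`, and the factor `‖1‖` allows for trivial `B`. With `η = 1/(2R)`,
  -- `ηt ≤ 1/2` on the spectrum, and `R ≥ 1` keeps `η ≤ 1/2`.
  set R := ‖b‖ * ‖(1 : B)‖ + 1 with hR
  have hR1 : 1 ≤ R := by rw [hR]; have := mul_nonneg (norm_nonneg b) (norm_nonneg (1 : B)); linarith
  have hle : ∀ t ∈ spectrum ℝ b, t ≤ R := by
    intro t ht
    have := spectrum.norm_le_norm_mul_of_mem ht
    rw [Real.norm_eq_abs] at this
    have := le_abs_self t
    linarith
  set η := 1 / (2 * R) with hη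
  have hη0 : 0 < η := by positivity
  have hη1 : η ≤ 1 / 2 := by
    rw [hη]
    exact one_div_le_one_div_of_le (by norm_num) (by linarith)
  obtain ⟨n, hn⟩ := exists_pow_lt_of_lt_one (show (0 : ℝ) < 1 / 2 by norm_num)
    (show 1 - η < 1 by linarith)
  have hn0 : n ≠ 0 := by
    rintro rfl
    norm_num at hn
  -- Since `y` has scalar part 1, this is exactly the scalar part of `(1 - η y)^n`.
  set α := (1 - η) ^ n with hα
  have hα0 : 0 < α := pow_pos (by linarith) n
  have hyfst : y.fst = 1 := by simp [hy, hw1]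
  set z : Unitization ℂ A := 1 - (η : ℂ) • y with hz
  set P : Unitization ℂ A := ((1 - α : ℝ) : ℂ)⁻¹ • (z ^ n - algebraMap ℂ _ (α : ℂ)) with hP
  have hα1 : ((1 - α : ℝ) : ℂ) ≠ 0 := by
    norm_cast
    linarith
  have hPfst : P.fst = 0 := by
    have h1 : z.fst = 1 - η := by
      change Unitization.fstHom ℂ A z = _
      rw [hz, map_sub, map_one, map_smul]
      change 1 - (η : ℂ) • y.fst = _
      simp [hyfst]
    change Unitization.fstHom ℂ A P = 0
    rw [hP, map_smul, map_sub, map_pow, AlgHomClass.commutes]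
    change _ • (z.fst ^ n - (α : ℂ)) = 0
    rw [h1, hα]
    push_cast
    simp
  have hPinr : (P.snd : Unitization ℂ A) = P := by
    ext
    · simp [hPfst]
    · simp
  have hΦinr : Φ P = φ P.snd := by
    conv_lhs => rw [← hPinr]
    exact DFunLike.congr_fun (Unitization.starLift.symm_apply_apply φ) P.snd
  have hΦP : Φ P = (1 - α)⁻¹ • ((1 - η • b) ^ n - algebraMap ℝ B α) := by
    rw [hP, hz]
    simp only [map_smul, map_sub, map_pow, map_one, AlgHomClass.commutes]
    rw [← Complex.ofReal_inv, Complex.coe_smul, Complex.coe_smul]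
    rfl
  have hnorm : ‖Φ P‖ < 1 := by
    rw [hΦP]
    refine norm_smul_pow_sub_lt_one hbsa hη0 hn0 ⟨hα0, hn⟩ (fun t ht => ?_)
    refine ⟨hpos t ht, ?_⟩
    calc η * t ≤ η * R := by gcongr; exact hle t ht
      _ = 1 / 2 := by rw [hη]; field_simp
      _ < 1 := by norm_num
  have hspec : spectralRadius ℂ P < 1 := by
    rw [← hPinr]
    refine (hρ _).trans_lt ?_
    rw [← hΦinr]
    rcases subsingleton_or_nontrivial B with hB | hB
    · simp [spectralRadius]
    · refine (spectrum.spectralRadius_le_nnnorm (𝕜 := ℂ) (Φ P)).trans_lt ?_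
      rw [← ENNReal.coe_one, ENNReal.coe_lt_coe]
      exact hnorm
  have h1P : IsUnit (1 - P) := by
    have : (1 : ℂ) ∈ resolventSet ℂ P := by
      refine spectrum.mem_resolventSet_of_spectralRadius_lt ?_
      simpa using hspec
    simpa [spectrum.mem_resolventSet_iff] using this
  -- `1 - P = (1 - z^n)/(1 - α)` and `1 - z = η y`, so the geometric sum exhibits `y` as a commuting
  -- factor of a unit.
  have hfac : 1 - P = ((((1 - α : ℝ) : ℂ)⁻¹ * (η : ℂ)) • ∑ i ∈ Finset.range n, z ^ i) * y := by
    have hg : (∑ i ∈ Finset.range n, z ^ i) * (1 - z) = 1 - z ^ n := geom_sum_mul_neg z n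
    have hzy : 1 - z = (η : ℂ) • y := by rw [hz]; abel
    rw [hzy] at hg
    have h1 : (1 : Unitization ℂ A) - P = ((1 - α : ℝ) : ℂ)⁻¹ • (1 - z ^ n) := by
      rw [hP, Algebra.algebraMap_eq_smul_one, ← sub_eq_zero]
      have : (1 : Unitization ℂ A) = ((1 - α : ℝ) : ℂ)⁻¹ • ((1 - α : ℝ) : ℂ) • 1 := by
        rw [smul_smul, inv_mul_cancel₀ hα1, one_smul]
      nth_rewrite 1 [this]
      rw [← smul_sub, ← smul_sub]
      convert smul_zero _
      push_cast
      rw [sub_smul, one_smul]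
      abel
    rw [h1, ← hg, mul_smul_comm, smul_mul_assoc, smul_smul]
  have hcomm : Commute ((((1 - α : ℝ) : ℂ)⁻¹ * (η : ℂ)) • ∑ i ∈ Finset.range n, z ^ i) y := by
    refine Commute.smul_left ?_ _
    refine Commute.sum_left _ _ _ fun i _ => ?_
    refine Commute.pow_left ?_ i
    rw [hz]
    exact (Commute.one_left y).sub_left ((Commute.refl y).smul_left _)
  rw [hfac] at h1P
  exact (hcomm.isUnit_mul_iff.1 h1P).2

/-- Invertibility of `w* w` gives a left inverse of `w`, that of `w w*` a right inverse. -/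
lemma isUnit_of_isUnit_starLift [StarModule ℂ A] (φ : A →⋆ₙₐ[ℂ] B)
    (hρ : ∀ a : A, spectralRadius ℂ (a : Unitization ℂ A) ≤ spectralRadius ℂ (φ a))
    (w : Unitization ℂ A) (hw1 : w.fst = 1) (hw : IsUnit (Unitization.starLift φ w)) :
    IsUnit w := by
  have h1 := isUnit_star_mul_self_of_spectralRadius_le φ hρ w hw1 hw
  have h2 := isUnit_star_mul_self_of_spectralRadius_le φ hρ (star w) (by simp [hw1])
    (by rw [map_star]; exact hw.star)
  rw [star_star] at h2
  obtain ⟨a, ha⟩ := h1.exists_left_inv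
  obtain ⟨b, hb⟩ := h2.exists_right_inv
  exact isUnit_iff_exists_and_exists.2
    ⟨⟨star w * b, by rw [← mul_assoc]; exact hb⟩, ⟨a * star w, by rw [mul_assoc]; exact ha⟩⟩

/-- `IsQuasiregular` uses the circle product `x + y + xy`; the change of sign matches it with `a + b
- ab`. -/
lemma isQuasiregular_neg_iff {A : Type*} [NonUnitalRing A] (x : A) :
    IsQuasiregular (-x) ↔ ∃ b, IsQuasiInverse (fun x y : A => x * y) x b := by
  rw [isQuasiregular_iff]
  constructor
  · rintro ⟨y, h1, h2⟩
    refine ⟨-y, ?_, ?_⟩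
    · simp only [quasiProd]
      rw [← neg_eq_zero, ← h1]
      simp only [mul_neg, neg_mul]
      abel
    · simp only [quasiProd]
      rw [← neg_eq_zero, ← h2]
      simp only [mul_neg, neg_mul]
      abel
  · rintro ⟨y, h1, h2⟩
    simp only [quasiProd] at h1 h2
    refine ⟨-y, ?_, ?_⟩
    · rw [← neg_eq_zero, ← h1]
      simp only [mul_neg, neg_mul]
      abel
    · rw [← neg_eq_zero, ← h2]
      simp only [mul_neg, neg_mul]
      abel

lemma quasiSpectrum_eq_quasispectrum {A : Type*} [NonUnitalRing A] [Module ℂ A] (x : A) :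
    quasiSpectrum (fun x y : A => x * y) x = quasispectrum ℂ x := by
  ext z
  simp only [quasiSpectrum, quasispectrum, Set.mem_union, Set.mem_singleton_iff,
    Set.mem_ofPred_eq, isQuasiregular_neg_iff, isUnit_iff_ne_zero]
  constructor
  · rintro (rfl | ⟨h0, h⟩) hz
    · exact absurd rfl hz
    · convert h
      simp [Units.smul_def]
  · intro h
    by_cases hz : z = 0
    · exact Or.inl hz
    · refine Or.inr ⟨hz, ?_⟩
      convert h hz
      simp [Units.smul_def]

end CStar

/-- The auxiliary seminorm-like function `ν` (later the `L²` norm) links the norm of the algebra to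
the operator norm. The two axiom structures are turned into instances on `V` so that the results
above apply. -/
theorem isQuasiInverseClosed_and_spectralRadius_eq {V : Type*} [AddCommGroup V] [Module ℂ V]
    {N : V → ℝ} {mul : V → V → V} {star : V → V}
    {H : Type*} [NormedAddCommGroup H] [InnerProductSpace ℂ H] [CompleteSpace H]
    {T : V → (H →L[ℂ] H)} (hA : IsBanachStarAlgebra N mul star) (hT : IsStarEmbedding N mul star T)
    (ν : V → ℝ) (hν0 : ∀ a, 0 ≤ ν a) (hν : ∀ a b, ν (mul a b) ≤ ‖T a‖ * ν b)
    (C θ : ℝ) (hC : 0 ≤ C) (hθ0 : 0 < θ) (hθ1 : θ < 1)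
    (hest : ∀ a, N (mul a a) ≤ C * ν a ^ θ * N a ^ (2 - θ)) :
    IsQuasiInverseClosed mul T ∧
      ∀ f : V, quasiSpectralRadius mul f = spectralRadius ℂ (T f) := by
  obtain ⟨D', hD'⟩ := hA.norm_mul_le
  -- `N` is submultiplicative only up to a constant, whereas `D * N` is genuinely so; `D ≥ 1` gives
  -- `N ≤ D * N`, which keeps the estimate for squares.
  set D := max D' 1 with hD
  have hD1 : 1 ≤ D := le_max_right _ _
  have hDmul : ∀ a b, N (mul a b) ≤ D * N a * N b := fun a b => by
    refine (hD' a b).trans ?_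
    have h1 := hA.norm_nonneg a
    have h2 := hA.norm_nonneg b
    gcongr
    exact le_max_left _ _
  let : Norm V := ⟨fun a => D * N a⟩
  have hnorm : ∀ a : V, ‖a‖ = D * N a := fun _ => rfl
  let nacg : NormedAddCommGroup V := NormedAddCommGroup.ofCore (𝕜 := ℂ)
    { norm_nonneg := fun a => mul_nonneg (by linarith) (hA.norm_nonneg a)
      norm_smul := fun c a => by rw [hnorm, hnorm, hA.norm_smul]; ring
      norm_triangle := fun a b => by
        rw [hnorm, hnorm, hnorm, ← mul_add]
        gcongr
        exact hA.norm_add_le a b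
      norm_eq_zero_iff := fun a => by
        rw [hnorm, mul_eq_zero, hA.norm_eq_zero]
        simp only [or_iff_right_iff_imp]
        intro h
        linarith }
  let ring : NonUnitalNormedRing V :=
    { nacg with
      mul := mul
      left_distrib := hA.mul_add
      right_distrib := hA.add_mul
      zero_mul := fun a => by
        have := hA.add_mul 0 0 a
        rw [add_zero] at this
        exact left_eq_add.1 this
      mul_zero := fun a => by
        have := hA.mul_add a 0 0
        rw [add_zero] at this
        exact left_eq_add.1 this
      mul_assoc := hA.mul_assoc
      norm_mul_le := fun a b => by
        change D * N (mul a b) ≤ D * N a * (D * N b)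
        have := hDmul a b
        calc D * N (mul a b) ≤ D * (D * N a * N b) := by gcongr
          _ = _ := by ring }
  have hmul : ∀ a b : V, a * b = mul a b := fun _ _ => rfl
  have hsmul : ∀ (c : ℂ) (a : V), ‖c • a‖ ≤ ‖c‖ * ‖a‖ := fun c a => by
    rw [hnorm, hnorm, hA.norm_smul]
    exact le_of_eq (by ring)
  let : NormedSpace ℂ V := { norm_smul_le := hsmul }
  have : IsScalarTower ℂ V V := ⟨fun z a b => hA.smul_mul z a b⟩
  have : SMulCommClass ℂ V V := ⟨fun z a b => (hA.mul_smul z a b).symm⟩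
  let : StarRing V :=
    { star := star
      star_involutive := hA.star_star
      star_mul := hA.star_mul
      star_add := hA.star_add }
  have : StarModule ℂ V := ⟨hA.star_smul⟩
  have : CompleteSpace V := by
    refine Metric.complete_of_cauchySeq_tendsto fun a ha => ?_
    obtain ⟨b, hb⟩ := hA.complete a fun ε hε => by
      obtain ⟨K, hK⟩ := Metric.cauchySeq_iff.1 ha ε hε
      refine ⟨K, fun m n hm hn => ?_⟩
      have h1 := hK m hm n hn
      rw [dist_eq_norm, hnorm] at h1
      have h2 := hA.norm_nonneg (a m - a n)
      nlinarith
    refine ⟨b, tendsto_iff_norm_sub_tendsto_zero.2 ?_⟩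
    simpa [hnorm] using hb.const_mul D
  let φ : V →⋆ₙₐ[ℂ] (H →L[ℂ] H) :=
    { toFun := T
      map_smul' := hT.map_smul
      map_zero' := by
        have := hT.map_add 0 0
        rw [add_zero] at this
        exact left_eq_add.1 this
      map_add' := hT.map_add
      map_mul' := hT.map_mul
      map_star' := hT.map_star }
  have hφ : ∀ a, φ a = T a := fun _ => rfl
  have hρ : ∀ a : V, spectralRadius ℂ (a : Unitization ℂ V) ≤ spectralRadius ℂ (φ a) := by
    refine spectralRadius_inr_le (φ : V →ₙₐ[ℂ] (H →L[ℂ] H)) ν hν0 hν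
      (D * C) θ (by positivity) hθ0 hθ1 fun a => ?_
    rw [hnorm, hnorm]
    have h1 : N a ≤ D * N a := by
      have := hA.norm_nonneg a
      nlinarith
    calc D * N (a * a) ≤ D * (C * ν a ^ θ * N a ^ (2 - θ)) := by gcongr; exact hest a
      _ ≤ D * (C * ν a ^ θ * (D * N a) ^ (2 - θ)) := by
        have := Real.rpow_nonneg (hν0 a) θ
        have := hA.norm_nonneg a
        gcongr
        linarith
      _ = _ := by ring
  have hclosed : IsQuasiInverseClosed mul T := by
    intro a b hab
    obtain ⟨h1, h2⟩ := hab
    simp only [quasiProd] at h1 h2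
    have e1 : (1 - T a) * (1 - b) = 1 := by
      rw [← sub_eq_zero, ← neg_eq_zero, ← h1]
      noncomm_ring
    have e2 : (1 - b) * (1 - T a) = 1 := by
      rw [← sub_eq_zero, ← neg_eq_zero, ← h2]
      noncomm_ring
    have hu : IsUnit (1 - (a : Unitization ℂ V)) := by
      refine isUnit_of_isUnit_starLift φ hρ _ ?_ ?_
      · change Unitization.fstHom ℂ V (1 - (a : Unitization ℂ V)) = 1
        rw [map_sub, map_one]
        change 1 - (a : Unitization ℂ V).fst = 1
        simp
      · rw [map_sub, map_one]
        have : Unitization.starLift φ (a : Unitization ℂ V) = T a :=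
          DFunLike.congr_fun (Unitization.starLift.symm_apply_apply φ) a
        rw [this]
        exact ⟨⟨_, _, e1, e2⟩, rfl⟩
    have hq : IsQuasiregular (-a) := by
      rw [isQuasiregular_iff_isUnit' ℂ, Unitization.inr_neg, ← sub_eq_add_neg]
      exact hu
    obtain ⟨a₀, ha₀⟩ := (isQuasiregular_neg_iff a).1 hq
    refine ⟨a₀, ?_, ha₀⟩
    -- `1 - T a₀` and `1 - b` both invert `1 - T a`, hence coincide.
    have e3 : (1 - T a₀) * (1 - T a) = 1 := by
      have h3 : T (a₀ + a - mul a₀ a) = 0 := by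
        have : a₀ + a - mul a₀ a = 0 := ha₀.2
        rw [this]
        exact map_zero φ
      have h4 : T (a₀ + a - mul a₀ a) = T a₀ + T a - T a₀ * T a := by
        rw [← hT.map_mul, ← hT.map_add]
        exact map_sub φ _ _
      rw [← sub_eq_zero, ← neg_eq_zero, ← h3, h4]
      noncomm_ring
    have e4 : 1 - T a₀ = 1 - b := left_inv_eq_right_inv e3 e1
    exact sub_right_injective e4
  refine ⟨hclosed, fun f => ?_⟩
  have h1 : quasiSpectralRadius mul f = spectralRadius ℂ (f : Unitization ℂ V) := by
    have h2 := quasiSpectrum_eq_quasispectrum f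
    rw [Unitization.quasispectrum_eq_spectrum_inr] at h2
    change quasiSpectrum mul f = _ at h2
    simp only [quasiSpectralRadius, h2, spectralRadius]
  rw [h1]
  refine le_antisymm (hρ f) ?_
  -- The reverse inequality is general: homomorphisms do not enlarge quasispectra.
  have h3 : spectrum ℂ (φ f) ⊆ spectrum ℂ (f : Unitization ℂ V) := by
    rw [← Unitization.quasispectrum_eq_spectrum_inr]
    exact (spectrum_subset_quasispectrum ℂ (φ f)).trans
      (NonUnitalAlgHom.quasispectrum_apply_subset φ f)
  exact biSup_mono h3

/-! ### Integrability consequences of the hypothesis on `u` and `ω` -/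

lemma sigmaFinite_of_integrable_pos {α : Type*} [MeasurableSpace α] {μ : Measure α} {f : α → ℝ}
    (hf : Integrable f μ) (h0 : ∀ x, 0 < f x) : SigmaFinite μ := by
  refine ⟨⟨⟨fun n : ℕ => {x | 1 / ((n : ℝ) + 1) < f x}, fun _ => trivial, fun n => ?_, ?_⟩⟩⟩
  · exact hf.measure_gt_lt_top (by positivity)
  · refine Set.eq_univ_of_forall fun x => ?_
    obtain ⟨n, hn⟩ := exists_nat_one_div_lt (h0 x)
    exact Set.mem_iUnion.2 ⟨n, hn⟩

section Integrability

variable {α : Type*} [MeasurableSpace α] {μ : Measure α} {ω u : α → ℝ}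

/-- The exponent of `u` may grow because `u` is bounded, and that of `ω` may shrink because `ω ≥ 1`.
-/
lemma integrable_rpow_mul_rpow_of_le (hω : AEMeasurable ω μ) (hω1 : ∀ x, 1 ≤ ω x)
    (hu : AEMeasurable u μ) (hu0 : ∀ x, 0 < u x) {M : ℝ} (hM : ∀ x, u x ≤ M) {s r s' r' : ℝ}
    (hs : s ≤ s') (hr : r' ≤ r) (hint : Integrable (fun x => u x ^ s * ω x ^ r) μ) :
    Integrable (fun x => u x ^ s' * ω x ^ r') μ := by
  refine (hint.const_mul (M ^ (s' - s))).mono'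
    ((hu.pow_const _).mul (hω.pow_const _)).aestronglyMeasurable (ae_of_all _ fun x => ?_)
  have h0 := hu0 x
  have h1 := hω1 x
  have hω0 : 0 < ω x := by linarith
  rw [Real.norm_of_nonneg (by positivity)]
  have h2 : u x ^ s' = u x ^ (s' - s) * u x ^ s := by rw [← Real.rpow_add h0]; simp
  have h3 : u x ^ (s' - s) ≤ M ^ (s' - s) := Real.rpow_le_rpow h0.le (hM x) (by linarith)
  have h4 : ω x ^ r' ≤ ω x ^ r := Real.rpow_le_rpow_of_exponent_le h1 hr
  have h5 : 0 ≤ M := h0.le.trans (hM x)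
  rw [h2]
  calc u x ^ (s' - s) * u x ^ s * ω x ^ r' ≤ M ^ (s' - s) * u x ^ s * ω x ^ r := by gcongr
    _ = _ := by ring

/-- From `u ≥ c/ω` one gets `ω^(r-s) ≤ c^(-s) u^s ω^r`. -/
lemma integrable_rpow_neg_of_le_mul (hω : AEMeasurable ω μ) (hω1 : ∀ x, 1 ≤ ω x)
    {c : ℝ} (hc : 0 < c) (hcu : ∀ x, c ≤ ω x * u x) {s r : ℝ} (hs : 0 ≤ s)
    (hint : Integrable (fun x => u x ^ s * ω x ^ r) μ) :
    Integrable (fun x => ω x ^ (-(s - r))) μ := by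
  refine (hint.const_mul (c ^ (-s))).mono' (hω.pow_const _).aestronglyMeasurable
    (ae_of_all _ fun x => ?_)
  have h1 := hω1 x
  have hω0 : 0 < ω x := by linarith
  have hu0 : 0 < u x := by
    have := hc.trans_le (hcu x)
    exact pos_of_mul_pos_right this hω0.le
  rw [Real.norm_of_nonneg (by positivity)]
  have h2 : c ^ s ≤ ω x ^ s * u x ^ s := by
    rw [← Real.mul_rpow hω0.le hu0.le]
    exact Real.rpow_le_rpow hc.le (hcu x) hs
  have h3 : ω x ^ (-(s - r)) = ω x ^ (-s) * ω x ^ r := by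
    rw [← Real.rpow_add hω0]
    congr 1
    ring
  rw [h3, ← mul_assoc]
  gcongr
  rw [Real.rpow_neg hω0.le, Real.rpow_neg hc.le, inv_mul_eq_div, le_div_iff₀ (by positivity),
    inv_mul_le_iff₀ (by positivity)]
  exact h2

end Integrability

lemma mul_mul_add_le_of_le_rpow {a b ua ub K δ : ℝ} (ha : 1 ≤ a) (hb : 1 ≤ b)
    (hua : ua ≤ K * a ^ (-δ)) (hub : ub ≤ K * b ^ (-δ)) :
    a * b * (ua + ub) ≤ K * (a ^ (1 - δ) * b + a * b ^ (1 - δ)) := by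
  have ha0 : 0 < a := by linarith
  have hb0 : 0 < b := by linarith
  have h1 : a ^ (1 - δ) = a * a ^ (-δ) := by
    rw [sub_eq_add_neg, Real.rpow_add ha0, Real.rpow_one]
  have h2 : b ^ (1 - δ) = b * b ^ (-δ) := by
    rw [sub_eq_add_neg, Real.rpow_add hb0, Real.rpow_one]
  calc a * b * (ua + ub) ≤ a * b * (K * a ^ (-δ) + K * b ^ (-δ)) := by gcongr
    _ = _ := by rw [h1, h2]; ring

/-- Outside a set of small measure, `u` is dominated by a negative power of `ω`. -/
lemma exists_measure_lt_of_integrable {α : Type*} [MeasurableSpace α] {μ : Measure α}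
    [NeZero μ] {ω u : α → ℝ} (hω1 : ∀ x, 1 ≤ ω x) (hu0 : ∀ x, 0 < u x)
    {s r : ℝ} (hs : 0 < s)
    (hint : Integrable (fun x => u x ^ s * ω x ^ r) μ) :
    ∃ n K : ℝ, 1 ≤ n ∧ 0 < K ∧ 2 * μ {x | K * ω x ^ (-(r / s)) < u x} < μ {x | ω x ≤ n} := by
  have hω0 : ∀ x, 0 < ω x := fun x => one_pos.trans_le (hω1 x)
  obtain ⟨n, hn⟩ : ∃ n : ℕ, μ {x | ω x ≤ n} ≠ 0 := by
    by_contra! h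
    have h1 : μ (⋃ n : ℕ, {x | ω x ≤ n}) = 0 := measure_iUnion_null h
    have h2 : (⋃ n : ℕ, {x | ω x ≤ n}) = Set.univ :=
      Set.eq_univ_of_forall fun x => Set.mem_iUnion.2 (exists_nat_ge (ω x))
    rw [h2] at h1
    exact NeZero.ne μ (Measure.measure_univ_eq_zero.1 h1)
  set I := ∫⁻ x, ENNReal.ofReal (u x ^ s * ω x ^ r) ∂μ with hI
  have hItop : I ≠ ∞ := by
    rw [hI, ← ofReal_integral_eq_lintegral_ofReal hint
      (ae_of_all _ fun x => by have := hu0 x; have := hω0 x; positivity)]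
    exact ENNReal.ofReal_ne_top
  have hlim : Tendsto (fun K : ℝ => 2 * (I / ENNReal.ofReal (K ^ s))) atTop (𝓝 (2 * (I / ∞))) := by
    refine ENNReal.Tendsto.const_mul ?_ (Or.inr (by simp))
    refine ENNReal.Tendsto.div tendsto_const_nhds (Or.inr (by simp)) ?_ (Or.inr hItop)
    exact ENNReal.tendsto_ofReal_atTop.comp (tendsto_rpow_atTop hs)
  rw [ENNReal.div_top, mul_zero] at hlim
  obtain ⟨K, hK1, hK2⟩ := ((hlim.eventually_lt_const (pos_iff_ne_zero.2 hn)).and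
    (eventually_gt_atTop 0)).exists
  refine ⟨max n 1, K, le_max_right _ _, hK2, ?_⟩
  -- On this set `u^s ω^r ≥ K^s`, so Markov's inequality bounds its measure by `I / K^s`, which is
  -- small for large `K`.
  calc 2 * μ {x | K * ω x ^ (-(r / s)) < u x} ≤ 2 * (I / ENNReal.ofReal (K ^ s)) := by
        gcongr
        have hKs : 0 < K ^ s := by positivity
        refine le_trans (measure_mono fun x hx => ?_) (meas_ge_le_lintegral_div
          hint.aestronglyMeasurable.aemeasurable.ennreal_ofReal
          (ENNReal.ofReal_pos.2 hKs).ne' ENNReal.ofReal_ne_top)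
        have h0 := hω0 x
        refine ENNReal.ofReal_le_ofReal ?_
        have h1 : (K * ω x ^ (-(r / s))) ^ s ≤ u x ^ s :=
          Real.rpow_le_rpow (by positivity) (le_of_lt hx) hs.le
        rw [Real.mul_rpow hK2.le (by positivity), ← Real.rpow_mul h0.le, neg_mul,
          div_mul_cancel₀ _ hs.ne', Real.rpow_neg h0.le, ← div_eq_mul_inv,
          div_le_iff₀ (by positivity)] at h1
        exact h1
    _ < μ {x | ω x ≤ n} := hK1
    _ ≤ _ := measure_mono fun x (hx : ω x ≤ n) => hx.trans (le_max_left _ _)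

/-! ### Avoiding a small set by translation -/

section Haar

variable {G : Type*} [Group G] [TopologicalSpace G] [IsTopologicalGroup G] [MeasurableSpace G]
  [BorelSpace G] {μ : Measure G} [μ.IsHaarMeasure] {ω u : G → ℝ}

/-- Two left translates of `D` have total measure `2 μ D`, too little to cover `V`. Only left
invariance is used, so this is available before unimodularity. -/
lemma exists_mem_of_two_mul_measure_lt {D V : Set G} (h : 2 * μ D < μ V) (x y : G) :
    ∃ v ∈ V, x * v ∉ D ∧ y * v ∉ D := by
  by_contra! hc
  have h1 : V ⊆ ((x * ·) ⁻¹' D) ∪ ((y * ·) ⁻¹' D) := fun v hv => by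
    by_cases hx : x * v ∈ D
    · exact Or.inl hx
    · exact Or.inr (hc v hv hx)
  have h2 := (measure_mono h1).trans (measure_union_le (μ := μ) _ _)
  rw [measure_preimage_mul, measure_preimage_mul, ← two_mul] at h2
  exact absurd h (not_lt.2 h2)

lemma exists_mem_of_two_mul_measure_lt' [μ.IsInvInvariant] {D V : Set G} (h : 2 * μ D < μ V)
    (x y : G) : ∃ v ∈ V, x * v ∉ D ∧ v⁻¹ * y ∉ D := by
  by_contra! hc
  have h1 : V ⊆ ((x * ·) ⁻¹' D) ∪ ((y⁻¹ * ·) ⁻¹' (Inv.inv ⁻¹' D)) := fun v hv => by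
    by_cases hx : x * v ∈ D
    · exact Or.inl hx
    · exact Or.inr (by simpa using hc v hv hx)
  have h2 := (measure_mono h1).trans (measure_union_le (μ := μ) _ _)
  rw [measure_preimage_mul, measure_preimage_mul, Measure.measure_preimage_inv, ← two_mul] at h2
  exact absurd h (not_lt.2 h2)

/-- In `xy = (xv)(v⁻¹y)` the element `v` is chosen with `ω v ≤ n` and with both factors outside the
set where `u > K ω^(-δ)`. There the hypothesis on `u` yields the gain `ω^(-δ)`, and returning to `x`
and `y` costs only powers of `n`. -/
lemma exists_weight_mul_le [μ.IsInvInvariant] (hω : IsWeight μ ω) (hω1 : ∀ x, 1 ≤ ω x)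
    (hu0 : ∀ x, 0 < u x) {s r : ℝ} (hr : 0 < r) (hrs : r < s)
    (hωu : ∀ x y, ω (x * y) / (ω x * ω y) ≤ u x + u y)
    (hint : Integrable (fun x => u x ^ s * ω x ^ r) μ) :
    ∃ C : ℝ, 0 < C ∧
      ∀ x y, ω (x * y) ≤ C * ω x ^ (1 - r / s) * ω y + ω x * (C * ω y ^ (1 - r / s)) := by
  have hω0 : ∀ x, 0 < ω x := fun x => one_pos.trans_le (hω1 x)
  obtain ⟨n, K, hn1, hK, hV⟩ := exists_measure_lt_of_integrable hω1 hu0 (hr.trans hrs) hint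
  set δ := r / s with hδ
  have hδ0 : 0 < δ := div_pos hr (hr.trans hrs)
  have hδ1 : δ < 1 := (div_lt_one (hr.trans hrs)).2 hrs
  have hn0 : 0 < n := by linarith
  refine ⟨K * n * n, by positivity, fun x y => ?_⟩
  obtain ⟨v, hv, hv1, hv2⟩ := exists_mem_of_two_mul_measure_lt' hV x y
  have h1 := hωu (x * v) (v⁻¹ * y)
  rw [div_le_iff₀ (mul_pos (hω0 _) (hω0 _)), mul_comm,
    show x * v * (v⁻¹ * y) = x * y by group] at h1
  have h2 := mul_mul_add_le_of_le_rpow (hω1 (x * v)) (hω1 (v⁻¹ * y)) (not_lt.1 hv1) (not_lt.1 hv2)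
  have hx : ω (x * v) ≤ n * ω x := by
    refine (hω.submul x v).trans ?_
    rw [mul_comm]
    have := hω0 x
    gcongr
    exact hv
  have hy : ω (v⁻¹ * y) ≤ n * ω y := by
    refine (hω.submul _ y).trans ?_
    rw [hω.map_inv]
    have := hω0 y
    gcongr
    exact hv
  have hpow : ∀ a b : G, ω a ≤ n * ω b → ω a ^ (1 - δ) ≤ n * ω b ^ (1 - δ) := by
    intro a b hab
    have hb := hω0 b
    calc ω a ^ (1 - δ) ≤ (n * ω b) ^ (1 - δ) := Real.rpow_le_rpow (hω0 a).le hab (by linarith)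
      _ = n ^ (1 - δ) * ω b ^ (1 - δ) := Real.mul_rpow hn0.le hb.le
      _ ≤ n ^ (1 : ℝ) * ω b ^ (1 - δ) := by gcongr; linarith
      _ = _ := by rw [Real.rpow_one]
  have hx' := hpow _ _ hx
  have hy' := hpow _ _ hy
  have e1 := hω0 (x * v)
  have e2 := hω0 (v⁻¹ * y)
  have e3 := hω0 x
  have e4 := hω0 y
  calc ω (x * y) ≤ _ := h1
    _ ≤ _ := h2
    _ ≤ K * (n * ω x ^ (1 - δ) * (n * ω y) + n * ω x * (n * ω y ^ (1 - δ))) := by gcongr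
    _ = _ := by ring

end Haar

/-! ### Unimodularity -/

lemma modularCharacter_eq_one_of_forall_le {G : Type*} [Group G] [TopologicalSpace G]
    [IsTopologicalGroup G] [LocallyCompactSpace G]
    (h : ∀ g : G, (Measure.modularCharacter g : ℝ) ≤ 1)
    (g : G) : Measure.modularCharacter g = 1 := by
  refine le_antisymm (by exact_mod_cast h g) ?_
  have h2 : (Measure.modularCharacter g : ℝ≥0) * Measure.modularCharacter g⁻¹ = 1 := by
    rw [← map_mul, mul_inv_cancel, map_one]
  rw [← h2]
  exact mul_le_of_le_one_right' (by exact_mod_cast h g⁻¹)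

section Unimodular

variable {G : Type*} [Group G] [TopologicalSpace G] [IsTopologicalGroup G] [LocallyCompactSpace G]
  [MeasurableSpace G] [BorelSpace G] {μ : Measure G} [μ.IsHaarMeasure]
  {ω u : G → ℝ}

/-- Right translation by `g` multiplies `∫ ω^(-t)` by the modular character, while
submultiplicativity decreases the integrand by at most the factor `ω(g)^(-t)`. -/
lemma rpow_neg_le_modularCharacter [μ.InnerRegular] (hω : IsWeight μ ω) (hω1 : ∀ x, 1 ≤ ω x)
    {t : ℝ} (ht : 0 ≤ t) (hint : Integrable (fun x => ω x ^ (-t)) μ) (g : G) :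
    ω g ^ (-t) ≤ (Measure.modularCharacter g : ℝ) := by
  have hω0 : ∀ x, 0 < ω x := fun x => one_pos.trans_le (hω1 x)
  set I := ∫⁻ x, ENNReal.ofReal (ω x ^ (-t)) ∂μ with hI
  have hItop : I ≠ ∞ := by
    rw [hI, ← ofReal_integral_eq_lintegral_ofReal hint
      (ae_of_all _ fun x => (Real.rpow_pos_of_pos (hω0 x) _).le)]
    exact ENNReal.ofReal_ne_top
  have hI0 : I ≠ 0 := by
    intro h
    rw [hI, lintegral_eq_zero_iff' hint.aestronglyMeasurable.aemeasurable.ennreal_ofReal] at h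
    obtain ⟨x, hx⟩ := h.exists
    simp only [Pi.zero_apply, ENNReal.ofReal_eq_zero] at hx
    exact absurd hx (not_le.2 (Real.rpow_pos_of_pos (hω0 x) _))
  have h1 : ∫⁻ x, ENNReal.ofReal (ω (x * g) ^ (-t)) ∂μ = Measure.modularCharacterFun g * I := by
    have h2 := Measure.map_right_mul_eq_modularCharacterFun_smul μ g
    have h3 : ∫⁻ x, ENNReal.ofReal (ω x ^ (-t)) ∂(μ.map (· * g)) =
        ∫⁻ x, ENNReal.ofReal (ω (x * g) ^ (-t)) ∂μ := by
      have := (Homeomorph.mulRight g).toMeasurableEquiv.measurableEmbedding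
      exact this.lintegral_map _
    rw [← h3, h2, lintegral_smul_measure]
    rfl
  have h4 : ENNReal.ofReal (ω g ^ (-t)) * I ≤ Measure.modularCharacterFun g * I := by
    rw [← h1, hI, ← lintegral_const_mul' _ _ ENNReal.ofReal_ne_top]
    refine lintegral_mono fun x => ?_
    rw [← ENNReal.ofReal_mul (Real.rpow_pos_of_pos (hω0 g) _).le]
    refine ENNReal.ofReal_le_ofReal ?_
    rw [← Real.mul_rpow (hω0 g).le (hω0 x).le]
    refine Real.rpow_le_rpow_of_nonpos (hω0 _) ?_ (by linarith)
    rw [mul_comm]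
    exact hω.submul x g
  rw [ENNReal.mul_le_mul_iff_left hI0 hItop, ENNReal.ofReal_le_iff_le_toReal ENNReal.coe_ne_top] at h4
  exact h4

lemma modularCharacter_le_rpow [μ.InnerRegular] (hω : IsWeight μ ω) (hω1 : ∀ x, 1 ≤ ω x)
    {t : ℝ} (ht : 0 ≤ t) (hint : Integrable (fun x => ω x ^ (-t)) μ) (g : G) :
    (Measure.modularCharacter g : ℝ) ≤ ω g ^ t := by
  have h1 := rpow_neg_le_modularCharacter hω hω1 ht hint g⁻¹
  have hω0 : 0 < ω g := one_pos.trans_le (hω1 g)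
  rw [hω.map_inv, Real.rpow_neg hω0.le] at h1
  have h2 : (Measure.modularCharacter g : ℝ) * (Measure.modularCharacter g⁻¹ : ℝ) = 1 := by
    rw [← NNReal.coe_mul, ← map_mul, mul_inv_cancel, map_one, NNReal.coe_one]
  have h3 : 0 < (Measure.modularCharacter g : ℝ) := by
    have := Measure.modularCharacterFun_pos g
    exact_mod_cast this
  have h4 : 0 < ω g ^ t := Real.rpow_pos_of_pos hω0 t
  calc (Measure.modularCharacter g : ℝ)
      = Measure.modularCharacter g * ((ω g ^ t)⁻¹ * ω g ^ t) := by field_simp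
    _ ≤ Measure.modularCharacter g * (Measure.modularCharacter g⁻¹ * ω g ^ t) := by gcongr
    _ = _ := by rw [← mul_assoc, h2, one_mul]

/-- If some value exceeds 1, iterate `x ↦ x x v`, with `v` chosen so that `x v` and the new point
stay outside `D`. Then `ω(xxv) ≤ C ω(x)^(2-δ)`, while the modular character is squared up to the
factor `κ⁻¹`. After `k` steps `2^k` competes with `(2-δ)^k`, against the bound of the character by
`ω^t`. -/
lemma modularCharacter_le_one [μ.InnerRegular] (hω : IsWeight μ ω) (hω1 : ∀ x, 1 ≤ ω x)
    (hu0 : ∀ x, 0 < u x) {s r : ℝ} (hr : 0 < r) (hrs : r < s)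
    (hωu : ∀ x y, ω (x * y) / (ω x * ω y) ≤ u x + u y)
    (hint : Integrable (fun x => u x ^ s * ω x ^ r) μ)
    (hint' : Integrable (fun x => ω x ^ (-(s - r))) μ) (g : G) :
    (Measure.modularCharacter g : ℝ) ≤ 1 := by
  have hω0 : ∀ x, 0 < ω x := fun x => one_pos.trans_le (hω1 x)
  have hΔ0 : ∀ x : G, 0 < (Measure.modularCharacter x : ℝ) := fun x => by
    have := Measure.modularCharacterFun_pos x
    exact_mod_cast this
  have hΔmul : ∀ x y : G, (Measure.modularCharacter (x * y) : ℝ) =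
    Measure.modularCharacter x * Measure.modularCharacter y := fun x y => by
      rw [map_mul, NNReal.coe_mul]
  set t := s - r with ht
  have ht0 : 0 < t := by linarith
  obtain ⟨n, K, hn1, hK, hV⟩ := exists_measure_lt_of_integrable hω1 hu0 (hr.trans hrs) hint
  set δ := r / s with hδ
  have hδ0 : 0 < δ := div_pos hr (hr.trans hrs)
  have hδ1 : δ < 1 := (div_lt_one (hr.trans hrs)).2 hrs
  set D := {x | K * ω x ^ (-δ) < u x} with hD
  have hn0 : 0 < n := by linarith
  set κ := n ^ t with hκ
  have hκ1 : 1 ≤ κ := Real.one_le_rpow hn1 ht0.le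
  have hVΔ : ∀ v ∈ {x | ω x ≤ n}, κ⁻¹ ≤ (Measure.modularCharacter v : ℝ) := fun v hv => by
    refine le_trans ?_ (rpow_neg_le_modularCharacter hω hω1 ht0.le hint' v)
    rw [hκ, ← Real.rpow_neg hn0.le]
    exact Real.rpow_le_rpow_of_nonpos (hω0 v) hv (by linarith)
  by_contra! hg
  -- One factor `κ` absorbs the loss from `v₀`; the other makes `d₀` positive.
  obtain ⟨m, hm⟩ := pow_unbounded_of_one_lt (κ ^ 2) hg
  obtain ⟨v₀, hv₀, hv₀D, -⟩ := exists_mem_of_two_mul_measure_lt hV (g ^ m) (g ^ m)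
  set d₀ := Real.log (Measure.modularCharacter (g ^ m * v₀)) - Real.log κ with hd₀
  have hd₀pos : 0 < d₀ := by
    rw [hd₀, sub_pos]
    refine Real.log_lt_log (by linarith) ?_
    rw [hΔmul, map_pow, NNReal.coe_pow]
    calc κ = κ ^ 2 * κ⁻¹ := by field_simp
      _ < (Measure.modularCharacter g : ℝ) ^ m * κ⁻¹ := by gcongr
      _ ≤ _ := by gcongr; exact hVΔ _ hv₀
  set C := max (2 * K * n) 1 with hC
  have hC1 : 1 ≤ C := le_max_right _ _
  -- `A` turns the affine recursion for `log ω` into a linear one: `log C + A = (2-δ) A`.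
  -- Subtracting `log κ` does the same for the logarithm of the modular character.
  set A := Real.log C / (1 - δ) with hA
  set B := Real.log (ω (g ^ m * v₀)) + A with hB
  have key : ∀ k : ℕ, ∃ x, x ∉ D ∧
      2 ^ k * d₀ ≤ Real.log (Measure.modularCharacter x) - Real.log κ ∧
      Real.log (ω x) + A ≤ (2 - δ) ^ k * B := by
    intro k
    induction k with
    | zero => exact ⟨g ^ m * v₀, hv₀D, by simp [hd₀], by simp [hB]⟩
    | succ k ih =>
      obtain ⟨x, hxD, hx1, hx2⟩ := ih
      obtain ⟨v, hv, hv1, hv2⟩ := exists_mem_of_two_mul_measure_lt hV x (x * x)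
      refine ⟨x * x * v, hv2, ?_, ?_⟩
      · rw [hΔmul, hΔmul, Real.log_mul (mul_pos (hΔ0 x) (hΔ0 x)).ne' (hΔ0 v).ne',
          Real.log_mul (hΔ0 x).ne' (hΔ0 x).ne', pow_succ]
        have := Real.log_le_log (by positivity) (hVΔ v hv)
        rw [Real.log_inv] at this
        linarith
      · have h1 : ω (x * x * v) ≤ C * ω x ^ (2 - δ) := by
          have h2 := hωu x (x * v)
          rw [div_le_iff₀ (mul_pos (hω0 _) (hω0 _)), ← mul_assoc, mul_comm] at h2
          have hxv1 : ω (x * v) ≤ n * ω x := by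
            refine (hω.submul x v).trans ?_
            rw [mul_comm]
            have := hω0 x
            gcongr
            exact hv
          have h3 := mul_mul_add_le_of_le_rpow (hω1 x) (hω1 (x * v)) (not_lt.1 hxD) (not_lt.1 hv1)
          have hx0 := hω0 x
          have hxv0 := hω0 (x * v)
          have h4 : ω (x * v) ^ (1 - δ) ≤ n * ω x ^ (1 - δ) := by
            calc ω (x * v) ^ (1 - δ) ≤ (n * ω x) ^ (1 - δ) :=
                  Real.rpow_le_rpow hxv0.le hxv1 (by linarith)
              _ = n ^ (1 - δ) * ω x ^ (1 - δ) := Real.mul_rpow hn0.le hx0.le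
              _ ≤ n ^ (1 : ℝ) * ω x ^ (1 - δ) := by gcongr; linarith
              _ = _ := by rw [Real.rpow_one]
          have h5 : ω x ^ (1 - δ) * ω x = ω x ^ (2 - δ) := by
            nth_rewrite 2 [← Real.rpow_one (ω x)]
            rw [← Real.rpow_add hx0]
            congr 1
            ring
          calc ω (x * x * v) ≤ _ := h2
            _ ≤ _ := h3
            _ ≤ K * (ω x ^ (1 - δ) * (n * ω x) + ω x * (n * ω x ^ (1 - δ))) := by gcongr
            _ = 2 * K * n * (ω x ^ (1 - δ) * ω x) := by ring
            _ = 2 * K * n * ω x ^ (2 - δ) := by rw [h5]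
            _ ≤ _ := by gcongr; exact le_max_left _ _
        have h6 := Real.log_le_log (hω0 _) h1
        rw [Real.log_mul (by linarith) (Real.rpow_pos_of_pos (hω0 x) _).ne',
          Real.log_rpow (hω0 x)] at h6
        have h7 : Real.log C = A * (1 - δ) := by
          rw [hA, div_mul_cancel₀]
          linarith
        calc Real.log (ω (x * x * v)) + A ≤ (2 - δ) * (Real.log (ω x) + A) := by
              rw [h7] at h6
              linarith
          _ ≤ (2 - δ) * ((2 - δ) ^ k * B) := by
              have : 0 ≤ 2 - δ := by linarith
              gcongr
          _ = _ := by ring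
  have hbound : ∀ k : ℕ, (2 / (2 - δ)) ^ k ≤ t * B / d₀ := by
    intro k
    obtain ⟨x, -, h1, h2⟩ := key k
    have h3 := Real.log_le_log (hΔ0 x) (modularCharacter_le_rpow hω hω1 ht0.le hint' x)
    rw [Real.log_rpow (hω0 x)] at h3
    have h4 : 0 ≤ Real.log κ := Real.log_nonneg hκ1
    have h5 : 0 ≤ A := div_nonneg (Real.log_nonneg hC1) (by linarith)
    have h6 : 2 ^ k * d₀ ≤ t * ((2 - δ) ^ k * B) := by
      calc 2 ^ k * d₀ ≤ t * Real.log (ω x) := by linarith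
        _ ≤ t * ((2 - δ) ^ k * B) := by gcongr; linarith
    have h7 : 0 < 2 - δ := by linarith
    rw [div_pow, div_le_div_iff₀ (by positivity) hd₀pos]
    linarith
  obtain ⟨k, hk⟩ := pow_unbounded_of_one_lt (t * B / d₀)
    (show 1 < 2 / (2 - δ) by rw [one_lt_div (by linarith)]; linarith)
  exact absurd (hbound k) (not_le.2 hk)

lemma isMulRightInvariant_of_modularCharacter_eq_one [μ.InnerRegular]
    (h : ∀ g : G, Measure.modularCharacter g = 1) : μ.IsMulRightInvariant :=
  ⟨fun g => by
    rw [Measure.map_right_mul_eq_modularCharacterFun_smul μ g]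
    change Measure.modularCharacter g • μ = μ
    rw [h g, one_smul]⟩

/-- The inverted measure is left invariant, hence a multiple of `μ`; a symmetric compact
neighbourhood of 1 shows that the factor is 1. -/
lemma isInvInvariant_of_isMulRightInvariant [μ.InnerRegular] [μ.IsMulRightInvariant] :
    μ.IsInvInvariant := by
  have h1 : μ.inv.IsMulLeftInvariant := inferInstance
  have h2 : IsFiniteMeasureOnCompacts μ.inv := ⟨fun K hK => by
    rw [Measure.inv_apply]
    exact hK.inv.measure_lt_top⟩
  have h3 : μ.inv.InnerRegular := by
    have := Measure.InnerRegular.map_of_continuous (μ := μ) (f := Inv.inv) continuous_inv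
    exact this
  have h4 := Measure.isMulLeftInvariant_eq_smul_of_innerRegular μ.inv μ
  set c := Measure.haarScalarFactor μ.inv μ with hc
  have hc1 : c = 1 := by
    obtain ⟨K, hK, hK1⟩ := exists_compact_mem_nhds (1 : G)
    have hL : IsCompact (K ∪ K⁻¹) := hK.union hK.inv
    have h5 : μ.inv (K ∪ K⁻¹) = μ (K ∪ K⁻¹) := by
      rw [Measure.inv_apply, Set.union_inv, inv_inv, Set.union_comm]
    rw [h4] at h5
    have h6 : 0 < μ (K ∪ K⁻¹) :=
      Measure.measure_pos_of_mem_nhds μ (mem_of_superset hK1 Set.subset_union_left)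
    have h7 : (c : ℝ≥0∞) * μ (K ∪ K⁻¹) = 1 * μ (K ∪ K⁻¹) := by
      rw [one_mul]
      exact h5
    have h8 := (ENNReal.mul_left_inj h6.ne' hL.measure_lt_top.ne).1 h7
    exact_mod_cast h8
  exact ⟨by rw [h4, hc1, one_smul]⟩

end Unimodular

/-! ### Interpolation and construction of the majorant -/

/-- Hölder's inequality for the factorisation `|f| ω v = |f|^θ · (|f|ω)^(1-θ) · ω^θ v` with
exponents `2/θ`, `p/(1-θ)` and `m`. -/
lemma lintegral_enorm_mul_le_interpolation {α : Type*} [MeasurableSpace α] {μ : Measure α}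
    {f : α → ℂ} {ω v : α → ℝ} (hf : AEStronglyMeasurable f μ) (hω : AEMeasurable ω μ)
    (hv : AEMeasurable v μ) (hω0 : ∀ x, 0 < ω x) (hv0 : ∀ x, 0 ≤ v x) {p : ℝ≥0∞} (hp0 : p ≠ 0)
    (hp : p ≠ ∞) {θ m : ℝ} (hθ0 : 0 < θ) (hθ1 : θ < 1) (hm : 0 < m)
    (hsum : θ / 2 + (1 - θ) / p.toReal + 1 / m = 1) :
    ∫⁻ x, ‖f x‖ₑ * ENNReal.ofReal (ω x * v x) ∂μ ≤
      (∫⁻ x, ENNReal.ofReal ((ω x ^ θ * v x) ^ m) ∂μ) ^ (1 / m) * eLpNorm f 2 μ ^ θ *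
        eLpNorm (fun x => f x * (ω x : ℂ)) p μ ^ (1 - θ) := by
  have hP : 0 < p.toReal := ENNReal.toReal_pos hp0 hp
  have hω' : AEStronglyMeasurable (fun x => (ω x : ℂ)) μ :=
    (Complex.measurable_ofReal.comp_aemeasurable hω).aestronglyMeasurable
  let F : Fin 3 → α → ℝ≥0∞ := ![fun x => ‖f x‖ₑ ^ (2 : ℝ), fun x => ‖f x * (ω x : ℂ)‖ₑ ^ p.toReal,
    fun x => ENNReal.ofReal ((ω x ^ θ * v x) ^ m)]
  let e : Fin 3 → ℝ := ![θ / 2, (1 - θ) / p.toReal, 1 / m]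
  have h := ENNReal.lintegral_prod_norm_pow_le (μ := μ) Finset.univ (f := F) (p := e)
    (by
      intro i _
      fin_cases i
      · exact hf.enorm.pow_const _
      · exact (hf.mul hω').enorm.pow_const _
      · exact ((((hω.pow_const _).mul hv).pow_const _)).ennreal_ofReal)
    (by simpa [Fin.sum_univ_three, e] using hsum)
    (by
      intro i _
      have : 0 < 1 - θ := by linarith
      fin_cases i <;> simp [e] <;> positivity)
  simp only [Fin.prod_univ_three, F, e, Matrix.cons_val_zero, Matrix.cons_val_one,
    Matrix.cons_val_two, Matrix.head_cons, Matrix.tail_cons] at h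
  refine le_trans (le_of_eq (lintegral_congr fun x => ?_)) (h.trans (le_of_eq ?_))
  · have h0 := hω0 x
    have h1 := hv0 x
    have h2 : ‖f x * (ω x : ℂ)‖ₑ = ‖f x‖ₑ * ENNReal.ofReal (ω x) := by
      rw [enorm_mul, ← ofReal_norm (ω x : ℂ), Complex.norm_real, Real.norm_of_nonneg h0.le]
    rw [h2, ← ENNReal.rpow_mul, ← ENNReal.rpow_mul, mul_div_cancel₀ _ two_ne_zero,
      mul_div_cancel₀ _ hP.ne', ENNReal.ofReal_rpow_of_nonneg (by positivity) (by positivity),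
      ← Real.rpow_mul (by positivity), mul_one_div_cancel hm.ne', Real.rpow_one,
      ENNReal.mul_rpow_of_nonneg _ _ (by linarith), ENNReal.ofReal_rpow_of_nonneg h0.le (by linarith)]
    calc ‖f x‖ₑ * ENNReal.ofReal (ω x * v x)
        = ‖f x‖ₑ ^ (θ + (1 - θ)) * ENNReal.ofReal (ω x ^ (1 - θ) * (ω x ^ θ * v x)) := by
          rw [← mul_assoc, ← Real.rpow_add h0]
          simp
      _ = _ := by
          rw [ENNReal.rpow_add_of_nonneg _ _ hθ0.le (by linarith),
            ENNReal.ofReal_mul (p := ω x ^ (1 - θ)) (by positivity)]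
          ring
  · rw [eLpNorm_eq_lintegral_rpow_enorm_toReal two_ne_zero ENNReal.ofNat_ne_top,
      eLpNorm_eq_lintegral_rpow_enorm_toReal hp0 hp, ← ENNReal.rpow_mul, ← ENNReal.rpow_mul]
    simp only [ENNReal.toReal_ofNat]
    rw [show 1 / (2 : ℝ) * θ = θ / 2 by ring, show 1 / p.toReal * (1 - θ) = (1 - θ) / p.toReal by ring]
    ring

/-- The majorant `σ` of the weight used in all estimates: `ω (x y) ≤ σ x ω y + ω x σ y`, together
with an interpolation inequality for `‖f σ‖₁`. -/
structure IsMajorant {G : Type*} [Group G] [MeasurableSpace G] (μ : Measure G) (ω σ : G → ℝ)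
    (p : ℝ≥0∞) (θ c : ℝ) (K : ℝ≥0∞) : Prop where
  aemeasurable : AEMeasurable σ μ
  theta_pos : 0 < θ
  theta_lt_one : θ < 1
  pos : 0 < c
  le : ∀ x, c ≤ σ x
  ne_top : K ≠ ∞
  mul_le : ∀ x y, ω (x * y) ≤ σ x * ω y + ω x * σ y
  lintegral_le : ∀ f : G → ℂ, AEStronglyMeasurable f μ →
    ∫⁻ x, ‖f x‖ₑ * ENNReal.ofReal (σ x) ∂μ ≤
      K * eLpNorm f 2 μ ^ θ * eLpNorm (fun x => f x * (ω x : ℂ)) p μ ^ (1 - θ)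

section Exists

variable {G : Type*} [Group G] [MeasurableSpace G] {μ : Measure G} {ω u : G → ℝ}

lemma lintegral_ofReal_rpow_ne_top {α : Type*} [MeasurableSpace α] {μ : Measure α} {f : α → ℝ}
    (hf : Integrable f μ) {m : ℝ} (hm : 0 ≤ m) : (∫⁻ x, ENNReal.ofReal (f x) ∂μ) ^ (1 / m) ≠ ∞ :=
  ENNReal.rpow_ne_top_of_nonneg (by positivity)
    (ne_top_of_le_ne_top hf.2.ne (lintegral_mono fun _ => Real.ofReal_le_enorm _))

/-- The majorant is `ωu`. The interpolation requires integrability of `u^m ω^(θm)`, which follows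
from the hypothesis once `m ≥ s` and `θm ≤ r`. -/
lemma exists_isMajorant_of_one_lt (hω : AEMeasurable ω μ) (hω1 : ∀ x, 1 ≤ ω x)
    {p q : ℝ≥0∞} (hp1 : 1 < p) (hp : p ≠ ∞) (hpq : p.HolderConjugate q)
    (hu : AEMeasurable u μ) (hu0 : ∀ x, 0 < u x) {M : ℝ} (hM : ∀ x, u x ≤ M)
    {s r : ℝ} (hs : ENNReal.ofReal s < q) (hr : 0 < r) {c : ℝ} (hc : 0 < c)
    (hcu : ∀ x, c ≤ ω x * u x)
    (hωu : ∀ x y, ω (x * y) / (ω x * ω y) ≤ u x + u y)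
    (hint : Integrable (fun x => u x ^ s * ω x ^ r) μ) :
    ∃ σ θ c K, IsMajorant μ ω σ p θ c K := by
  have hω0 : ∀ x, 0 < ω x := fun x => one_pos.trans_le (hω1 x)
  have hP1 : 1 < p.toReal := by
    rw [← ENNReal.toReal_one]
    exact (ENNReal.toReal_lt_toReal ENNReal.one_ne_top hp).2 hp1
  set P := p.toReal with hP
  have hq : q ≠ ∞ := by
    rintro rfl
    have := hpq.inv_add_inv_eq_one
    simp at this
    exact absurd this hp1.ne'
  have hq0 : q ≠ 0 := by
    rintro rfl
    simp at hs
  have hQ : 0 < q.toReal := ENNReal.toReal_pos hq0 hq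
  have hPQ : 1 / P + 1 / q.toReal = 1 := by
    have := congrArg ENNReal.toReal hpq.inv_add_inv_eq_one
    rw [ENNReal.toReal_add (ENNReal.inv_ne_top.2 (by positivity)) (ENNReal.inv_ne_top.2 hq0),
      ENNReal.toReal_inv, ENNReal.toReal_inv, ENNReal.toReal_one] at this
    simpa [one_div] using this
  set Q := q.toReal with hQdef
  have hsQ : s < Q := by
    rw [← ENNReal.ofReal_toReal hq] at hs
    exact (ENNReal.ofReal_lt_ofReal_iff hQ).1 hs
  -- Hölder dictates this value of `m`. As `θ → 0` it tends to `q > s`, and `θm` tends to 0.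
  have hlim : Tendsto (fun θ : ℝ => (1 - θ / 2 - (1 - θ) / P)⁻¹) (𝓝[>] 0) (𝓝 Q) := by
    have h1 : Tendsto (fun θ : ℝ => 1 - θ / 2 - (1 - θ) / P) (𝓝 0) (𝓝 Q⁻¹) := by
      have h2 : Continuous fun θ : ℝ => 1 - θ / 2 - (1 - θ) / P := by fun_prop
      have h3 := h2.tendsto 0
      have h4 : 1 - 0 / 2 - (1 - 0) / P = Q⁻¹ := by
        rw [← one_div Q]
        linarith
      rwa [h4] at h3
    have h5 := h1.inv₀ (inv_ne_zero hQ.ne')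
    rw [inv_inv] at h5
    exact h5.mono_left nhdsWithin_le_nhds
  have hid : Tendsto (fun θ : ℝ => θ) (𝓝[>] 0) (𝓝 0) := tendsto_id.mono_left nhdsWithin_le_nhds
  have hlim2 := hid.mul hlim
  rw [zero_mul] at hlim2
  obtain ⟨θ, ⟨⟨⟨hm0, hms⟩, hmr⟩, hθ1⟩, hθ0⟩ := (((((hlim.eventually_const_lt hQ).and
    (hlim.eventually_const_lt hsQ)).and (hlim2.eventually_lt_const hr)).and
    (hid.eventually_lt_const one_pos)).and self_mem_nhdsWithin).exists
  set m := (1 - θ / 2 - (1 - θ) / P)⁻¹ with hm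
  have hθ0 : 0 < θ := hθ0
  have hsum : θ / 2 + (1 - θ) / P + 1 / m = 1 := by
    rw [hm, one_div, inv_inv]
    ring
  have hint' := integrable_rpow_mul_rpow_of_le hω hω1 hu hu0 hM hms.le hmr.le hint
  have heq : ∀ x, u x ^ m * ω x ^ (θ * m) = (ω x ^ θ * u x) ^ m := fun x => by
    have := hω0 x
    rw [Real.mul_rpow (by positivity) (hu0 x).le, ← Real.rpow_mul this.le, mul_comm]
  simp only [heq] at hint'
  refine ⟨fun x => ω x * u x, θ, c, (∫⁻ x, ENNReal.ofReal ((ω x ^ θ * u x) ^ m) ∂μ) ^ (1 / m),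
    hω.mul hu, hθ0, hθ1, hc, hcu, ?_, fun x y => ?_, fun f hf => ?_⟩
  · exact lintegral_ofReal_rpow_ne_top hint' hm0.le
  · have h := hωu x y
    rw [div_le_iff₀ (mul_pos (hω0 x) (hω0 y))] at h
    linarith
  · exact lintegral_enorm_mul_le_interpolation hf hω hu hω0 (fun x => (hu0 x).le)
      (by positivity) hp hθ0 hθ1 hm0 hsum

/-- For `p = 1` Hölder forces `m = 2/θ`, so `θm = 2` cannot be made small. The decay `ω^(-δ)` in
place of `u` compensates for this. -/
lemma exists_isMajorant_one (hω : AEMeasurable ω μ) (hω1 : ∀ x, 1 ≤ ω x) {δ t C : ℝ}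
    (hδ0 : 0 < δ) (hδ1 : δ < 1) (ht : 0 < t) (hC : 0 < C)
    (hωC : ∀ x y, ω (x * y) ≤ C * ω x ^ (1 - δ) * ω y + ω x * (C * ω y ^ (1 - δ)))
    (hint : Integrable (fun x => ω x ^ (-t)) μ) :
    ∃ σ θ c K, IsMajorant μ ω σ 1 θ c K := by
  have hω0 : ∀ x, 0 < ω x := fun x => one_pos.trans_le (hω1 x)
  -- Chosen so that `(θ - δ) m = -t`, the exponent whose integrability is known.
  set θ := 2 * δ / (2 + t) with hθ
  have hθ0 : 0 < θ := by positivity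
  have hθ1 : θ < 1 := by
    rw [hθ, div_lt_one (by positivity)]
    linarith
  set m := 2 / θ with hm
  have hm0 : 0 < m := by positivity
  have hint' : Integrable (fun x => (ω x ^ θ * (C * ω x ^ (-δ))) ^ m) μ := by
    refine (hint.const_mul (C ^ m)).congr (ae_of_all _ fun x => ?_)
    have h0 := hω0 x
    have h1 : ω x ^ θ * (C * ω x ^ (-δ)) = C * ω x ^ (θ - δ) := by
      rw [sub_eq_add_neg, Real.rpow_add h0]
      ring
    simp only [h1]
    rw [Real.mul_rpow hC.le (by positivity), ← Real.rpow_mul h0.le]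
    congr 2
    rw [hm, hθ]
    field_simp
    ring
  have hσ : ∀ x, ω x * (C * ω x ^ (-δ)) = C * ω x ^ (1 - δ) := fun x => by
    rw [sub_eq_add_neg, Real.rpow_add (hω0 x), Real.rpow_one]
    ring
  refine ⟨fun x => C * ω x ^ (1 - δ), θ, C,
    (∫⁻ x, ENNReal.ofReal ((ω x ^ θ * (C * ω x ^ (-δ))) ^ m) ∂μ) ^ (1 / m),
    (hω.pow_const _).const_mul _, hθ0, hθ1, hC, fun x => ?_, ?_, hωC, fun f hf => ?_⟩
  · have := Real.one_le_rpow (hω1 x) (show 0 ≤ 1 - δ by linarith)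
    nlinarith
  · exact lintegral_ofReal_rpow_ne_top hint' hm0.le
  · have h := lintegral_enorm_mul_le_interpolation (μ := μ) hf hω
      (v := fun x => C * ω x ^ (-δ)) ((hω.pow_const _).const_mul _) hω0
      (fun x => by have := hω0 x; positivity) (p := 1) one_ne_zero ENNReal.one_ne_top hθ0 hθ1 hm0
      (by rw [hm, ENNReal.toReal_one]; field_simp; ring)
    simp only [hσ] at h
    exact h

end Exists

/-! ### The group is `σ`-compact -/

section SigmaCompact

variable {X : Type*} [TopologicalSpace X] [T2Space X] [MeasurableSpace X] [BorelSpace X]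
  {μ : Measure X} [SigmaFinite μ] [μ.InnerRegularCompactLTTop]

/-- For each piece of finite measure, compact sets exhaust `E` up to `1/(k+1)`. -/
lemma exists_isCompact_measure_diff_iUnion_eq_zero {E : Set X} (hE : MeasurableSet E) :
    ∃ K : ℕ × ℕ → Set X, (∀ i, IsCompact (K i)) ∧ (∀ i, K i ⊆ E) ∧ μ (E \ ⋃ i, K i) = 0 := by
  have h : ∀ i : ℕ × ℕ, ∃ K ⊆ E ∩ spanningSets μ i.1, IsCompact K ∧
      μ ((E ∩ spanningSets μ i.1) \ K) < (i.2 + 1 : ℝ≥0∞)⁻¹ := fun i =>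
    (hE.inter (measurableSet_spanningSets μ i.1)).exists_isCompact_sdiff_lt
      ((measure_mono Set.inter_subset_right).trans_lt (measure_spanningSets_lt_top μ i.1)).ne
      (by simp)
  choose K hKE hK hμ using h
  refine ⟨K, hK, fun i => (hKE i).trans Set.inter_subset_left, ?_⟩
  have h1 : E \ ⋃ i, K i ⊆ ⋃ n, (E ∩ spanningSets μ n) \ ⋃ i, K i := by
    intro x hx
    obtain ⟨n, hn⟩ := Set.mem_iUnion.1 (iUnion_spanningSets μ ▸ Set.mem_univ x)
    exact Set.mem_iUnion.2 ⟨n, ⟨hx.1, hn⟩, hx.2⟩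
  refine measure_mono_null h1 (measure_iUnion_null fun n => ?_)
  have h2 : ∀ k : ℕ, μ ((E ∩ spanningSets μ n) \ ⋃ i, K i) ≤ (k + 1 : ℝ≥0∞)⁻¹ := fun k =>
    (measure_mono (Set.sdiff_subset_sdiff_right (Set.subset_iUnion K (n, k)))).trans (hμ (n, k)).le
  have h3 : Tendsto (fun k : ℕ => (k + 1 : ℝ≥0∞)⁻¹) atTop (𝓝 0) := by
    have := (tendsto_add_atTop_iff_nat 1).2 ENNReal.tendsto_inv_nat_nhds_zero
    simpa using this
  exact le_antisymm (ge_of_tendsto' h3 h2) bot_le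

end SigmaCompact

-- A countable union `C` of compact sets has null complement. Then `C` meets `x C⁻¹` for every `x`,
-- so the countably many compact products `K i * K j` cover the group.
open Pointwise in
lemma sigmaCompactSpace_of_sigmaFinite {G : Type*} [Group G] [TopologicalSpace G]
    [IsTopologicalGroup G] [T2Space G] [MeasurableSpace G] [BorelSpace G] (μ : Measure G)
    [SigmaFinite μ] [μ.InnerRegularCompactLTTop] [μ.IsMulLeftInvariant] [μ.IsInvInvariant]
    [NeZero μ] : SigmaCompactSpace G := by
  obtain ⟨K, hK, -, hμ⟩ := exists_isCompact_measure_diff_iUnion_eq_zero (μ := μ)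
    (MeasurableSet.univ (α := G))
  rw [← isSigmaCompact_univ_iff]
  have h : (⋃ i : (ℕ × ℕ) × (ℕ × ℕ), K i.1 * K i.2) = Set.univ := by
    refine Set.eq_univ_of_forall fun x => ?_
    rw [← Set.compl_eq_univ_sdiff] at hμ
    set C := ⋃ i, K i with hC
    have h1 : μ ((x⁻¹ * ·) ⁻¹' (Inv.inv ⁻¹' Cᶜ)) = 0 := by
      rw [measure_preimage_mul, Measure.measure_preimage_inv, hμ]
    have h2 : μ (Cᶜ ∪ ((x⁻¹ * ·) ⁻¹' (Inv.inv ⁻¹' Cᶜ))) = 0 := measure_union_null hμ h1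
    obtain ⟨y, hy⟩ : (Cᶜ ∪ ((x⁻¹ * ·) ⁻¹' (Inv.inv ⁻¹' Cᶜ)))ᶜ.Nonempty := by
      rw [Set.nonempty_compl]
      intro h3
      rw [h3] at h2
      exact NeZero.ne μ (Measure.measure_univ_eq_zero.1 h2)
    simp only [Set.mem_compl_iff, Set.mem_union, Set.mem_preimage, not_or, not_not, mul_inv_rev,
      inv_inv] at hy
    obtain ⟨i, hi⟩ := Set.mem_iUnion.1 hy.1
    obtain ⟨j, hj⟩ := Set.mem_iUnion.1 hy.2
    exact Set.mem_iUnion.2 ⟨(i, j), Set.mem_mul.2 ⟨y, hi, _, hj, by group⟩⟩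
  rw [← h]
  exact isSigmaCompact_iUnion_of_isCompact _ fun i => (hK i.1).mul (hK i.2)

/-! ### The Baire `σ`-algebra and joint measurability of multiplication -/

section Baire

/-- The group `G` with its Baire `σ`-algebra, generated by the compactly supported continuous
functions. -/
def BaireGroup (G : Type*) := G

instance (G : Type*) [Group G] : Group (BaireGroup G) := inferInstanceAs (Group G)

instance (G : Type*) [TopologicalSpace G] : MeasurableSpace (BaireGroup G) :=
  ⨆ f : {f : G → ℝ // Continuous f ∧ HasCompactSupport f},
    MeasurableSpace.comap (fun x : BaireGroup G => f.1 x) (borel ℝ)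

/-- The identity map from `G` with the Borel to `G` with the Baire `σ`-algebra. -/
def toBaire (G : Type*) [Group G] : G →* BaireGroup G := MonoidHom.id G

lemma measurable_baire {G : Type*} [TopologicalSpace G] {f : G → ℝ} (hf : Continuous f)
    (hc : HasCompactSupport f) : Measurable (fun x : BaireGroup G => f x) := by
  rw [measurable_iff_comap_le, BorelSpace.measurable_eq (α := ℝ)]
  exact le_iSup (fun f : {f : G → ℝ // Continuous f ∧ HasCompactSupport f} =>
    MeasurableSpace.comap (fun x : BaireGroup G => f.1 x) (borel ℝ)) ⟨f, hf, hc⟩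

lemma measurable_to_baire {G α : Type*} [TopologicalSpace G] [MeasurableSpace α]
    {φ : α → BaireGroup G}
    (h : ∀ f : G → ℝ, Continuous f → HasCompactSupport f → Measurable fun x => f (φ x)) :
    Measurable φ := by
  rw [measurable_iff_comap_le]
  change MeasurableSpace.comap φ (⨆ _, _) ≤ _
  rw [MeasurableSpace.comap_iSup]
  refine iSup_le fun f => ?_
  rw [MeasurableSpace.comap_comp, ← BorelSpace.measurable_eq (α := ℝ), ← measurable_iff_comap_le]
  exact h f.1 f.2.1 f.2.2

variable {G : Type*} [Group G] [TopologicalSpace G]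

lemma measurable_toBaire [MeasurableSpace G] [OpensMeasurableSpace G] :
    Measurable (toBaire G) :=
  measurable_to_baire fun _ hf _ => hf.measurable

variable [IsTopologicalGroup G]

lemma exists_nhds_one_forall_dist_lt {E : Type*} [NormedAddCommGroup E] {f : G → E}
    (hf : Continuous f) (hc : HasCompactSupport f)
    {ε : ℝ} (hε : 0 < ε) : ∃ V ∈ 𝓝 (1 : G), ∀ v ∈ V, ∀ y, dist (f y) (f (v * y)) < ε := by
  let := IsTopologicalGroup.rightUniformSpace G
  have h1 := hc.uniformContinuous_of_continuous hf
  have h2 := h1 (Metric.dist_mem_uniformity hε)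
  rw [mem_map, uniformity_eq_comap_nhds_one' G, mem_comap] at h2
  obtain ⟨V, hV, hVs⟩ := h2
  refine ⟨V, hV, fun v hv y => ?_⟩
  exact hVs (show (y, v * y) ∈ _ by simpa using hv)

instance : MeasurableInv (BaireGroup G) :=
  ⟨measurable_to_baire fun f hf hc =>
    measurable_baire (f := fun x : G => f x⁻¹) (hf.comp continuous_inv)
      (hc.comp_homeomorph (Homeomorph.inv G))⟩

variable [LocallyCompactSpace G]

lemma exists_measurableSet_baire_subset {x : G} {U : Set G} (hU : U ∈ 𝓝 x) :
    ∃ W ⊆ U, W ∈ 𝓝 x ∧ MeasurableSet (show Set (BaireGroup G) from W) := by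
  obtain ⟨V, hVU, hV, hxV⟩ := mem_nhds_iff.1 hU
  obtain ⟨k, hk1, hk0, hkc, -⟩ := exists_continuous_one_zero_of_isCompact (isCompact_singleton (x := x))
    hV.isClosed_compl (by simpa using hxV)
  refine ⟨k ⁻¹' Set.Ioi (1 / 2), fun y hy => ?_, ?_, ?_⟩
  · by_contra hyU
    have : k y = 0 := hk0 (fun h => hyU (hVU h))
    simp only [Set.mem_preimage, this, Set.mem_Ioi] at hy
    norm_num at hy
  · refine k.continuous.continuousAt.preimage_mem_nhds (Ioi_mem_nhds ?_)
    rw [hk1 rfl]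
    norm_num
  · exact measurable_baire k.continuous hkc measurableSet_Ioi

/-- By uniform continuity, `f(xy)` is within `ε` of `f(a_n y)` when `x` lies in a small Baire
neighbourhood of `a_n`. Countably many such neighbourhoods cover the group, so the approximation is
measurable on the product. -/
instance [SigmaCompactSpace G] : MeasurableMul₂ (BaireGroup G) := by
  refine ⟨measurable_to_baire fun f hf hc => ?_⟩
  have key : ∀ ε : ℝ, 0 < ε → ∃ F : BaireGroup G × BaireGroup G → ℝ, Measurable F ∧
      ∀ p, dist (F p) (f (p.1 * p.2)) < ε := by
    intro ε hε
    obtain ⟨V, hV, hVf⟩ := exists_nhds_one_forall_dist_lt hf hc hε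
    have hcov : ∀ x : G, ∃ W : Set G, (∀ y ∈ W, y * x⁻¹ ∈ V) ∧ W ∈ 𝓝 x ∧
        MeasurableSet (show Set (BaireGroup G) from W) := fun x => by
      have h1 : {y : G | y * x⁻¹ ∈ V} ∈ 𝓝 x := by
        have h2 : ContinuousAt (fun y : G => y * x⁻¹) x := by fun_prop
        exact h2 (by simpa using hV)
      obtain ⟨W, hW, h⟩ := exists_measurableSet_baire_subset h1
      exact ⟨W, fun y hy => hW hy, h⟩
    choose W hWV hWn hWm using hcov
    obtain ⟨S, hS, hSU⟩ := countable_cover_nhds_of_sigmaCompact hWn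
    have hne : S.Nonempty := by
      by_contra h
      rw [Set.not_nonempty_iff_eq_empty] at h
      have h1 : (1 : G) ∈ ⋃ x ∈ S, W x := hSU ▸ Set.mem_univ _
      simp [h] at h1
    obtain ⟨a, rfl⟩ := hS.exists_eq_range hne
    have hex : ∀ x : BaireGroup G, ∃ n, @id G x ∈ W (a n) := fun x => by
      have h1 : @id G x ∈ ⋃ x ∈ Set.range a, W x := hSU ▸ Set.mem_univ _
      simpa using h1
    classical
    refine ⟨fun p => f (a (Nat.find (hex p.1)) * @id G p.2), ?_, fun p => ?_⟩
    · have h1 : Measurable fun q : ℕ × BaireGroup G => f (a q.1 * @id G q.2) :=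
        measurable_from_prod_countable_right fun n =>
          measurable_baire (hf.comp (continuous_const_mul (a n)))
            (hc.comp_homeomorph (Homeomorph.mulLeft (a n)))
      have h2 : Measurable fun x : BaireGroup G => Nat.find (hex x) :=
        measurable_find hex fun n => hWm (a n)
      exact h1.comp ((h2.comp measurable_fst).prodMk measurable_snd)
    · have h1 := hVf _ (hWV _ _ (Nat.find_spec (hex p.1))) (a (Nat.find (hex p.1)) * @id G p.2)
      have h2 : @id G p.1 * (a (Nat.find (hex p.1)))⁻¹ * (a (Nat.find (hex p.1)) * @id G p.2) =
          @id G p.1 * @id G p.2 := by group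
      rw [h2] at h1
      exact h1
  choose F hFm hF using fun n : ℕ => key (1 / ((n : ℝ) + 1)) (by positivity)
  refine measurable_of_tendsto_metrizable hFm (tendsto_pi_nhds.2 fun p => ?_)
  rw [tendsto_iff_dist_tendsto_zero]
  exact squeeze_zero (fun _ => dist_nonneg) (fun n => (hF n p).le)
    tendsto_one_div_add_atTop_nhds_zero_nat

variable [T2Space G] [MeasurableSpace G] [BorelSpace G] {μ : Measure G}

/-- Outer regularity and Urysohn functions give Baire sets `{k = 1}` between `K` and open sets of
nearly the same measure; their intersection works. -/
lemma exists_measurableSet_baire_ae_eq_of_isCompact [μ.OuterRegular]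
    [IsFiniteMeasureOnCompacts μ] {K : Set G} (hK : IsCompact K) :
    ∃ T : Set (BaireGroup G), MeasurableSet T ∧ K ⊆ toBaire G ⁻¹' T ∧
      μ (toBaire G ⁻¹' T \ K) = 0 := by
  have h : ∀ n : ℕ, ∃ T : Set (BaireGroup G), MeasurableSet T ∧ K ⊆ toBaire G ⁻¹' T ∧
      μ (toBaire G ⁻¹' T) ≤ μ K + (n + 1 : ℝ≥0∞)⁻¹ := fun n => by
    obtain ⟨U, hKU, hU, hμU⟩ := K.exists_isOpen_lt_add (μ := μ) hK.measure_lt_top.ne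
      (ε := (n + 1 : ℝ≥0∞)⁻¹) (by simp)
    obtain ⟨k, hk1, hk0, hkc, -⟩ := exists_continuous_one_zero_of_isCompact hK
      hU.isClosed_compl (Set.disjoint_compl_right_iff_subset.2 hKU)
    refine ⟨(fun x : BaireGroup G => k x) ⁻¹' {1}, measurable_baire k.continuous hkc
      (measurableSet_singleton 1), fun x hx => hk1 hx, le_trans (measure_mono fun x hx => ?_) hμU.le⟩
    by_contra hxU
    have h1 : k x = 0 := hk0 hxU
    have h2 : k x = 1 := hx
    rw [h1] at h2
    exact zero_ne_one h2
  choose T hTm hKT hT using h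
  refine ⟨⋂ n, T n, MeasurableSet.iInter hTm, ?_, ?_⟩
  · rw [Set.preimage_iInter]
    exact Set.subset_iInter hKT
  · rw [measure_sdiff _ hK.measurableSet.nullMeasurableSet hK.measure_lt_top.ne, tsub_eq_zero_iff_le]
    · have h3 : Tendsto (fun k : ℕ => μ K + (k + 1 : ℝ≥0∞)⁻¹) atTop (𝓝 (μ K + 0)) := by
        have := (tendsto_add_atTop_iff_nat 1).2 ENNReal.tendsto_inv_nat_nhds_zero
        exact Tendsto.const_add _ (by simpa using this)
      rw [add_zero] at h3
      refine ge_of_tendsto' h3 fun n => le_trans (measure_mono ?_) (hT n)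
      exact Set.preimage_mono (Set.iInter_subset T n)
    · rw [Set.preimage_iInter]
      exact Set.subset_iInter hKT

lemma exists_measurableSet_baire_ae_eq [SigmaFinite μ] [μ.Regular] {E : Set G}
    (hE : MeasurableSet E) :
    ∃ T : Set (BaireGroup G), MeasurableSet T ∧ toBaire G ⁻¹' T =ᵐ[μ] E := by
  obtain ⟨K, hK, hKE, hμ⟩ := exists_isCompact_measure_diff_iUnion_eq_zero (μ := μ) hE
  choose T hTm hKT hT using fun i => exists_measurableSet_baire_ae_eq_of_isCompact (μ := μ) (hK i)
  refine ⟨⋃ i, T i, MeasurableSet.iUnion hTm, ?_⟩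
  rw [ae_eq_set]
  constructor
  · refine measure_mono_null (t := ⋃ i, (toBaire G ⁻¹' T i \ K i)) ?_ (measure_iUnion_null hT)
    rintro x ⟨hx, hxE⟩
    obtain ⟨i, hi⟩ := Set.mem_iUnion.1 hx
    exact Set.mem_iUnion.2 ⟨i, hi, fun h => hxE (hKE i h)⟩
  · refine measure_mono_null (Set.sdiff_subset_sdiff_right ?_) hμ
    rw [Set.preimage_iUnion]
    exact Set.iUnion_mono hKT

end Baire

/-! ### Transfer of functions to a measurable model -/

section Model

variable {G H : Type*} [Group G] [MeasurableSpace G] [Group H] [MeasurableSpace H]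

/-- `φ : G → H` is measure preserving, and every measurable set of `G` is almost everywhere equal
to the preimage of a measurable set of `H`. -/
structure IsMeasurableModel (μ : Measure G) (ν : Measure H) (φ : G →* H) : Prop where
  measurePreserving : MeasurePreserving φ μ ν
  exists_ae_eq : ∀ E : Set G, MeasurableSet E → ∃ T : Set H, MeasurableSet T ∧ φ ⁻¹' T =ᵐ[μ] E

variable {μ : Measure G} {ν : Measure H} {φ : G →* H}

/-- A function is recovered from its sublevel sets at rational heights; these are countably many, so
one null set suffices. -/
lemma IsMeasurableModel.exists_ennreal (hφ : IsMeasurableModel μ ν φ) {f : G → ℝ≥0∞}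
    (hf : AEMeasurable f μ) : ∃ f₀ : H → ℝ≥0∞, Measurable f₀ ∧ f =ᵐ[μ] f₀ ∘ φ := by
  obtain ⟨f', hf', hff'⟩ := hf
  have h : ∀ q : ℚ, ∃ T : Set H, MeasurableSet T ∧
      φ ⁻¹' T =ᵐ[μ] {x | f' x < ENNReal.ofReal q} := fun q =>
    hφ.exists_ae_eq _ (measurableSet_lt hf' measurable_const)
  choose T hT hTe using h
  classical
  refine ⟨fun y => ⨅ q : ℚ, if y ∈ T q then ENNReal.ofReal q else ∞,
    Measurable.iInf fun q => Measurable.ite (hT q) measurable_const measurable_const, ?_⟩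
  filter_upwards [hff', ae_all_iff.2 hTe] with x hx hTx
  rw [hx, Function.comp_apply]
  have hTx' : ∀ q : ℚ, φ x ∈ T q ↔ f' x < ENNReal.ofReal q := fun q => by
    have := hTx q
    exact this.to_iff
  simp only [hTx']
  refine le_antisymm (le_iInf fun q => ?_) (le_of_forall_gt fun b hb => ?_)
  · split_ifs with h
    · exact h.le
    · exact le_top
  · obtain ⟨q, -, hq1, hq2⟩ := ENNReal.lt_iff_exists_rat_btwn.1 hb
    refine (iInf_le _ q).trans_lt ?_
    rw [← ENNReal.ofReal] at hq1 hq2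
    rw [if_pos hq1]
    exact hq2

lemma IsMeasurableModel.exists_complex (hφ : IsMeasurableModel μ ν φ) {f : G → ℂ}
    (hf : AEStronglyMeasurable f μ) : ∃ f₀ : H → ℂ, Measurable f₀ ∧ f =ᵐ[μ] f₀ ∘ φ := by
  have hm := hf.aemeasurable
  have hr : AEMeasurable (fun x => (f x).re) μ := Complex.measurable_re.comp_aemeasurable hm
  have hi : AEMeasurable (fun x => (f x).im) μ := Complex.measurable_im.comp_aemeasurable hm
  obtain ⟨a, ha, ha'⟩ := hφ.exists_ennreal hr.ennreal_ofReal
  obtain ⟨b, hb, hb'⟩ := hφ.exists_ennreal hr.neg.ennreal_ofReal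
  obtain ⟨c, hc, hc'⟩ := hφ.exists_ennreal hi.ennreal_ofReal
  obtain ⟨d, hd, hd'⟩ := hφ.exists_ennreal hi.neg.ennreal_ofReal
  refine ⟨fun y => (((a y).toReal - (b y).toReal : ℝ) : ℂ) +
    (((c y).toReal - (d y).toReal : ℝ) : ℂ) * Complex.I, ?_, ?_⟩
  · have h1 : Measurable fun y => (a y).toReal - (b y).toReal := ha.ennreal_toReal.sub hb.ennreal_toReal
    have h2 : Measurable fun y => (c y).toReal - (d y).toReal := hc.ennreal_toReal.sub hd.ennreal_toReal
    exact (Complex.measurable_ofReal.comp h1).add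
      ((Complex.measurable_ofReal.comp h2).mul_const _)
  · filter_upwards [ha', hb', hc', hd'] with x h1 h2 h3 h4
    have key : ∀ t : ℝ, (ENNReal.ofReal t).toReal - (ENNReal.ofReal (-t)).toReal = t := fun t => by
      rw [ENNReal.toReal_ofReal', ENNReal.toReal_ofReal']
      exact max_zero_sub_max_neg_zero_eq_self t
    simp only [Function.comp_apply] at h1 h2 h3 h4 ⊢
    rw [← h1, ← h2, ← h3, ← h4]
    simp only [Pi.neg_apply, key]
    exact (Complex.re_add_im (f x)).symm

lemma IsMeasurableModel.lintegral_comp (hφ : IsMeasurableModel μ ν φ) {f : H → ℝ≥0∞}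
    (hf : Measurable f) : ∫⁻ x, f (φ x) ∂μ = ∫⁻ y, f y ∂ν := hφ.measurePreserving.lintegral_comp hf

lemma IsMeasurableModel.integral_comp (hφ : IsMeasurableModel μ ν φ) {f : H → ℂ}
    (hf : Measurable f) : ∫ x, f (φ x) ∂μ = ∫ y, f y ∂ν := by
  rw [← hφ.measurePreserving.map_eq]
  exact (integral_map hφ.measurePreserving.measurable.aemeasurable hf.aestronglyMeasurable).symm

end Model

section Group

variable {G : Type*} [Group G] [MeasurableSpace G] [MeasurableMul G] [MeasurableInv G]
  {μ : Measure G} [μ.IsMulRightInvariant] [μ.IsInvInvariant]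

lemma measurePreserving_inv_mul (x : G) : MeasurePreserving (fun y => y⁻¹ * x) μ μ :=
  (measurePreserving_mul_right μ x).comp (Measure.measurePreserving_inv μ)

lemma ae_eq_comp_inv_mul {β : Type*} {f g : G → β} (h : f =ᵐ[μ] g) (x : G) :
    (fun y => f (y⁻¹ * x)) =ᵐ[μ] fun y => g (y⁻¹ * x) :=
  (measurePreserving_inv_mul x).quasiMeasurePreserving.ae_eq_comp h

lemma ae_eq_comp_inv_mul_left {G : Type*} [Group G] [MeasurableSpace G] [MeasurableMul G]
    {μ : Measure G} [μ.IsMulLeftInvariant] {β : Type*} {f g : G → β} (h : f =ᵐ[μ] g)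
    (y : G) : (fun x => f (y⁻¹ * x)) =ᵐ[μ] fun x => g (y⁻¹ * x) :=
  (measurePreserving_mul_left μ y⁻¹).quasiMeasurePreserving.ae_eq_comp h

end Group

/-- The convolution `(f * g)(x) = ∫ f(y) g(y⁻¹ x) dy`. -/
noncomputable def conv {G : Type*} [Group G] [MeasurableSpace G] (μ : Measure G) (f g : G → ℂ)
    (x : G) : ℂ :=
  ∫ y, f y * g (y⁻¹ * x) ∂μ

/-! ### Fubini for convolutions -/

section Fubini

variable {G H : Type*} [Group G] [MeasurableSpace G] [MeasurableMul G] [MeasurableInv G]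
  [Group H] [MeasurableSpace H] [MeasurableMul₂ H] [MeasurableInv H]
  {μ : Measure G} [μ.IsMulRightInvariant] [μ.IsInvInvariant] {ν : Measure H} {φ : G →* H}

/-- The identity holds at every `x`, not just almost everywhere, because `y ↦ y⁻¹ x` preserves the
measure. -/
lemma mlconvolution_eq_comp (hφ : IsMeasurableModel μ ν φ) {f g : G → ℝ≥0∞} {f₀ g₀ : H → ℝ≥0∞}
    (hf₀ : Measurable f₀) (hg₀ : Measurable g₀) (hf : f =ᵐ[μ] f₀ ∘ φ) (hg : g =ᵐ[μ] g₀ ∘ φ) (x : G) :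
    mlconvolution f g μ x = mlconvolution f₀ g₀ ν (φ x) := by
  simp only [mlconvolution_def]
  rw [← hφ.lintegral_comp (f := fun y => f₀ y * g₀ (y⁻¹ * φ x)) (by fun_prop)]
  refine lintegral_congr_ae ?_
  filter_upwards [hf, ae_eq_comp_inv_mul hg x] with y h1 h2
  rw [h1, h2]
  simp

lemma aemeasurable_mlconvolution_of_model [SFinite ν] (hφ : IsMeasurableModel μ ν φ) {f g : G → ℝ≥0∞}
    (hf : AEMeasurable f μ) (hg : AEMeasurable g μ) : AEMeasurable (mlconvolution f g μ) μ := by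
  obtain ⟨f₀, hf₀, hff⟩ := hφ.exists_ennreal hf
  obtain ⟨g₀, hg₀, hgg⟩ := hφ.exists_ennreal hg
  have h : mlconvolution f g μ = fun x => mlconvolution f₀ g₀ ν (φ x) :=
    funext fun x => mlconvolution_eq_comp hφ hf₀ hg₀ hff hgg x
  rw [h]
  exact ((measurable_mlconvolution ν hf₀ hg₀).comp hφ.measurePreserving.measurable).aemeasurable

/-- Both sides are moved to the model, where the integrand is jointly measurable and Tonelli
applies. -/
lemma lintegral_mul_mlconvolution [SFinite ν] [μ.IsMulLeftInvariant]
    (hφ : IsMeasurableModel μ ν φ) {f g h : G → ℝ≥0∞}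
    (hf : AEMeasurable f μ) (hg : AEMeasurable g μ) (hh : AEMeasurable h μ) :
    ∫⁻ x, h x * mlconvolution f g μ x ∂μ = ∫⁻ y, f y * ∫⁻ x, g (y⁻¹ * x) * h x ∂μ ∂μ := by
  obtain ⟨f₀, hf₀, hff⟩ := hφ.exists_ennreal hf
  obtain ⟨g₀, hg₀, hgg⟩ := hφ.exists_ennreal hg
  obtain ⟨h₀, hh₀, hhh⟩ := hφ.exists_ennreal hh
  have e1 : ∫⁻ x, h x * mlconvolution f g μ x ∂μ = ∫⁻ x, h₀ x * mlconvolution f₀ g₀ ν x ∂ν := by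
    rw [← hφ.lintegral_comp (f := fun x => h₀ x * mlconvolution f₀ g₀ ν x)
      (hh₀.mul (measurable_mlconvolution ν hf₀ hg₀))]
    refine lintegral_congr_ae ?_
    filter_upwards [hhh] with x hx
    rw [hx, mlconvolution_eq_comp hφ hf₀ hg₀ hff hgg, Function.comp_apply]
  have e2 : ∀ y, ∫⁻ x, g (y⁻¹ * x) * h x ∂μ = ∫⁻ x, g₀ ((φ y)⁻¹ * x) * h₀ x ∂ν := fun y => by
    rw [← hφ.lintegral_comp (f := fun x => g₀ ((φ y)⁻¹ * x) * h₀ x) (by fun_prop)]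
    refine lintegral_congr_ae ?_
    filter_upwards [hhh, ae_eq_comp_inv_mul_left hgg y] with x h1 h2
    rw [h1, h2]
    simp
  have e3 : ∫⁻ y, f y * ∫⁻ x, g (y⁻¹ * x) * h x ∂μ ∂μ =
      ∫⁻ y, f₀ y * ∫⁻ x, g₀ (y⁻¹ * x) * h₀ x ∂ν ∂ν := by
    rw [← hφ.lintegral_comp (f := fun y => f₀ y * ∫⁻ x, g₀ (y⁻¹ * x) * h₀ x ∂ν) (by fun_prop)]
    refine lintegral_congr_ae ?_
    filter_upwards [hff] with y hy
    rw [hy, e2, Function.comp_apply]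
  rw [e1, e3]
  simp only [mlconvolution_def]
  have e4 : ∀ x, h₀ x * ∫⁻ y, f₀ y * g₀ (y⁻¹ * x) ∂ν = ∫⁻ y, h₀ x * (f₀ y * g₀ (y⁻¹ * x)) ∂ν :=
    fun x => (lintegral_const_mul _ (by fun_prop)).symm
  have e5 : ∀ y, f₀ y * ∫⁻ x, g₀ (y⁻¹ * x) * h₀ x ∂ν = ∫⁻ x, h₀ x * (f₀ y * g₀ (y⁻¹ * x)) ∂ν :=
    fun y => by
      rw [← lintegral_const_mul _ (by fun_prop)]
      exact lintegral_congr fun x => by ring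
  simp only [e4, e5]
  exact lintegral_lintegral_swap (Measurable.aemeasurable (by fun_prop))

lemma conv_eq_comp (hφ : IsMeasurableModel μ ν φ) {f g : G → ℂ} {f₀ g₀ : H → ℂ}
    (hf₀ : Measurable f₀) (hg₀ : Measurable g₀) (hf : f =ᵐ[μ] f₀ ∘ φ) (hg : g =ᵐ[μ] g₀ ∘ φ) (x : G) :
    conv μ f g x = conv ν f₀ g₀ (φ x) := by
  simp only [conv]
  rw [← hφ.integral_comp (f := fun y => f₀ y * g₀ (y⁻¹ * φ x)) (by fun_prop)]
  refine integral_congr_ae ?_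
  filter_upwards [hf, ae_eq_comp_inv_mul hg x] with y h1 h2
  rw [h1, h2]
  simp

lemma measurable_conv [SFinite ν] {f g : H → ℂ} (hf : Measurable f) (hg : Measurable g) :
    Measurable (conv ν f g) := by
  have h : StronglyMeasurable (Function.uncurry fun x y : H => f y * g (y⁻¹ * x)) :=
    Measurable.stronglyMeasurable (by fun_prop)
  exact h.integral_prod_right.measurable

lemma aestronglyMeasurable_conv [SFinite ν] (hφ : IsMeasurableModel μ ν φ) {f g : G → ℂ}
    (hf : AEStronglyMeasurable f μ) (hg : AEStronglyMeasurable g μ) :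
    AEStronglyMeasurable (conv μ f g) μ := by
  obtain ⟨f₀, hf₀, hff⟩ := hφ.exists_complex hf
  obtain ⟨g₀, hg₀, hgg⟩ := hφ.exists_complex hg
  have h : conv μ f g = fun x => conv ν f₀ g₀ (φ x) :=
    funext fun x => conv_eq_comp hφ hf₀ hg₀ hff hgg x
  rw [h]
  exact ((measurable_conv hf₀ hg₀).comp hφ.measurePreserving.measurable).aestronglyMeasurable

lemma integral_mul_conv [SFinite ν] [μ.IsMulLeftInvariant]
    (hφ : IsMeasurableModel μ ν φ) {f g h : G → ℂ}
    (hf : AEStronglyMeasurable f μ) (hg : AEStronglyMeasurable g μ) (hh : AEStronglyMeasurable h μ)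
    (hfin : ∫⁻ x, ‖h x‖ₑ * mlconvolution (fun x => ‖f x‖ₑ) (fun x => ‖g x‖ₑ) μ x ∂μ ≠ ∞) :
    ∫ x, h x * conv μ f g x ∂μ = ∫ y, f y * ∫ x, g (y⁻¹ * x) * h x ∂μ ∂μ := by
  obtain ⟨f₀, hf₀, hff⟩ := hφ.exists_complex hf
  obtain ⟨g₀, hg₀, hgg⟩ := hφ.exists_complex hg
  obtain ⟨h₀, hh₀, hhh⟩ := hφ.exists_complex hh
  have e1 : ∫ x, h x * conv μ f g x ∂μ = ∫ x, h₀ x * conv ν f₀ g₀ x ∂ν := by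
    rw [← hφ.integral_comp (f := fun x => h₀ x * conv ν f₀ g₀ x) (hh₀.mul (measurable_conv hf₀ hg₀))]
    refine integral_congr_ae ?_
    filter_upwards [hhh] with x hx
    rw [hx, conv_eq_comp hφ hf₀ hg₀ hff hgg, Function.comp_apply]
  have e2 : ∀ y, ∫ x, g (y⁻¹ * x) * h x ∂μ = ∫ x, g₀ ((φ y)⁻¹ * x) * h₀ x ∂ν := fun y => by
    rw [← hφ.integral_comp (f := fun x => g₀ ((φ y)⁻¹ * x) * h₀ x) (by fun_prop)]
    refine integral_congr_ae ?_
    filter_upwards [hhh, ae_eq_comp_inv_mul_left hgg y] with x h1 h2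
    rw [h1, h2]
    simp
  have e6 : Measurable fun y => ∫ x, g₀ (y⁻¹ * x) * h₀ x ∂ν := by
    have h : StronglyMeasurable (Function.uncurry fun y x : H => g₀ (y⁻¹ * x) * h₀ x) :=
      Measurable.stronglyMeasurable (by fun_prop)
    exact h.integral_prod_right.measurable
  have e3 : ∫ y, f y * ∫ x, g (y⁻¹ * x) * h x ∂μ ∂μ =
      ∫ y, f₀ y * ∫ x, g₀ (y⁻¹ * x) * h₀ x ∂ν ∂ν := by
    rw [← hφ.integral_comp (f := fun y => f₀ y * ∫ x, g₀ (y⁻¹ * x) * h₀ x ∂ν) (hf₀.mul e6)]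
    refine integral_congr_ae ?_
    filter_upwards [hff] with y hy
    rw [hy, e2, Function.comp_apply]
  have hfin' : ∫⁻ x, ∫⁻ y, ‖h₀ x * (f₀ y * g₀ (y⁻¹ * x))‖ₑ ∂ν ∂ν ≠ ∞ := by
    have e7 : ∫⁻ x, ‖h x‖ₑ * mlconvolution (fun x => ‖f x‖ₑ) (fun x => ‖g x‖ₑ) μ x ∂μ =
        ∫⁻ x, ‖h₀ x‖ₑ * mlconvolution (fun x => ‖f₀ x‖ₑ) (fun x => ‖g₀ x‖ₑ) ν x ∂ν := by
      rw [← hφ.lintegral_comp (f := fun x => ‖h₀ x‖ₑ *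
        mlconvolution (fun x => ‖f₀ x‖ₑ) (fun x => ‖g₀ x‖ₑ) ν x)
        (hh₀.enorm.mul (measurable_mlconvolution ν hf₀.enorm hg₀.enorm))]
      refine lintegral_congr_ae ?_
      filter_upwards [hhh] with x hx
      rw [hx, mlconvolution_eq_comp hφ hf₀.enorm hg₀.enorm (hff.mono fun y hy => by simp [hy])
        (hgg.mono fun y hy => by simp [hy]), Function.comp_apply]
    rw [e7] at hfin
    convert hfin using 3 with x
    rw [mlconvolution_def, ← lintegral_const_mul _ (by fun_prop)]
    exact lintegral_congr fun y => by rw [enorm_mul, enorm_mul]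
  rw [e1, e3]
  simp only [conv]
  have e4 : ∀ x, h₀ x * ∫ y, f₀ y * g₀ (y⁻¹ * x) ∂ν = ∫ y, h₀ x * (f₀ y * g₀ (y⁻¹ * x)) ∂ν :=
    fun x => (integral_const_mul _ _).symm
  have e5 : ∀ y, f₀ y * ∫ x, g₀ (y⁻¹ * x) * h₀ x ∂ν = ∫ x, h₀ x * (f₀ y * g₀ (y⁻¹ * x)) ∂ν :=
    fun y => by
      rw [← integral_const_mul]
      exact integral_congr_ae (ae_of_all _ fun x => by ring)
  simp only [e4, e5]
  have hmeas : Measurable (Function.uncurry fun x y => h₀ x * (f₀ y * g₀ (y⁻¹ * x))) := by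
    fun_prop
  refine integral_integral_swap ⟨hmeas.aestronglyMeasurable, ?_⟩
  rw [HasFiniteIntegral, lintegral_prod _ hmeas.enorm.aemeasurable]
  exact lt_top_iff_ne_top.2 hfin'

end Fubini

lemma isMeasurableModel_toBaire {G : Type*} [Group G] [TopologicalSpace G] [IsTopologicalGroup G]
    [LocallyCompactSpace G] [T2Space G] [MeasurableSpace G] [BorelSpace G] (μ : Measure G)
    [SigmaFinite μ] [μ.Regular] : IsMeasurableModel μ (μ.map (toBaire G)) (toBaire G) :=
  ⟨measurable_toBaire.measurePreserving μ, fun _ hE => exists_measurableSet_baire_ae_eq hE⟩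

section AbsConv

variable {G H : Type*} [Group G] [MeasurableSpace G] [MeasurableMul G] [MeasurableInv G]
  [Group H] [MeasurableSpace H] [MeasurableMul₂ H] [MeasurableInv H]
  {μ : Measure G} [μ.IsMulRightInvariant] [μ.IsInvInvariant]
  {ν : Measure H} [SFinite ν] {φ : G →* H}

/-- The convolution of the absolute values. -/
noncomputable def absConv (μ : Measure G) (f g : G → ℂ) : G → ℝ≥0∞ :=
  mlconvolution (fun x => ‖f x‖ₑ) (fun x => ‖g x‖ₑ) μ

lemma aemeasurable_absConv (hφ : IsMeasurableModel μ ν φ) {f g : G → ℂ}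
    (hf : AEStronglyMeasurable f μ) (hg : AEStronglyMeasurable g μ) :
    AEMeasurable (absConv μ f g) μ :=
  aemeasurable_mlconvolution_of_model hφ hf.enorm hg.enorm

lemma aestronglyMeasurable_mul_comp_inv_mul {f g : G → ℂ} (hf : AEStronglyMeasurable f μ)
    (hg : AEStronglyMeasurable g μ) (x : G) :
    AEStronglyMeasurable (fun y => f y * g (y⁻¹ * x)) μ :=
  hf.mul (hg.comp_quasiMeasurePreserving (measurePreserving_inv_mul x).quasiMeasurePreserving)

lemma conv_congr_ae {f f' g g' : G → ℂ} (hf : f =ᵐ[μ] f') (hg : g =ᵐ[μ] g') :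
    conv μ f g = conv μ f' g' := by
  ext x
  refine integral_congr_ae ?_
  filter_upwards [hf, ae_eq_comp_inv_mul hg x] with y h1 h2
  rw [h1, h2]

end AbsConv

/-! ### Young's inequality and the algebra of convolution -/

section Young

variable {G H : Type*} [Group G] [MeasurableSpace G] [MeasurableMul G] [MeasurableInv G]
  [Group H] [MeasurableSpace H] [MeasurableMul₂ H] [MeasurableInv H]
  {μ : Measure G} [μ.IsMulLeftInvariant] [μ.IsMulRightInvariant] [μ.IsInvInvariant]
  {ν : Measure H} [SFinite ν] {φ : G →* H}

lemma lintegral_mlconvolution (hφ : IsMeasurableModel μ ν φ) {f g : G → ℝ≥0∞}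
    (hf : AEMeasurable f μ) (hg : AEMeasurable g μ) :
    ∫⁻ x, mlconvolution f g μ x ∂μ = (∫⁻ x, f x ∂μ) * ∫⁻ x, g x ∂μ := by
  have h := lintegral_mul_mlconvolution hφ hf hg (h := fun _ => 1) aemeasurable_const
  simp only [one_mul, mul_one, lintegral_mul_left_eq_self] at h
  rw [h, lintegral_mul_const'' _ hf]

/-- Hölder applied to `f g = f^(1-1/P) (f g^P)^(1/P)` in the inner integral, followed by the `L¹`
identity for `f * g^P`. -/
lemma lintegral_mlconvolution_rpow_le (hφ : IsMeasurableModel μ ν φ) {f g : G → ℝ≥0∞}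
    (hf : AEMeasurable f μ) (hg : AEMeasurable g μ) {P : ℝ} (hP : 1 ≤ P) :
    ∫⁻ x, mlconvolution f g μ x ^ P ∂μ ≤ (∫⁻ x, f x ∂μ) ^ P * ∫⁻ x, g x ^ P ∂μ := by
  have hP0 : 0 < P := by linarith
  have hb : 0 ≤ 1 - 1 / P := by
    rw [sub_nonneg, div_le_one hP0]
    exact hP
  have hgP : AEMeasurable (fun x => g x ^ P) μ := hg.pow_const _
  have h1 : ∀ x, mlconvolution f g μ x ^ P ≤
      (∫⁻ x, f x ∂μ) ^ (P - 1) * mlconvolution f (fun x => g x ^ P) μ x := by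
    intro x
    have hgx : AEMeasurable (fun y => g (y⁻¹ * x)) μ :=
      hg.comp_quasiMeasurePreserving (measurePreserving_inv_mul x).quasiMeasurePreserving
    have h2 := ENNReal.lintegral_mul_norm_pow_le (μ := μ) hf
      (g := fun y => f y * g (y⁻¹ * x) ^ P) (hf.mul (hgx.pow_const _)) hb
      (show 0 ≤ 1 / P by positivity) (by ring)
    have h3 : ∀ y, f y ^ (1 - 1 / P) * (f y * g (y⁻¹ * x) ^ P) ^ (1 / P) = f y * g (y⁻¹ * x) := by
      intro y
      rw [ENNReal.mul_rpow_of_nonneg _ _ (by positivity), ← ENNReal.rpow_mul,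
        mul_one_div_cancel hP0.ne', ENNReal.rpow_one, ← mul_assoc,
        ← ENNReal.rpow_add_of_nonneg _ _ hb (by positivity)]
      simp
    simp only [h3] at h2
    rw [mlconvolution_def, mlconvolution_def]
    calc (∫⁻ y, f y * g (y⁻¹ * x) ∂μ) ^ P
        ≤ ((∫⁻ y, f y ∂μ) ^ (1 - 1 / P) *
          (∫⁻ y, f y * g (y⁻¹ * x) ^ P ∂μ) ^ (1 / P)) ^ P := by gcongr
      _ = _ := by
        rw [ENNReal.mul_rpow_of_nonneg _ _ hP0.le, ← ENNReal.rpow_mul, ← ENNReal.rpow_mul,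
          one_div_mul_cancel hP0.ne', ENNReal.rpow_one, sub_mul, one_mul,
          one_div_mul_cancel hP0.ne']
  calc ∫⁻ x, mlconvolution f g μ x ^ P ∂μ
      ≤ ∫⁻ x, (∫⁻ x, f x ∂μ) ^ (P - 1) * mlconvolution f (fun x => g x ^ P) μ x ∂μ :=
        lintegral_mono h1
    _ = (∫⁻ x, f x ∂μ) ^ (P - 1) * ((∫⁻ x, f x ∂μ) * ∫⁻ x, g x ^ P ∂μ) := by
        rw [lintegral_const_mul'' _ (aemeasurable_mlconvolution_of_model hφ hf hgP),
          lintegral_mlconvolution hφ hf hgP]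
    _ = _ := by
        rw [← mul_assoc]
        nth_rewrite 2 [← ENNReal.rpow_one (∫⁻ x, f x ∂μ)]
        rw [← ENNReal.rpow_add_of_nonneg _ _ (by linarith) zero_le_one, sub_add_cancel]

lemma eLpNorm_mlconvolution_le (hφ : IsMeasurableModel μ ν φ) {f g : G → ℝ≥0∞}
    (hf : AEMeasurable f μ) (hg : AEMeasurable g μ) {p : ℝ≥0∞} (hp1 : 1 ≤ p) (hp : p ≠ ∞) :
    eLpNorm (mlconvolution f g μ) p μ ≤ (∫⁻ x, f x ∂μ) * eLpNorm g p μ := by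
  have hp0 : p ≠ 0 := (one_pos.trans_le hp1).ne'
  have hP : 1 ≤ p.toReal := by
    rw [← ENNReal.toReal_one]
    exact (ENNReal.toReal_le_toReal ENNReal.one_ne_top hp).2 hp1
  rw [eLpNorm_eq_lintegral_rpow_enorm_toReal hp0 hp, eLpNorm_eq_lintegral_rpow_enorm_toReal hp0 hp]
  simp only [enorm_eq_self]
  calc _ ≤ ((∫⁻ x, f x ∂μ) ^ p.toReal * ∫⁻ x, g x ^ p.toReal ∂μ) ^ (1 / p.toReal) := by
        gcongr
        exact lintegral_mlconvolution_rpow_le hφ hf hg hP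
    _ = _ := by
        rw [ENNReal.mul_rpow_of_nonneg _ _ (by positivity), ← ENNReal.rpow_mul,
          mul_one_div_cancel (by linarith), ENNReal.rpow_one]

lemma mlconvolution_inv {G : Type*} [Group G] [MeasurableSpace G] [MeasurableMul G] {μ : Measure G}
    [μ.IsMulLeftInvariant] (f g : G → ℝ≥0∞) (x : G) :
    mlconvolution f g μ x = mlconvolution (fun y => g y⁻¹) (fun y => f y⁻¹) μ x⁻¹ := by
  rw [mlconvolution_def, mlconvolution_def, ← lintegral_mul_left_eq_self _ x]
  refine lintegral_congr fun y => ?_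
  rw [mul_comm (g _)]
  simp

/-- Inversion exchanges the two factors and preserves all norms, since the measure is inversion
invariant. -/
lemma eLpNorm_mlconvolution_le' (hφ : IsMeasurableModel μ ν φ) {f g : G → ℝ≥0∞}
    (hf : AEMeasurable f μ) (hg : AEMeasurable g μ) {p : ℝ≥0∞} (hp1 : 1 ≤ p) (hp : p ≠ ∞) :
    eLpNorm (mlconvolution f g μ) p μ ≤ eLpNorm f p μ * ∫⁻ x, g x ∂μ := by
  have hinv := Measure.measurePreserving_inv μ
  have hf' : AEMeasurable (fun y => f y⁻¹) μ :=
    hf.comp_quasiMeasurePreserving hinv.quasiMeasurePreserving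
  have hg' : AEMeasurable (fun y => g y⁻¹) μ :=
    hg.comp_quasiMeasurePreserving hinv.quasiMeasurePreserving
  have h := eLpNorm_mlconvolution_le hφ hg' hf' hp1 hp
  have h1 : eLpNorm (fun y => f y⁻¹) p μ = eLpNorm f p μ :=
    eLpNorm_comp_measurePreserving hf.aestronglyMeasurable hinv
  have h2 : eLpNorm (mlconvolution f g μ) p μ =
      eLpNorm (mlconvolution (fun y => g y⁻¹) (fun y => f y⁻¹) μ) p μ := by
    rw [show mlconvolution f g μ =
      mlconvolution (fun y => g y⁻¹) (fun y => f y⁻¹) μ ∘ Inv.inv from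
        funext fun x => mlconvolution_inv f g x]
    exact eLpNorm_comp_measurePreserving
      (aemeasurable_mlconvolution_of_model hφ hg' hf').aestronglyMeasurable hinv
  rw [h2, mul_comm, ← h1, ← lintegral_inv_eq_self g]
  exact h

lemma enorm_conv_le {G : Type*} [Group G] [MeasurableSpace G] {μ : Measure G} (f g : G → ℂ) (x : G) :
    ‖conv μ f g x‖ₑ ≤ absConv μ f g x := by
  refine (enorm_integral_le_lintegral_enorm _).trans (le_of_eq ?_)
  exact lintegral_congr fun y => enorm_mul _ _

lemma eLpNorm_absConv_le (hφ : IsMeasurableModel μ ν φ) {f g : G → ℂ}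
    (hf : AEStronglyMeasurable f μ) (hg : AEStronglyMeasurable g μ) {p : ℝ≥0∞} (hp1 : 1 ≤ p)
    (hp : p ≠ ∞) : eLpNorm (absConv μ f g) p μ ≤ eLpNorm f 1 μ * eLpNorm g p μ := by
  rw [eLpNorm_one_eq_lintegral_enorm, ← eLpNorm_enorm g]
  exact eLpNorm_mlconvolution_le hφ hf.enorm hg.enorm hp1 hp

lemma eLpNorm_conv_le_absConv {G : Type*} [Group G] [MeasurableSpace G] {μ : Measure G}
    (f g : G → ℂ) (p : ℝ≥0∞) : eLpNorm (conv μ f g) p μ ≤ eLpNorm (absConv μ f g) p μ :=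
  eLpNorm_mono_enorm fun x => by simpa using enorm_conv_le f g x

lemma eLpNorm_conv_le (hφ : IsMeasurableModel μ ν φ) {f g : G → ℂ}
    (hf : AEStronglyMeasurable f μ) (hg : AEStronglyMeasurable g μ) {p : ℝ≥0∞} (hp1 : 1 ≤ p)
    (hp : p ≠ ∞) : eLpNorm (conv μ f g) p μ ≤ eLpNorm f 1 μ * eLpNorm g p μ :=
  (eLpNorm_conv_le_absConv f g p).trans (eLpNorm_absConv_le hφ hf hg hp1 hp)

lemma memLp_conv (hφ : IsMeasurableModel μ ν φ) {f g : G → ℂ} {p : ℝ≥0∞} (hp1 : 1 ≤ p)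
    (hp : p ≠ ∞) (hf : MemLp f 1 μ) (hg : MemLp g p μ) : MemLp (conv μ f g) p μ :=
  ⟨aestronglyMeasurable_conv hφ hf.1 hg.1,
    (eLpNorm_conv_le hφ hf.1 hg.1 hp1 hp).trans_lt (ENNReal.mul_lt_top hf.2 hg.2)⟩

lemma ae_absConv_lt_top (hφ : IsMeasurableModel μ ν φ) {f g : G → ℂ} {p : ℝ≥0∞} (hp1 : 1 ≤ p)
    (hp : p ≠ ∞) (hf : MemLp f 1 μ) (hg : MemLp g p μ) : ∀ᵐ x ∂μ, absConv μ f g x < ∞ := by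
  have hp0 : p ≠ 0 := (one_pos.trans_le hp1).ne'
  have hP : 0 < p.toReal := ENNReal.toReal_pos hp0 hp
  have h : eLpNorm (absConv μ f g) p μ < ∞ :=
    (eLpNorm_absConv_le hφ hf.1 hg.1 hp1 hp).trans_lt (ENNReal.mul_lt_top hf.2 hg.2)
  have h1 := lintegral_rpow_enorm_lt_top_of_eLpNorm_lt_top hp0 hp h
  have h2 := ae_lt_top' ((aemeasurable_absConv hφ hf.1 hg.1).enorm.pow_const p.toReal) h1.ne
  filter_upwards [h2] with x hx
  by_contra! hc
  rw [top_le_iff] at hc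
  simp [hc, hP] at hx

lemma isConvolution_of_ae_eq (hφ : IsMeasurableModel μ ν φ) {f g h : G → ℂ} {p : ℝ≥0∞}
    (hp1 : 1 ≤ p) (hp : p ≠ ∞) (hf : MemLp f 1 μ) (hg : MemLp g p μ) (hh : h =ᵐ[μ] conv μ f g) :
    IsConvolution μ f g h := by
  filter_upwards [hh, ae_absConv_lt_top hφ hp1 hp hf hg] with x h1 h2
  refine ⟨⟨aestronglyMeasurable_mul_comp_inv_mul hf.1 hg.1 x, ?_⟩, h1⟩
  rw [HasFiniteIntegral]
  simp only [enorm_mul]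
  exact h2

lemma conv_add_left (hφ : IsMeasurableModel μ ν φ) {f f' g : G → ℂ} {p : ℝ≥0∞} (hp1 : 1 ≤ p)
    (hp : p ≠ ∞) (hf : MemLp f 1 μ) (hf' : MemLp f' 1 μ) (hg : MemLp g p μ) :
    conv μ (f + f') g =ᵐ[μ] conv μ f g + conv μ f' g := by
  filter_upwards [isConvolution_of_ae_eq hφ hp1 hp hf hg EventuallyEq.rfl,
    isConvolution_of_ae_eq hφ hp1 hp hf' hg EventuallyEq.rfl] with x h1 h2
  rw [Pi.add_apply, conv, conv, conv, ← integral_add h1.1 h2.1]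
  simp only [Pi.add_apply, add_mul]

lemma conv_add_right (hφ : IsMeasurableModel μ ν φ) {f g g' : G → ℂ} {p : ℝ≥0∞} (hp1 : 1 ≤ p)
    (hp : p ≠ ∞) (hf : MemLp f 1 μ) (hg : MemLp g p μ) (hg' : MemLp g' p μ) :
    conv μ f (g + g') =ᵐ[μ] conv μ f g + conv μ f g' := by
  filter_upwards [isConvolution_of_ae_eq hφ hp1 hp hf hg EventuallyEq.rfl,
    isConvolution_of_ae_eq hφ hp1 hp hf hg' EventuallyEq.rfl] with x h1 h2
  rw [Pi.add_apply, conv, conv, conv, ← integral_add h1.1 h2.1]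
  simp only [Pi.add_apply, mul_add]

lemma conv_smul_left {G : Type*} [Group G] [MeasurableSpace G] {μ : Measure G} (c : ℂ)
    (f g : G → ℂ) : conv μ (c • f) g = c • conv μ f g := by
  ext x
  simp only [conv, Pi.smul_apply, smul_eq_mul, mul_assoc, integral_const_mul]

lemma conv_smul_right {G : Type*} [Group G] [MeasurableSpace G] {μ : Measure G} (c : ℂ)
    (f g : G → ℂ) : conv μ f (c • g) = c • conv μ f g := by
  ext x
  simp only [conv, Pi.smul_apply, smul_eq_mul, mul_left_comm _ c, integral_const_mul]

lemma conv_assoc (hφ : IsMeasurableModel μ ν φ) {f g h : G → ℂ} {p : ℝ≥0∞} (hp1 : 1 ≤ p)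
    (hp : p ≠ ∞) (hf : MemLp f 1 μ) (hg : MemLp g 1 μ) (hh : MemLp h p μ) :
    conv μ (conv μ f g) h =ᵐ[μ] conv μ f (conv μ g h) := by
  -- Young's inequality for the absolute values supplies, at almost every `x`, the finiteness needed
  -- to interchange the integrals.
  have hfin : ∀ᵐ x ∂μ, mlconvolution (absConv μ f g) (fun x => ‖h x‖ₑ) μ x < ∞ := by
    have hp0 : p ≠ 0 := (one_pos.trans_le hp1).ne'
    have hP : 0 < p.toReal := ENNReal.toReal_pos hp0 hp
    have hm := aemeasurable_absConv hφ hf.1 hg.1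
    have h1 : eLpNorm (mlconvolution (absConv μ f g) (fun x => ‖h x‖ₑ) μ) p μ < ∞ := by
      refine (eLpNorm_mlconvolution_le hφ hm hh.1.enorm hp1 hp).trans_lt (ENNReal.mul_lt_top ?_ ?_)
      · rw [absConv, lintegral_mlconvolution hφ hf.1.enorm hg.1.enorm,
          ← eLpNorm_one_eq_lintegral_enorm, ← eLpNorm_one_eq_lintegral_enorm]
        exact ENNReal.mul_lt_top hf.2 hg.2
      · exact (eLpNorm_enorm h).trans_lt hh.2
    have h2 := lintegral_rpow_enorm_lt_top_of_eLpNorm_lt_top hp0 hp h1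
    have h3 := ae_lt_top' ((aemeasurable_mlconvolution_of_model hφ hm
      hh.1.enorm).enorm.pow_const p.toReal) h2.ne
    filter_upwards [h3] with x hx
    by_contra! hc
    rw [top_le_iff] at hc
    simp [hc, hP] at hx
  filter_upwards [hfin] with x hx
  have h1 := integral_mul_conv hφ hf.1 hg.1 (h := fun z => h (z⁻¹ * x))
    (hh.1.comp_quasiMeasurePreserving (measurePreserving_inv_mul x).quasiMeasurePreserving) (by
      rw [mlconvolution_def] at hx
      simp only [mul_comm ‖h _‖ₑ]
      exact hx.ne)
  have h2 : conv μ (conv μ f g) h x = ∫ z, h (z⁻¹ * x) * conv μ f g z ∂μ :=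
    integral_congr_ae (ae_of_all _ fun z => mul_comm _ _)
  rw [h2, h1]
  refine integral_congr_ae (ae_of_all _ fun y => ?_)
  simp only [conv]
  rw [← integral_mul_left_eq_self _ y]
  simp [mul_assoc]

lemma lintegral_enorm_mul_absConv_ne_top (hφ : IsMeasurableModel μ ν φ) {f g h : G → ℂ}
    (hf : MemLp f 1 μ) (hg : MemLp g 2 μ) (hh : MemLp h 2 μ) :
    ∫⁻ x, ‖h x‖ₑ * absConv μ f g x ∂μ ≠ ∞ := by
  refine ne_top_of_le_ne_top ?_ (ENNReal.lintegral_mul_le_Lp_mul_Lq μ Real.HolderConjugate.two_two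
    hh.1.enorm (aemeasurable_absConv hφ hf.1 hg.1))
  have h1 : eLpNorm (absConv μ f g) 2 μ < ∞ :=
    (eLpNorm_absConv_le hφ hf.1 hg.1 one_le_two ENNReal.ofNat_ne_top).trans_lt
      (ENNReal.mul_lt_top hf.2 hg.2)
  have h2 := lintegral_rpow_enorm_lt_top_of_eLpNorm_lt_top two_ne_zero ENNReal.ofNat_ne_top h1
  have h3 := lintegral_rpow_enorm_lt_top_of_eLpNorm_lt_top two_ne_zero ENNReal.ofNat_ne_top hh.2
  simp only [ENNReal.toReal_ofNat, enorm_eq_self] at h2 h3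
  exact ENNReal.mul_ne_top (ENNReal.rpow_ne_top_of_nonneg (by norm_num) h3.ne)
    (ENNReal.rpow_ne_top_of_nonneg (by norm_num) h2.ne)

lemma conj_conv {G : Type*} [Group G] [MeasurableSpace G] {μ : Measure G} (f g : G → ℂ) (x : G) :
    conj (conv μ f g x) = conv μ (fun y => conj (f y)) (fun y => conj (g y)) x := by
  rw [conv, ← integral_conj]
  simp [conv]

lemma memLp_conj {α : Type*} [MeasurableSpace α] {μ : Measure α} {f : α → ℂ} {p : ℝ≥0∞}
    (hf : MemLp f p μ) : MemLp (fun x => conj (f x)) p μ := hf.star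

/-- This is the adjoint relation behind `T_{f*} = (T_f)*`. Both sides are expanded by Fubini and
matched by inverting and then translating the variables. -/
lemma integral_conj_conv_mul (hφ : IsMeasurableModel μ ν φ) {f g h : G → ℂ}
    (hf : MemLp f 1 μ) (hg : MemLp g 2 μ) (hh : MemLp h 2 μ) :
    ∫ x, h x * conj (conv μ f g x) ∂μ =
      ∫ x, conv μ (fun y => conj (f y⁻¹)) h x * conj (g x) ∂μ := by
  have hf' := memLp_conj hf
  have hg' := memLp_conj hg
  have hfs : MemLp (fun y => conj (f y⁻¹)) 1 μ :=
    hf'.comp_measurePreserving (Measure.measurePreserving_inv μ)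
  have h1 := integral_mul_conv hφ hf'.1 hg'.1 hh.1
    (lintegral_enorm_mul_absConv_ne_top hφ hf' hg' hh)
  have h2 := integral_mul_conv hφ hfs.1 hh.1 hg'.1
    (lintegral_enorm_mul_absConv_ne_top hφ hfs hh hg')
  simp only [conj_conv]
  rw [h1]
  simp only [mul_comm (conv μ _ h _)]
  rw [h2]
  rw [← integral_inv_eq_self (fun y => conj (f y⁻¹) * ∫ x, h (y⁻¹ * x) * conj (g x) ∂μ) μ]
  refine integral_congr_ae (ae_of_all _ fun y => ?_)
  simp only [inv_inv]
  congr 1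
  rw [← integral_mul_left_eq_self (fun x => h (y * x) * conj (g x)) y⁻¹]
  simp [mul_comm]

lemma conj_conv_inv {G : Type*} [Group G] [MeasurableSpace G] [MeasurableMul G] {μ : Measure G}
    [μ.IsMulLeftInvariant] (f g : G → ℂ) (x : G) :
    conj (conv μ f g x⁻¹) = conv μ (fun y => conj (g y⁻¹)) (fun y => conj (f y⁻¹)) x := by
  rw [conj_conv]
  simp only [conv]
  rw [← integral_mul_left_eq_self (fun y => conj (g y⁻¹) * conj (f (y⁻¹ * x)⁻¹)) x]
  simp [mul_comm]

end Young

/-! ### The weighted Young inequality -/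

section Weighted

variable {G H : Type*} [Group G] [MeasurableSpace G] [MeasurableMul G] [MeasurableInv G]
  [Group H] [MeasurableSpace H] [MeasurableMul₂ H] [MeasurableInv H]
  {μ : Measure G} [μ.IsMulLeftInvariant] [μ.IsMulRightInvariant] [μ.IsInvInvariant]
  {ν : Measure H} [SFinite ν] {φ : G →* H}

/-- Splitting `ω(x)` over `x = y (y⁻¹x)` dominates the weighted convolution by `|f|σ * |g|ω + |f|ω *
|g|σ`; each term is an `L¹`–`L^p` convolution. -/
lemma eLpNorm_conv_mul_weight_le (hφ : IsMeasurableModel μ ν φ) {ω σ : G → ℝ}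
    (hω : AEMeasurable ω μ) (hσ : AEMeasurable σ μ) (hω0 : ∀ x, 0 ≤ ω x) (hσ0 : ∀ x, 0 ≤ σ x)
    (hmul : ∀ x y, ω (x * y) ≤ σ x * ω y + ω x * σ y) {p : ℝ≥0∞} (hp1 : 1 ≤ p) (hp : p ≠ ∞)
    {f g : G → ℂ} (hf : AEStronglyMeasurable f μ) (hg : AEStronglyMeasurable g μ) :
    eLpNorm (fun x => conv μ f g x * (ω x : ℂ)) p μ ≤
      (∫⁻ x, ‖f x‖ₑ * ENNReal.ofReal (σ x) ∂μ) * eLpNorm (fun x => g x * (ω x : ℂ)) p μ +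
      eLpNorm (fun x => f x * (ω x : ℂ)) p μ * ∫⁻ x, ‖g x‖ₑ * ENNReal.ofReal (σ x) ∂μ := by
  set fσ : G → ℝ≥0∞ := fun x => ‖f x‖ₑ * ENNReal.ofReal (σ x) with hfσ
  set gσ : G → ℝ≥0∞ := fun x => ‖g x‖ₑ * ENNReal.ofReal (σ x) with hgσ
  set fω : G → ℝ≥0∞ := fun x => ‖f x‖ₑ * ENNReal.ofReal (ω x) with hfω
  set gω : G → ℝ≥0∞ := fun x => ‖g x‖ₑ * ENNReal.ofReal (ω x) with hgω
  have mfσ : AEMeasurable fσ μ := hf.enorm.mul hσ.ennreal_ofReal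
  have mgσ : AEMeasurable gσ μ := hg.enorm.mul hσ.ennreal_ofReal
  have mfω : AEMeasurable fω μ := hf.enorm.mul hω.ennreal_ofReal
  have mgω : AEMeasurable gω μ := hg.enorm.mul hω.ennreal_ofReal
  have henorm : ∀ (k : G → ℂ) (x : G), ‖k x * (ω x : ℂ)‖ₑ = ‖k x‖ₑ * ENNReal.ofReal (ω x) :=
    fun k x => by
      rw [enorm_mul, ← ofReal_norm (ω x : ℂ), Complex.norm_real, Real.norm_of_nonneg (hω0 x)]
  have hpt : ∀ x, ‖conv μ f g x * (ω x : ℂ)‖ₑ ≤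
      ‖(mlconvolution fσ gω μ + mlconvolution fω gσ μ) x‖ₑ := by
    intro x
    rw [henorm, enorm_eq_self, Pi.add_apply]
    have hgx : AEMeasurable (fun y => gω (y⁻¹ * x)) μ :=
      mgω.comp_quasiMeasurePreserving (measurePreserving_inv_mul x).quasiMeasurePreserving
    calc ‖conv μ f g x‖ₑ * ENNReal.ofReal (ω x) ≤ absConv μ f g x * ENNReal.ofReal (ω x) := by
          gcongr
          exact enorm_conv_le f g x
      _ = ∫⁻ y, ‖f y‖ₑ * ‖g (y⁻¹ * x)‖ₑ * ENNReal.ofReal (ω x) ∂μ := by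
          rw [absConv, mlconvolution_def, lintegral_mul_const' _ _ ENNReal.ofReal_ne_top]
      _ ≤ ∫⁻ y, (fσ y * gω (y⁻¹ * x) + fω y * gσ (y⁻¹ * x)) ∂μ := by
          refine lintegral_mono fun y => ?_
          have h := hmul y (y⁻¹ * x)
          rw [mul_inv_cancel_left] at h
          calc ‖f y‖ₑ * ‖g (y⁻¹ * x)‖ₑ * ENNReal.ofReal (ω x)
              ≤ ‖f y‖ₑ * ‖g (y⁻¹ * x)‖ₑ *
                (ENNReal.ofReal (σ y) * ENNReal.ofReal (ω (y⁻¹ * x)) +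
                ENNReal.ofReal (ω y) * ENNReal.ofReal (σ (y⁻¹ * x))) := by
                gcongr
                rw [← ENNReal.ofReal_mul (hσ0 y), ← ENNReal.ofReal_mul (hω0 y),
                  ← ENNReal.ofReal_add (mul_nonneg (hσ0 _) (hω0 _)) (mul_nonneg (hω0 _) (hσ0 _))]
                exact ENNReal.ofReal_le_ofReal h
            _ = _ := by
                simp only [hfσ, hgσ, hfω, hgω]
                ring
      _ = _ := by
          exact lintegral_add_left' (mfσ.mul hgx) _
  have hF : ∀ k : G → ℂ, eLpNorm (fun x => ‖k x‖ₑ * ENNReal.ofReal (ω x)) p μ =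
      eLpNorm (fun x => k x * (ω x : ℂ)) p μ := fun k => by
    rw [← eLpNorm_enorm (fun x => k x * (ω x : ℂ))]
    simp only [henorm]
  calc eLpNorm (fun x => conv μ f g x * (ω x : ℂ)) p μ
      ≤ eLpNorm (mlconvolution fσ gω μ + mlconvolution fω gσ μ) p μ := eLpNorm_mono_enorm hpt
    _ ≤ eLpNorm (mlconvolution fσ gω μ) p μ + eLpNorm (mlconvolution fω gσ μ) p μ :=
        eLpNorm_add_le (aemeasurable_mlconvolution_of_model hφ mfσ mgω).aestronglyMeasurable
          (aemeasurable_mlconvolution_of_model hφ mfω mgσ).aestronglyMeasurable hp1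
    _ ≤ (∫⁻ x, fσ x ∂μ) * eLpNorm gω p μ + eLpNorm fω p μ * ∫⁻ x, gσ x ∂μ := by
        gcongr
        · exact eLpNorm_mlconvolution_le hφ mfσ mgω hp1 hp
        · exact eLpNorm_mlconvolution_le' hφ mfω mgσ hp1 hp
    _ = _ := by rw [hF, hF]

end Weighted

/-! ### Faithfulness of the action on `L²` -/

section Injective

variable {G H : Type*} [Group G] [TopologicalSpace G] [IsTopologicalGroup G]
  [LocallyCompactSpace G] [T2Space G] [MeasurableSpace G] [BorelSpace G]
  [Group H] [MeasurableSpace H] [MeasurableMul₂ H] [MeasurableInv H]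
  {μ : Measure G} [μ.IsHaarMeasure] [μ.IsMulRightInvariant] [μ.IsInvInvariant]
  {ν : Measure H} [SFinite ν] {φ : G →* H}

/-- Pairing `f * 1_U = 0` with `ψ` gives `∫ f(y) ∫_U ψ(yx) dx dy = 0`. For a small neighbourhood `U`
of 1 the inner integral is uniformly close to `ψ(y) μ(U)`. -/
lemma integral_mul_eq_zero_of_conv_eq_zero (hφ : IsMeasurableModel μ ν φ) {f : G → ℂ}
    (hf : MemLp f 1 μ) (h : ∀ g : G → ℂ, MemLp g 2 μ → conv μ f g =ᵐ[μ] 0) {ψ : G → ℂ}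
    (hψ : Continuous ψ) (hψc : HasCompactSupport ψ) : ∫ x, f x * ψ x ∂μ = 0 := by
  have hψ2 : MemLp ψ 2 μ := hψ.memLp_of_hasCompactSupport hψc
  have hfi : Integrable f μ := memLp_one_iff_integrable.1 hf
  obtain ⟨B, hB⟩ := hψc.exists_bound_of_continuous hψ
  have hfψ : Integrable (fun x => f x * ψ x) μ :=
    hfi.mul_bdd hψ.aestronglyMeasurable (ae_of_all _ hB)
  have key : ∀ ε : ℝ, 0 < ε → ‖∫ x, f x * ψ x ∂μ‖ ≤ ε * ∫ x, ‖f x‖ ∂μ := by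
    intro ε hε
    -- Uniform continuity is stated for left multiplication, so `ψ` is precomposed with inversion:
    -- `(yx)⁻¹ = x⁻¹ y⁻¹` with `x⁻¹ ∈ V`.
    obtain ⟨V, hV, hVψ⟩ := exists_nhds_one_forall_dist_lt (f := fun x => ψ x⁻¹)
      (hψ.comp continuous_inv) (hψc.comp_homeomorph (Homeomorph.inv G)) hε
    have hV' : V⁻¹ ∈ 𝓝 (1 : G) := inv_mem_nhds_one G hV
    obtain ⟨U, hU, hUV, hUc⟩ := local_compact_nhds hV'
    have hU0 : μ U ≠ 0 := (Measure.measure_pos_of_mem_nhds μ hU).ne'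
    have hUf : μ U ≠ ∞ := hUc.measure_lt_top.ne
    have hUm : MeasurableSet U := hUc.isClosed.measurableSet
    have hg : MemLp (U.indicator fun _ => (1 : ℂ)) 2 μ := memLp_indicator_const 2 hUm 1 (Or.inr hUf)
    have h1 := integral_mul_conv hφ hf.1 hg.1 hψ2.1
      (lintegral_enorm_mul_absConv_ne_top hφ hf hg hψ2)
    have h2 : ∫ x, ψ x * conv μ f (U.indicator fun _ => (1 : ℂ)) x ∂μ = 0 := by
      rw [← integral_zero G ℂ (μ := μ)]
      refine integral_congr_ae ?_
      filter_upwards [h _ hg] with x hx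
      simp [hx]
    have h3 : ∀ y, ∫ x, U.indicator (fun _ => (1 : ℂ)) (y⁻¹ * x) * ψ x ∂μ =
        ∫ x in U, ψ (y * x) ∂μ := fun y => by
      rw [← integral_mul_left_eq_self _ y, ← integral_indicator hUm]
      refine integral_congr_ae (ae_of_all _ fun x => ?_)
      by_cases hx : x ∈ U <;> simp [hx]
    rw [h2] at h1
    simp only [h3] at h1
    have h4 : ∀ y, ‖∫ x in U, ψ (y * x) ∂μ - ψ y * (μ.real U : ℂ)‖ ≤ ε * μ.real U := fun y => by
      have hi : IntegrableOn (fun x => ψ (y * x)) U μ :=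
        (hψ.comp (continuous_const_mul y)).continuousOn.integrableOn_compact hUc
      have hc : ψ y * (μ.real U : ℂ) = ∫ _ in U, ψ y ∂μ := by
        rw [setIntegral_const, Complex.real_smul, mul_comm]
      rw [hc, ← integral_sub hi (integrableOn_const hUf)]
      refine norm_setIntegral_le_of_norm_le_const hUc.measure_lt_top fun x hx => ?_
      have h5 := hVψ x⁻¹ (hUV hx) y⁻¹
      rw [dist_comm, dist_eq_norm] at h5
      simpa using h5.le
    have h6 : ‖(∫ x, f x * ψ x ∂μ) * (μ.real U : ℂ)‖ ≤ ∫ x, ‖f x‖ * (ε * μ.real U) ∂μ := by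
      have h7 : (∫ x, f x * ψ x ∂μ) * (μ.real U : ℂ) =
          -∫ y, f y * (∫ x in U, ψ (y * x) ∂μ - ψ y * (μ.real U : ℂ)) ∂μ := by
        -- Measurability in the parameter is obtained by recognising a convolution.
        have hI : AEStronglyMeasurable (fun y => ∫ x in U, ψ (y * x) ∂μ) μ := by
          have h10 : (fun y => ∫ x in U, ψ (y * x) ∂μ) =
              conv μ ψ (fun x => U.indicator (fun _ => (1 : ℂ)) x⁻¹) := by
            ext y
            rw [← h3, conv]
            simp [mul_comm]
          rw [h10]
          exact aestronglyMeasurable_conv hφ hψ2.1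
            (hg.1.comp_quasiMeasurePreserving (Measure.measurePreserving_inv μ).quasiMeasurePreserving)
        have h8 : Integrable (fun y => f y * (∫ x in U, ψ (y * x) ∂μ - ψ y * (μ.real U : ℂ))) μ :=
          hfi.mul_bdd (hI.sub (hψ.aestronglyMeasurable.mul_const _)) (ae_of_all _ h4)
        have h11 : (∫ x, f x * ψ x ∂μ) * (μ.real U : ℂ) +
            ∫ y, f y * (∫ x in U, ψ (y * x) ∂μ - ψ y * (μ.real U : ℂ)) ∂μ = 0 := by
          rw [← integral_mul_const, ← integral_add (hfψ.mul_const _) h8, h1]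
          exact integral_congr_ae (ae_of_all _ fun y => by ring)
        exact eq_neg_of_add_eq_zero_left h11
      rw [h7, norm_neg]
      refine norm_integral_le_of_norm_le (hfi.norm.mul_const _) (ae_of_all _ fun y => ?_)
      rw [norm_mul]
      exact mul_le_mul_of_nonneg_left (h4 y) (norm_nonneg _)
    have hr : 0 < μ.real U := ENNReal.toReal_pos hU0 hUf
    rw [norm_mul, Complex.norm_real, Real.norm_of_nonneg hr.le, integral_mul_const, ← mul_assoc] at h6
    have := le_of_mul_le_mul_right h6 hr
    linarith
  have h9 : ‖∫ x, f x * ψ x ∂μ‖ ≤ 0 := by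
    refine ge_of_tendsto (f := fun ε : ℝ => ε * ∫ x, ‖f x‖ ∂μ) (x := 𝓝[>] 0) ?_
      (eventually_mem_nhdsWithin.mono fun ε hε => key ε hε)
    have : Tendsto (fun ε : ℝ => ε * ∫ x, ‖f x‖ ∂μ) (𝓝 0) (𝓝 (0 * ∫ x, ‖f x‖ ∂μ)) :=
      tendsto_id.mul_const _
    rw [zero_mul] at this
    exact this.mono_left nhdsWithin_le_nhds
  exact norm_le_zero_iff.1 h9

/-- The function is orthogonal to all compactly supported continuous functions, which are dense in
`L²`. -/
lemma ae_eq_zero_of_conv_eq_zero [SigmaCompactSpace G] [μ.Regular]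
    (hφ : IsMeasurableModel μ ν φ) {f : G → ℂ}
    (hf : MemLp f 1 μ) (hf2 : MemLp f 2 μ)
    (h : ∀ g : G → ℂ, MemLp g 2 μ → conv μ f g =ᵐ[μ] 0) : f =ᵐ[μ] 0 := by
  set F : Lp ℂ 2 μ := hf2.toLp f with hF
  have key : ∀ ε : ℝ, 0 < ε → ‖F‖ ^ 2 ≤ ε * ‖F‖ := by
    intro ε hε
    obtain ⟨ψ, hψc, hψe, hψ, hψ2⟩ := hf2.exists_hasCompactSupport_eLpNorm_sub_le
      ENNReal.ofNat_ne_top (ε := ENNReal.ofReal ε) (by simpa using hε)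
    set P : Lp ℂ 2 μ := hψ2.toLp ψ with hP
    have h1 : inner ℂ P F = 0 := by
      rw [L2.inner_def]
      rw [← integral_mul_eq_zero_of_conv_eq_zero hφ hf h (ψ := fun x => conj (ψ x))
        (Complex.continuous_conj.comp hψ) (hψc.comp_left (map_zero _))]
      refine integral_congr_ae ?_
      filter_upwards [hf2.coeFn_toLp, hψ2.coeFn_toLp] with x h1 h2
      rw [hF, hP, h1, h2, RCLike.inner_apply]
    have h2 : ‖F - P‖ ≤ ε := by
      rw [hF, hP, ← MemLp.toLp_sub, Lp.norm_toLp]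
      exact ENNReal.toReal_le_of_le_ofReal hε.le hψe
    calc ‖F‖ ^ 2 = RCLike.re (inner ℂ (F - P) F) := by
          rw [inner_sub_left, h1, sub_zero, inner_self_eq_norm_sq]
      _ ≤ ‖F - P‖ * ‖F‖ := re_inner_le_norm _ _
      _ ≤ ε * ‖F‖ := by gcongr
  have h0 : ‖F‖ = 0 := by
    by_contra hne
    have hpos : 0 < ‖F‖ := lt_of_le_of_ne (norm_nonneg _) (Ne.symm hne)
    have := key (‖F‖ / 2) (by positivity)
    nlinarith
  have h3 : F = 0 := norm_eq_zero.1 h0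
  filter_upwards [hf2.coeFn_toLp, Lp.coeFn_zero ℂ 2 μ] with x h1 h2
  rw [← h1, ← hF, h3, h2]

end Injective

/-! ### The weighted space and its completeness -/

lemma exists_tendsto_of_isClosed_range {V E : Type*} [AddCommGroup V] [Module ℂ V]
    [NormedAddCommGroup E] [NormedSpace ℂ E] [CompleteSpace E] {J : V →ₗ[ℂ] E}
    (hJ : IsClosed (Set.range J)) {N : V → ℝ} (hN : ∀ v, N v = ‖J v‖) (a : ℕ → V)
    (ha : ∀ ε : ℝ, 0 < ε → ∃ K : ℕ, ∀ m n : ℕ, K ≤ m → K ≤ n → N (a m - a n) < ε) :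
    ∃ b : V, Tendsto (fun n => N (a n - b)) atTop (𝓝 0) := by
  simp only [hN, map_sub] at ha ⊢
  have hc : CauchySeq fun n => J (a n) := by
    refine Metric.cauchySeq_iff.2 fun ε hε => ?_
    obtain ⟨K, hK⟩ := ha ε hε
    refine ⟨K, fun m hm n hn => ?_⟩
    rw [dist_eq_norm]
    exact hK m n hm hn
  obtain ⟨P, hP⟩ := cauchySeq_tendsto_of_complete hc
  obtain ⟨b, rfl⟩ := hJ.mem_of_tendsto hP (Eventually.of_forall fun n => Set.mem_range_self (a n))
  exact ⟨b, tendsto_iff_norm_sub_tendsto_zero.1 hP⟩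

section Space

variable {G : Type*} [MeasurableSpace G] {μ : Measure G} {ω : G → ℝ} {p : ℝ≥0∞}

lemma memLp_two_coe (f : weightedLpInterL2 μ ω p) : MemLp f.1 2 μ := Lp.mem_Lp_iff_memLp.1 f.2.2

lemma memLp_coe_mul_weight (f : weightedLpInterL2 μ ω p) :
    MemLp (fun x => f.1 x * (ω x : ℂ)) p μ := f.2.1

lemma weightedLpInterL2_ext {f g : weightedLpInterL2 μ ω p} (h : f.1 =ᵐ[μ] g.1) : f = g :=
  Subtype.ext (AEEqFun.ext h)

lemma weightedLpInterL2_coeFn_add (f g : weightedLpInterL2 μ ω p) :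
    (f + g).1 =ᵐ[μ] (f.1 : G → ℂ) + (g.1 : G → ℂ) := AEEqFun.coeFn_add f.1 g.1

lemma weightedLpInterL2_coeFn_smul (c : ℂ) (f : weightedLpInterL2 μ ω p) :
    (c • f).1 =ᵐ[μ] c • (f.1 : G → ℂ) := AEEqFun.coeFn_smul c f.1

lemma exists_weightedLpInterL2 {f : G → ℂ} (h1 : MemLp (fun x => f x * (ω x : ℂ)) p μ)
    (h2 : MemLp f 2 μ) : ∃ F : weightedLpInterL2 μ ω p, F.1 =ᵐ[μ] f := by
  have h3 := AEEqFun.coeFn_mk f h2.1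
  refine ⟨⟨AEEqFun.mk f h2.1, ?_, ?_⟩, h3⟩
  · refine (memLp_congr_ae ?_).mpr h1
    filter_upwards [h3] with x hx
    rw [hx]
  · exact Lp.mem_Lp_iff_memLp.2 ((memLp_congr_ae h3).mpr h2)

/-- The map `f ↦ (f ω, f)` of `L^p(G, ω) ∩ L^2(G)` into `L^p(G) × L^2(G)`. -/
noncomputable def interEmbedding (μ : Measure G) (ω : G → ℝ) (p : ℝ≥0∞) :
    weightedLpInterL2 μ ω p →ₗ[ℂ] Lp ℂ p μ × Lp ℂ 2 μ where
  toFun f := ((memLp_coe_mul_weight f).toLp _, (memLp_two_coe f).toLp _)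
  map_add' f g := by
    refine Prod.ext ?_ ?_
    · change _ = (memLp_coe_mul_weight f).toLp _ + (memLp_coe_mul_weight g).toLp _
      rw [← MemLp.toLp_add, MemLp.toLp_eq_toLp_iff]
      filter_upwards [weightedLpInterL2_coeFn_add f g] with x hx
      change (f + g).1 x * (ω x : ℂ) = f.1 x * (ω x : ℂ) + g.1 x * (ω x : ℂ)
      rw [hx, Pi.add_apply, add_mul]
    · change _ = (memLp_two_coe f).toLp _ + (memLp_two_coe g).toLp _
      rw [← MemLp.toLp_add, MemLp.toLp_eq_toLp_iff]
      exact weightedLpInterL2_coeFn_add f g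
  map_smul' c f := by
    refine Prod.ext ?_ ?_
    · change _ = c • (memLp_coe_mul_weight f).toLp _
      rw [← MemLp.toLp_const_smul, MemLp.toLp_eq_toLp_iff]
      filter_upwards [weightedLpInterL2_coeFn_smul c f] with x hx
      change (c • f).1 x * (ω x : ℂ) = c * (f.1 x * (ω x : ℂ))
      rw [hx, Pi.smul_apply, smul_eq_mul, mul_assoc]
    · change _ = c • (memLp_two_coe f).toLp _
      rw [← MemLp.toLp_const_smul, MemLp.toLp_eq_toLp_iff]
      exact weightedLpInterL2_coeFn_smul c f

lemma coeFn_interEmbedding_fst (f : weightedLpInterL2 μ ω p) :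
    (interEmbedding μ ω p f).1 =ᵐ[μ] fun x => f.1 x * (ω x : ℂ) :=
  (memLp_coe_mul_weight f).coeFn_toLp

lemma coeFn_interEmbedding_snd (f : weightedLpInterL2 μ ω p) :
    (interEmbedding μ ω p f).2 =ᵐ[μ] f.1 := (memLp_two_coe f).coeFn_toLp

lemma interNorm_eq [Fact (1 ≤ p)] (f : weightedLpInterL2 μ ω p) :
    interNorm μ ω p f = ‖interEmbedding μ ω p f‖ := by
  rw [Prod.norm_def]
  change _ = max ‖(memLp_coe_mul_weight f).toLp _‖ ‖(memLp_two_coe f).toLp _‖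
  rw [Lp.norm_toLp, Lp.norm_toLp]
  rfl

lemma interEmbedding_injective : Function.Injective (interEmbedding μ ω p) := fun f g h => by
  refine weightedLpInterL2_ext ?_
  filter_upwards [coeFn_interEmbedding_snd f, coeFn_interEmbedding_snd g] with x h1 h2
  rw [← h1, ← h2, h]

/-- The two components of a limit are related by multiplication by `ω`: almost everywhere
convergence along a common subsequence identifies them. -/
lemma isClosed_range_interEmbedding [Fact (1 ≤ p)] :
    IsClosed (Set.range (interEmbedding μ ω p)) := by
  refine isClosed_of_closure_subset fun P hP => ?_
  obtain ⟨v, hv, hvP⟩ := mem_closure_iff_seq_limit.1 hP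
  choose a ha using hv
  have hp0 : p ≠ 0 := (one_pos.trans_le (Fact.out : 1 ≤ p)).ne'
  have h1 : Tendsto (fun n => (v n).1) atTop (𝓝 P.1) := (continuous_fst.tendsto P).comp hvP
  have h2 : Tendsto (fun n => (v n).2) atTop (𝓝 P.2) := (continuous_snd.tendsto P).comp hvP
  obtain ⟨i, hi, hia⟩ := (tendstoInMeasure_of_tendsto_Lp h2).exists_seq_tendsto_ae
  obtain ⟨j, hj, hja⟩ := (tendstoInMeasure_of_tendsto_Lp
    (h1.comp hi.tendsto_atTop)).exists_seq_tendsto_ae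
  have hv1 : ∀ᵐ x ∂μ, ∀ n, (v n).1 x = (a n).1 x * (ω x : ℂ) := ae_all_iff.2 fun n => by
    rw [← ha n]
    exact coeFn_interEmbedding_fst (a n)
  have hv2 : ∀ᵐ x ∂μ, ∀ n, (v n).2 x = (a n).1 x := ae_all_iff.2 fun n => by
    rw [← ha n]
    exact coeFn_interEmbedding_snd (a n)
  have hP12 : P.1 =ᵐ[μ] fun x => P.2 x * (ω x : ℂ) := by
    filter_upwards [hia, hja, hv1, hv2] with x hx1 hx2 hx3 hx4
    refine tendsto_nhds_unique hx2 ?_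
    have h5 := ((hx1.comp hj.tendsto_atTop).mul_const (ω x : ℂ))
    refine h5.congr fun n => ?_
    simp only [Function.comp_apply, hx3, hx4]
  obtain ⟨F, hF⟩ := exists_weightedLpInterL2 (ω := ω) (p := p)
    ((memLp_congr_ae hP12).1 (Lp.memLp P.1)) (Lp.memLp P.2)
  refine ⟨F, Prod.ext (Lp.ext ?_) (Lp.ext ?_)⟩
  · filter_upwards [coeFn_interEmbedding_fst F, hF, hP12] with x hx1 hx2 hx3
    rw [hx1, hx2, hx3]
  · filter_upwards [coeFn_interEmbedding_snd F, hF] with x hx1 hx2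
    rw [hx1, hx2]

end Space

lemma rpow_mul_rpow_sub_le {a b θ : ℝ} (ha : 0 ≤ a) (hab : a ≤ b) (hθ : 0 ≤ θ) :
    a ^ θ * b ^ (1 - θ) ≤ b := by
  rcases eq_or_lt_of_le (ha.trans hab) with hb | hb
  · have ha0 : a = 0 := le_antisymm (hab.trans hb.ge) ha
    subst hb
    rcases eq_or_lt_of_le hθ with h | h
    · simp [← h]
    · simp [ha0, Real.zero_rpow h.ne']
  · calc a ^ θ * b ^ (1 - θ) ≤ b ^ θ * b ^ (1 - θ) := by gcongr
      _ = b := by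
        rw [← Real.rpow_add hb]
        simp

lemma eLpNorm_conj {α : Type*} [MeasurableSpace α] {μ : Measure α} (f : α → ℂ) (p : ℝ≥0∞) :
    eLpNorm (fun x => conj (f x)) p μ = eLpNorm f p μ :=
  eLpNorm_congr_norm_ae (ae_of_all _ fun x => by simp)

section Norms

variable {G : Type*} [MeasurableSpace G] {μ : Measure G} {ω σ : G → ℝ} {p : ℝ≥0∞}

/-- The norm in `L^p(G, ω)`. -/
noncomputable def weightedNorm (f : weightedLpInterL2 μ ω p) : ℝ :=
  (eLpNorm (fun x => f.1 x * (ω x : ℂ)) p μ).toReal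

/-- The norm in `L^2(G)`. -/
noncomputable def twoNorm (f : weightedLpInterL2 μ ω p) : ℝ := (eLpNorm f.1 2 μ).toReal

/-- The norm in `L^1(G, σ)`. -/
noncomputable def majorantNorm (σ : G → ℝ) (f : weightedLpInterL2 μ ω p) : ℝ :=
  (∫⁻ x, ‖f.1 x‖ₑ * ENNReal.ofReal (σ x) ∂μ).toReal

lemma weightedNorm_nonneg (f : weightedLpInterL2 μ ω p) : 0 ≤ weightedNorm f :=
  ENNReal.toReal_nonneg

lemma twoNorm_nonneg (f : weightedLpInterL2 μ ω p) : 0 ≤ twoNorm f := ENNReal.toReal_nonneg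

lemma majorantNorm_nonneg (f : weightedLpInterL2 μ ω p) : 0 ≤ majorantNorm σ f :=
  ENNReal.toReal_nonneg

lemma weightedNorm_le_interNorm (f : weightedLpInterL2 μ ω p) :
    weightedNorm f ≤ interNorm μ ω p f := le_max_left _ _

lemma twoNorm_le_interNorm (f : weightedLpInterL2 μ ω p) : twoNorm f ≤ interNorm μ ω p f :=
  le_max_right _ _

lemma interNorm_nonneg (f : weightedLpInterL2 μ ω p) : 0 ≤ interNorm μ ω p f :=
  (twoNorm_nonneg f).trans (twoNorm_le_interNorm f)

end Norms

/-! ### Norm estimates from the majorant -/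

section Majorant

variable {G : Type*} [Group G] [MeasurableSpace G] {μ : Measure G} {ω σ : G → ℝ} {p : ℝ≥0∞}
  {θ c : ℝ} {K : ℝ≥0∞}

lemma IsMajorant.nonneg (hM : IsMajorant μ ω σ p θ c K) (x : G) : 0 ≤ σ x :=
  hM.pos.le.trans (hM.le x)

lemma IsMajorant.lintegral_ne_top (hM : IsMajorant μ ω σ p θ c K) (f : weightedLpInterL2 μ ω p) :
    ∫⁻ x, ‖f.1 x‖ₑ * ENNReal.ofReal (σ x) ∂μ ≠ ∞ :=
  ne_top_of_le_ne_top (ENNReal.mul_ne_top (ENNReal.mul_ne_top hM.ne_top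
    (ENNReal.rpow_ne_top_of_nonneg hM.theta_pos.le (memLp_two_coe f).2.ne))
    (ENNReal.rpow_ne_top_of_nonneg (sub_nonneg.2 hM.theta_lt_one.le)
      (memLp_coe_mul_weight f).2.ne)) (hM.lintegral_le f.1 (memLp_two_coe f).1)

lemma IsMajorant.mul_eLpNorm_one_le (hM : IsMajorant μ ω σ p θ c K) (f : G → ℂ) :
    ENNReal.ofReal c * eLpNorm f 1 μ ≤ ∫⁻ x, ‖f x‖ₑ * ENNReal.ofReal (σ x) ∂μ := by
  rw [eLpNorm_one_eq_lintegral_enorm, ← lintegral_const_mul' _ _ ENNReal.ofReal_ne_top]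
  refine lintegral_mono fun x => ?_
  rw [mul_comm]
  exact mul_le_mul_right (ENNReal.ofReal_le_ofReal (hM.le x)) _

lemma IsMajorant.memLp_one (hM : IsMajorant μ ω σ p θ c K) (f : weightedLpInterL2 μ ω p) :
    MemLp f.1 1 μ := by
  refine ⟨(memLp_two_coe f).1, lt_top_iff_ne_top.2 fun h => ?_⟩
  have h1 := hM.mul_eLpNorm_one_le f.1
  rw [h, ENNReal.mul_top (by simpa using hM.pos), top_le_iff] at h1
  exact hM.lintegral_ne_top f h1

lemma IsMajorant.majorantNorm_le (hM : IsMajorant μ ω σ p θ c K) (f : weightedLpInterL2 μ ω p) :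
    majorantNorm σ f ≤ K.toReal * twoNorm f ^ θ * weightedNorm f ^ (1 - θ) := by
  rw [majorantNorm, twoNorm, weightedNorm, ENNReal.toReal_rpow, ENNReal.toReal_rpow,
    ← ENNReal.toReal_mul, ← ENNReal.toReal_mul]
  exact ENNReal.toReal_mono (ENNReal.mul_ne_top (ENNReal.mul_ne_top hM.ne_top
    (ENNReal.rpow_ne_top_of_nonneg hM.theta_pos.le (memLp_two_coe f).2.ne))
    (ENNReal.rpow_ne_top_of_nonneg (sub_nonneg.2 hM.theta_lt_one.le)
      (memLp_coe_mul_weight f).2.ne)) (hM.lintegral_le f.1 (memLp_two_coe f).1)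

lemma IsMajorant.majorantNorm_le_rpow_mul_rpow (hM : IsMajorant μ ω σ p θ c K)
    (f : weightedLpInterL2 μ ω p) :
    majorantNorm σ f ≤ K.toReal * (twoNorm f ^ θ * interNorm μ ω p f ^ (1 - θ)) := by
  rw [← mul_assoc]
  refine (hM.majorantNorm_le f).trans ?_
  have h1 := Real.rpow_le_rpow (weightedNorm_nonneg f) (weightedNorm_le_interNorm f)
    (sub_nonneg.2 hM.theta_lt_one.le)
  have h2 := Real.rpow_nonneg (twoNorm_nonneg f) θ
  have h3 : 0 ≤ K.toReal := ENNReal.toReal_nonneg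
  gcongr

lemma IsMajorant.majorantNorm_le_interNorm (hM : IsMajorant μ ω σ p θ c K)
    (f : weightedLpInterL2 μ ω p) : majorantNorm σ f ≤ K.toReal * interNorm μ ω p f :=
  (hM.majorantNorm_le_rpow_mul_rpow f).trans (mul_le_mul_of_nonneg_left
    (rpow_mul_rpow_sub_le (twoNorm_nonneg f) (twoNorm_le_interNorm f) hM.theta_pos.le)
    ENNReal.toReal_nonneg)

lemma IsMajorant.oneNorm_le (hM : IsMajorant μ ω σ p θ c K) (f : weightedLpInterL2 μ ω p) :
    (eLpNorm f.1 1 μ).toReal ≤ c⁻¹ * majorantNorm σ f := by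
  have h := ENNReal.toReal_mono (hM.lintegral_ne_top f) (hM.mul_eLpNorm_one_le f.1)
  rw [ENNReal.toReal_mul, ENNReal.toReal_ofReal hM.pos.le] at h
  rw [inv_mul_eq_div, le_div_iff₀ hM.pos, mul_comm]
  exact h

end Majorant

section Star

variable {G : Type*} [Group G] [MeasurableSpace G] [MeasurableInv G] {μ : Measure G}
  [μ.IsInvInvariant] {ω : G → ℝ} {p : ℝ≥0∞}

lemma memLp_conj_inv_mul_weight (hω : IsWeight μ ω) (f : weightedLpInterL2 μ ω p) :
    MemLp (fun x => conj (f.1 x⁻¹) * (ω x : ℂ)) p μ := by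
  have h := (memLp_conj (memLp_coe_mul_weight f)).comp_measurePreserving
    (Measure.measurePreserving_inv μ)
  refine (memLp_congr_ae (ae_of_all _ fun x => ?_)).1 h
  simp [hω.map_inv]

lemma memLp_conj_inv (f : weightedLpInterL2 μ ω p) : MemLp (fun x => conj (f.1 x⁻¹)) 2 μ :=
  (memLp_conj (memLp_two_coe f)).comp_measurePreserving (Measure.measurePreserving_inv μ)

lemma interNorm_star (hω : IsWeight μ ω) {f h : weightedLpInterL2 μ ω p}
    (hh : h.1 =ᵐ[μ] fun x => conj (f.1 x⁻¹)) : interNorm μ ω p h = interNorm μ ω p f := by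
  have h1 : eLpNorm (fun x => h.1 x * (ω x : ℂ)) p μ =
      eLpNorm (fun x => f.1 x * (ω x : ℂ)) p μ := by
    rw [← eLpNorm_conj (fun x => f.1 x * (ω x : ℂ)), ← eLpNorm_comp_measurePreserving
      (memLp_conj (memLp_coe_mul_weight f)).1 (Measure.measurePreserving_inv μ)]
    refine eLpNorm_congr_ae (hh.mono fun x hx => ?_)
    simp [hx, hω.map_inv]
  have h2 : eLpNorm h.1 2 μ = eLpNorm f.1 2 μ := by
    rw [← eLpNorm_conj f.1, ← eLpNorm_comp_measurePreserving
      (memLp_conj (memLp_two_coe f)).1 (Measure.measurePreserving_inv μ)]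
    exact eLpNorm_congr_ae hh
  rw [interNorm, interNorm, h1, h2]

end Star

section Algebra

variable {G H : Type*} [Group G] [MeasurableSpace G] [MeasurableMul G] [MeasurableInv G]
  [Group H] [MeasurableSpace H] [MeasurableMul₂ H] [MeasurableInv H]
  {μ : Measure G} [μ.IsMulLeftInvariant] [μ.IsMulRightInvariant] [μ.IsInvInvariant]
  {ν : Measure H} [SFinite ν] {φ : G →* H} {ω σ : G → ℝ} {p : ℝ≥0∞} {θ c : ℝ} {K : ℝ≥0∞}

/-- Convolution by an integrable function, as an operator on `L^2(G)`. -/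
noncomputable def convOp (hφ : IsMeasurableModel μ ν φ) {f : G → ℂ} (hf : MemLp f 1 μ) :
    Lp ℂ 2 μ →L[ℂ] Lp ℂ 2 μ :=
  LinearMap.mkContinuous
    { toFun := fun g => (memLp_conv hφ one_le_two ENNReal.ofNat_ne_top hf (Lp.memLp g)).toLp _
      map_add' := fun g h => by
        rw [← MemLp.toLp_add, MemLp.toLp_eq_toLp_iff, conv_congr_ae EventuallyEq.rfl
          (Lp.coeFn_add g h)]
        exact conv_add_right hφ one_le_two ENNReal.ofNat_ne_top hf (Lp.memLp g) (Lp.memLp h)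
      map_smul' := fun c g => by
        rw [← MemLp.toLp_const_smul, MemLp.toLp_eq_toLp_iff, conv_congr_ae EventuallyEq.rfl
          (Lp.coeFn_smul c g), conv_smul_right]
        rfl }
    (eLpNorm f 1 μ).toReal fun g => by
      change ‖(memLp_conv hφ one_le_two ENNReal.ofNat_ne_top hf (Lp.memLp g)).toLp _‖ ≤ _
      rw [Lp.norm_toLp, Lp.norm_def, ← ENNReal.toReal_mul]
      exact ENNReal.toReal_mono (ENNReal.mul_ne_top hf.2.ne (Lp.memLp g).2.ne)
        (eLpNorm_conv_le hφ hf.1 (Lp.memLp g).1 one_le_two ENNReal.ofNat_ne_top)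

lemma coeFn_convOp (hφ : IsMeasurableModel μ ν φ) {f : G → ℂ} (hf : MemLp f 1 μ) (g : Lp ℂ 2 μ) :
    convOp hφ hf g =ᵐ[μ] conv μ f g :=
  (memLp_conv hφ one_le_two ENNReal.ofNat_ne_top hf (Lp.memLp g)).coeFn_toLp

lemma IsMajorant.memLp_conv_mul_weight (hM : IsMajorant μ ω σ p θ c K)
    (hφ : IsMeasurableModel μ ν φ) (hω : IsWeight μ ω) (hp1 : 1 ≤ p) (hp : p ≠ ∞)
    (f g : weightedLpInterL2 μ ω p) : MemLp (fun x => conv μ f.1 g.1 x * (ω x : ℂ)) p μ := by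
  refine ⟨(aestronglyMeasurable_conv hφ (memLp_two_coe f).1 (memLp_two_coe g).1).mul
    (Complex.measurable_ofReal.comp_aemeasurable hω.aemeasurable).aestronglyMeasurable, ?_⟩
  refine (eLpNorm_conv_mul_weight_le hφ hω.aemeasurable hM.aemeasurable hω.nonneg hM.nonneg
    hM.mul_le hp1 hp (memLp_two_coe f).1 (memLp_two_coe g).1).trans_lt ?_
  exact ENNReal.add_lt_top.2 ⟨ENNReal.mul_lt_top (hM.lintegral_ne_top f).lt_top
    (memLp_coe_mul_weight g).2, ENNReal.mul_lt_top (memLp_coe_mul_weight f).2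
    (hM.lintegral_ne_top g).lt_top⟩

lemma IsMajorant.weightedNorm_mul_le (hM : IsMajorant μ ω σ p θ c K)
    (hφ : IsMeasurableModel μ ν φ) (hω : IsWeight μ ω) (hp1 : 1 ≤ p) (hp : p ≠ ∞)
    {f g h : weightedLpInterL2 μ ω p} (hh : h.1 =ᵐ[μ] conv μ f.1 g.1) :
    weightedNorm h ≤ majorantNorm σ f * weightedNorm g + weightedNorm f * majorantNorm σ g := by
  have h1 : eLpNorm (fun x => h.1 x * (ω x : ℂ)) p μ =
      eLpNorm (fun x => conv μ f.1 g.1 x * (ω x : ℂ)) p μ :=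
    eLpNorm_congr_ae (hh.mono fun x hx => by simp only [hx])
  have e1 := ENNReal.mul_ne_top (hM.lintegral_ne_top f) (memLp_coe_mul_weight g).2.ne
  have e2 := ENNReal.mul_ne_top (memLp_coe_mul_weight f).2.ne (hM.lintegral_ne_top g)
  rw [weightedNorm, h1, majorantNorm, majorantNorm, weightedNorm, weightedNorm,
    ← ENNReal.toReal_mul, ← ENNReal.toReal_mul, ← ENNReal.toReal_add e1 e2]
  exact ENNReal.toReal_mono (ENNReal.add_ne_top.2 ⟨e1, e2⟩)
    (eLpNorm_conv_mul_weight_le hφ hω.aemeasurable hM.aemeasurable hω.nonneg hM.nonneg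
      hM.mul_le hp1 hp (memLp_two_coe f).1 (memLp_two_coe g).1)

lemma IsMajorant.twoNorm_mul_le (hM : IsMajorant μ ω σ p θ c K)
    (hφ : IsMeasurableModel μ ν φ) {f g h : weightedLpInterL2 μ ω p}
    (hh : h.1 =ᵐ[μ] conv μ f.1 g.1) :
    twoNorm h ≤ c⁻¹ * majorantNorm σ f * twoNorm g := by
  have h1 : twoNorm h ≤ (eLpNorm f.1 1 μ).toReal * twoNorm g := by
    rw [twoNorm, twoNorm, eLpNorm_congr_ae hh, ← ENNReal.toReal_mul]
    exact ENNReal.toReal_mono (ENNReal.mul_ne_top (hM.memLp_one f).2.ne (memLp_two_coe g).2.ne)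
      (eLpNorm_conv_le hφ (memLp_two_coe f).1 (memLp_two_coe g).1 one_le_two ENNReal.ofNat_ne_top)
  exact h1.trans (mul_le_mul_of_nonneg_right (hM.oneNorm_le f) (twoNorm_nonneg g))

lemma IsMajorant.interNorm_mul_le (hM : IsMajorant μ ω σ p θ c K)
    (hφ : IsMeasurableModel μ ν φ) (hω : IsWeight μ ω) (hp1 : 1 ≤ p) (hp : p ≠ ∞)
    {f g h : weightedLpInterL2 μ ω p} (hh : h.1 =ᵐ[μ] conv μ f.1 g.1) :
    interNorm μ ω p h ≤
      (2 * K.toReal + c⁻¹ * K.toReal) * interNorm μ ω p f * interNorm μ ω p g := by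
  have hK : 0 ≤ K.toReal := ENNReal.toReal_nonneg
  have hc : 0 ≤ c⁻¹ := inv_nonneg.2 hM.pos.le
  have hf := interNorm_nonneg f
  have hg := interNorm_nonneg g
  have h1 := hM.majorantNorm_le_interNorm f
  have h2 := hM.majorantNorm_le_interNorm g
  have h3 := weightedNorm_le_interNorm f
  have h4 := weightedNorm_le_interNorm g
  have h5 := twoNorm_le_interNorm g
  have h0 : 0 ≤ interNorm μ ω p f * interNorm μ ω p g := mul_nonneg hf hg
  refine max_le ?_ ?_
  · refine (hM.weightedNorm_mul_le hφ hω hp1 hp hh).trans ?_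
    calc _ ≤ K.toReal * interNorm μ ω p f * interNorm μ ω p g +
          interNorm μ ω p f * (K.toReal * interNorm μ ω p g) :=
          add_le_add (mul_le_mul h1 h4 (weightedNorm_nonneg g) (by positivity))
            (mul_le_mul h3 h2 (majorantNorm_nonneg g) hf)
      _ ≤ _ := by nlinarith [mul_nonneg (mul_nonneg hc hK) h0]
  · refine (hM.twoNorm_mul_le hφ hh).trans ?_
    calc _ ≤ c⁻¹ * (K.toReal * interNorm μ ω p f) * interNorm μ ω p g :=
          mul_le_mul (mul_le_mul_of_nonneg_left h1 hc) h5 (twoNorm_nonneg g) (by positivity)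
      _ ≤ _ := by nlinarith [mul_nonneg hK h0]

/-- Each term in the bounds for the two norms of `f * f` contains one factor `‖fσ‖₁`. Interpolating
that factor brings in `‖f‖₂^θ`. -/
lemma IsMajorant.interNorm_sq_le (hM : IsMajorant μ ω σ p θ c K)
    (hφ : IsMeasurableModel μ ν φ) (hω : IsWeight μ ω) (hp1 : 1 ≤ p) (hp : p ≠ ∞)
    {f h : weightedLpInterL2 μ ω p} (hh : h.1 =ᵐ[μ] conv μ f.1 f.1) :
    interNorm μ ω p h ≤
      (2 * K.toReal + c⁻¹ * K.toReal) * twoNorm f ^ θ * interNorm μ ω p f ^ (2 - θ) := by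
  have hK : 0 ≤ K.toReal := ENNReal.toReal_nonneg
  have hc : 0 ≤ c⁻¹ := inv_nonneg.2 hM.pos.le
  have hf := interNorm_nonneg f
  have hE : interNorm μ ω p f ^ (2 - θ) = interNorm μ ω p f ^ (1 - θ) * interNorm μ ω p f := by
    rw [show 2 - θ = 1 - θ + 1 by ring, Real.rpow_add_one' hf]
    have := hM.theta_lt_one
    linarith
  set B := twoNorm f ^ θ * interNorm μ ω p f ^ (1 - θ) with hB
  have hB0 : 0 ≤ B := mul_nonneg (Real.rpow_nonneg (twoNorm_nonneg f) _) (Real.rpow_nonneg hf _)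
  have h1 : majorantNorm σ f ≤ K.toReal * B := hM.majorantNorm_le_rpow_mul_rpow f
  have h3 := weightedNorm_le_interNorm f
  have h5 := twoNorm_le_interNorm f
  have h0 : 0 ≤ B * interNorm μ ω p f := mul_nonneg hB0 hf
  rw [hE, show (2 * K.toReal + c⁻¹ * K.toReal) * twoNorm f ^ θ *
    (interNorm μ ω p f ^ (1 - θ) * interNorm μ ω p f) =
    (2 * K.toReal + c⁻¹ * K.toReal) * (B * interNorm μ ω p f) by rw [hB]; ring]
  refine max_le ?_ ?_
  · refine (hM.weightedNorm_mul_le hφ hω hp1 hp hh).trans ?_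
    calc _ ≤ K.toReal * B * interNorm μ ω p f + interNorm μ ω p f * (K.toReal * B) :=
          add_le_add (mul_le_mul h1 h3 (weightedNorm_nonneg f) (by positivity))
            (mul_le_mul h3 h1 (majorantNorm_nonneg f) hf)
      _ ≤ _ := by nlinarith [mul_nonneg (mul_nonneg hc hK) h0]
  · refine (hM.twoNorm_mul_le hφ hh).trans ?_
    calc _ ≤ c⁻¹ * (K.toReal * B) * interNorm μ ω p f :=
          mul_le_mul (mul_le_mul_of_nonneg_left h1 hc) h5 (twoNorm_nonneg f) (by positivity)
      _ ≤ _ := by nlinarith [mul_nonneg hK h0]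

end Algebra

/-! ### Verification of the algebra and embedding axioms -/

section Structure

variable {G H : Type*} [Group G] [MeasurableSpace G] [MeasurableMul G] [MeasurableInv G]
  [Group H] [MeasurableSpace H] [MeasurableMul₂ H] [MeasurableInv H]
  {μ : Measure G} [μ.IsMulRightInvariant] [μ.IsInvInvariant]
  {ν : Measure H} [SFinite ν] {φ : G →* H} {ω σ : G → ℝ} {p : ℝ≥0∞} {θ c : ℝ} {K : ℝ≥0∞}
  {mul : weightedLpInterL2 μ ω p → weightedLpInterL2 μ ω p → weightedLpInterL2 μ ω p}
  {star : weightedLpInterL2 μ ω p → weightedLpInterL2 μ ω p}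
  {T : weightedLpInterL2 μ ω p → (Lp ℂ 2 μ →L[ℂ] Lp ℂ 2 μ)}

lemma isBanachStarAlgebra_of_ae_eq_conv [μ.IsMulLeftInvariant]
    (hM : IsMajorant μ ω σ p θ c K)
    (hφ : IsMeasurableModel μ ν φ) (hω : IsWeight μ ω) (hp1 : 1 ≤ p) (hp : p ≠ ∞)
    (hmul : ∀ f g, (mul f g).1 =ᵐ[μ] conv μ f.1 g.1)
    (hstar : ∀ f, (star f).1 =ᵐ[μ] fun x => conj (f.1 x⁻¹)) :
    IsBanachStarAlgebra (interNorm μ ω p) mul star := by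
  have : Fact (1 ≤ p) := ⟨hp1⟩
  have m1 := fun f : weightedLpInterL2 μ ω p => hM.memLp_one f
  have hinv := (Measure.measurePreserving_inv μ).quasiMeasurePreserving
  have hss : ∀ f, (fun x => conj ((star f).1 x⁻¹)) =ᵐ[μ] f.1 := fun f => by
    filter_upwards [hinv.ae (hstar f)] with x hx
    rw [hx, inv_inv, Complex.conj_conj]
  refine
    { norm_nonneg := interNorm_nonneg
      norm_eq_zero := fun a => by
        rw [interNorm_eq, norm_eq_zero, map_eq_zero_iff _ interEmbedding_injective]
      norm_add_le := fun a b => by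
        simp only [interNorm_eq, map_add]
        exact norm_add_le _ _
      norm_smul := fun z a => by
        simp only [interNorm_eq, map_smul]
        exact norm_smul _ _
      complete := exists_tendsto_of_isClosed_range isClosed_range_interEmbedding interNorm_eq
      add_mul := fun a b d => weightedLpInterL2_ext ?_
      mul_add := fun a b d => weightedLpInterL2_ext ?_
      smul_mul := fun z a b => weightedLpInterL2_ext ?_
      mul_smul := fun z a b => weightedLpInterL2_ext ?_
      mul_assoc := fun a b d => weightedLpInterL2_ext ?_
      norm_mul_le := ⟨_, fun a b => hM.interNorm_mul_le hφ hω hp1 hp (hmul a b)⟩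
      star_star := fun a => weightedLpInterL2_ext ((hstar (star a)).trans (hss a))
      star_add := fun a b => weightedLpInterL2_ext ?_
      star_smul := fun z a => weightedLpInterL2_ext ?_
      star_mul := fun a b => weightedLpInterL2_ext ?_
      norm_star := fun a => interNorm_star hω (hstar a) }
  · refine (hmul _ _).trans ?_
    rw [conv_congr_ae (weightedLpInterL2_coeFn_add a b) EventuallyEq.rfl]
    filter_upwards [conv_add_left hφ le_rfl ENNReal.one_ne_top (m1 a) (m1 b) (m1 d), hmul a d,
      hmul b d, weightedLpInterL2_coeFn_add (mul a d) (mul b d)] with x h1 h2 h3 h4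
    rw [h1, h4, Pi.add_apply, Pi.add_apply, h2, h3]
  · refine (hmul _ _).trans ?_
    rw [conv_congr_ae EventuallyEq.rfl (weightedLpInterL2_coeFn_add b d)]
    filter_upwards [conv_add_right hφ le_rfl ENNReal.one_ne_top (m1 a) (m1 b) (m1 d), hmul a b,
      hmul a d, weightedLpInterL2_coeFn_add (mul a b) (mul a d)] with x h1 h2 h3 h4
    rw [h1, h4, Pi.add_apply, Pi.add_apply, h2, h3]
  · refine (hmul _ _).trans ?_
    rw [conv_congr_ae (weightedLpInterL2_coeFn_smul z a) EventuallyEq.rfl, conv_smul_left]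
    filter_upwards [hmul a b, weightedLpInterL2_coeFn_smul z (mul a b)] with x h1 h2
    rw [h2, Pi.smul_apply, Pi.smul_apply, h1]
  · refine (hmul _ _).trans ?_
    rw [conv_congr_ae EventuallyEq.rfl (weightedLpInterL2_coeFn_smul z b), conv_smul_right]
    filter_upwards [hmul a b, weightedLpInterL2_coeFn_smul z (mul a b)] with x h1 h2
    rw [h2, Pi.smul_apply, Pi.smul_apply, h1]
  · refine (hmul _ _).trans (EventuallyEq.trans ?_ (hmul _ _).symm)
    rw [conv_congr_ae (hmul a b) EventuallyEq.rfl, conv_congr_ae EventuallyEq.rfl (hmul b d)]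
    exact conv_assoc hφ le_rfl ENNReal.one_ne_top (m1 a) (m1 b) (m1 d)
  · filter_upwards [hstar (a + b), hinv.ae (weightedLpInterL2_coeFn_add a b),
      weightedLpInterL2_coeFn_add (star a) (star b), hstar a, hstar b] with x h1 h2 h3 h4 h5
    rw [h1, h2, h3, Pi.add_apply, Pi.add_apply, h4, h5, map_add]
  · filter_upwards [hstar (z • a), hinv.ae (weightedLpInterL2_coeFn_smul z a),
      weightedLpInterL2_coeFn_smul (conj z) (star a), hstar a] with x h1 h2 h3 h4
    rw [h1, h2, h3, Pi.smul_apply, Pi.smul_apply, h4, smul_eq_mul, smul_eq_mul, map_mul]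
  · filter_upwards [hstar (mul a b), hinv.ae (hmul a b), hmul (star b) (star a)] with x h1 h2 h3
    rw [h1, h2, h3, conj_conv_inv, conv_congr_ae (hstar b) (hstar a)]

lemma isStarEmbedding_of_ae_eq_conv [μ.IsMulLeftInvariant]
    (hM : IsMajorant μ ω σ p θ c K)
    (hφ : IsMeasurableModel μ ν φ)
    (hinj : ∀ f : G → ℂ, MemLp f 1 μ → MemLp f 2 μ →
      (∀ g : G → ℂ, MemLp g 2 μ → conv μ f g =ᵐ[μ] 0) → f =ᵐ[μ] 0)
    (hmul : ∀ f g, (mul f g).1 =ᵐ[μ] conv μ f.1 g.1)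
    (hstar : ∀ f, (star f).1 =ᵐ[μ] fun x => conj (f.1 x⁻¹))
    (hT : ∀ f g, T f g =ᵐ[μ] conv μ f.1 g) :
    IsStarEmbedding (interNorm μ ω p) mul star T := by
  have m1 := fun f : weightedLpInterL2 μ ω p => hM.memLp_one f
  have hinv := (Measure.measurePreserving_inv μ).quasiMeasurePreserving
  have hss : ∀ f, (fun x => conj ((star f).1 x⁻¹)) =ᵐ[μ] f.1 := fun f => by
    filter_upwards [hinv.ae (hstar f)] with x hx
    rw [hx, inv_inv, Complex.conj_conj]
  have hadd : ∀ a b, T (a + b) = T a + T b := fun a b => by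
    refine ContinuousLinearMap.ext fun g => Lp.ext ?_
    refine (hT _ _).trans ?_
    rw [conv_congr_ae (weightedLpInterL2_coeFn_add a b) EventuallyEq.rfl,
      _root_.add_apply]
    filter_upwards [conv_add_left hφ one_le_two ENNReal.ofNat_ne_top (m1 a) (m1 b) (Lp.memLp g),
      hT a g, hT b g, Lp.coeFn_add (T a g) (T b g)] with x h1 h2 h3 h4
    rw [h1, h4, Pi.add_apply, Pi.add_apply, h2, h3]
  have hsmul : ∀ (z : ℂ) a, T (z • a) = z • T a := fun z a => by
    refine ContinuousLinearMap.ext fun g => Lp.ext ?_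
    refine (hT _ _).trans ?_
    rw [conv_congr_ae (weightedLpInterL2_coeFn_smul z a) EventuallyEq.rfl, conv_smul_left,
      _root_.smul_apply]
    filter_upwards [hT a g, Lp.coeFn_smul z (T a g)] with x h1 h2
    rw [h2, Pi.smul_apply, Pi.smul_apply, h1]
  refine
    { map_add := hadd
      map_smul := hsmul
      map_mul := fun a b => ContinuousLinearMap.ext fun g => Lp.ext ?_
      map_star := fun a => ?_
      injective := fun a b hab => ?_
      bounded := ⟨c⁻¹ * K.toReal, fun a => ?_⟩ }
  · refine (hT _ _).trans ?_
    change _ =ᵐ[μ] T a (T b g)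
    refine EventuallyEq.trans ?_ (hT _ _).symm
    rw [conv_congr_ae (hmul a b) EventuallyEq.rfl, conv_congr_ae EventuallyEq.rfl (hT b g)]
    exact conv_assoc hφ one_le_two ENNReal.ofNat_ne_top (m1 a) (m1 b) (Lp.memLp g)
  · rw [ContinuousLinearMap.eq_adjoint_iff]
    intro g h
    rw [L2.inner_def, L2.inner_def]
    -- The adjoint relation is used for `star a`, whose own involution is `a` by `hss`.
    have h1 := integral_conj_conv_mul hφ (m1 (star a)) (Lp.memLp g) (Lp.memLp h)
    rw [conv_congr_ae (hss a) EventuallyEq.rfl] at h1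
    refine Eq.trans ?_ (h1.trans ?_)
    · refine integral_congr_ae ?_
      filter_upwards [hT (star a) g] with x hx
      rw [hx, RCLike.inner_apply]
    · refine integral_congr_ae ?_
      filter_upwards [hT a h] with x hx
      rw [hx, RCLike.inner_apply]
  · have h0 : T (a + (-1 : ℂ) • b) = 0 := by
      rw [hadd, hsmul, hab, neg_one_smul, add_neg_cancel]
    have h1 := hinj (a + (-1 : ℂ) • b).1 (m1 _) (memLp_two_coe _) fun g hg => by
      have h2 := hT (a + (-1 : ℂ) • b) (hg.toLp g)
      rw [h0, conv_congr_ae EventuallyEq.rfl hg.coeFn_toLp] at h2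
      exact h2.symm.trans (Lp.coeFn_zero ℂ 2 μ)
    refine weightedLpInterL2_ext ?_
    filter_upwards [h1, weightedLpInterL2_coeFn_add a ((-1 : ℂ) • b),
      weightedLpInterL2_coeFn_smul (-1) b] with x h3 h4 h5
    rw [h4, Pi.add_apply, h5, Pi.smul_apply, neg_one_smul, ← sub_eq_add_neg] at h3
    exact sub_eq_zero.1 h3
  · have hc : 0 ≤ c⁻¹ := inv_nonneg.2 hM.pos.le
    refine ContinuousLinearMap.opNorm_le_bound _ (mul_nonneg (mul_nonneg hc ENNReal.toReal_nonneg)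
      (interNorm_nonneg a)) fun g => ?_
    have h1 : ‖T a g‖ ≤ (eLpNorm a.1 1 μ).toReal * ‖g‖ := by
      rw [Lp.norm_def, Lp.norm_def, eLpNorm_congr_ae (hT a g), ← ENNReal.toReal_mul]
      exact ENNReal.toReal_mono (ENNReal.mul_ne_top (m1 a).2.ne (Lp.memLp g).2.ne)
        (eLpNorm_conv_le hφ (m1 a).1 (Lp.memLp g).1 one_le_two ENNReal.ofNat_ne_top)
    refine h1.trans (mul_le_mul_of_nonneg_right ?_ (norm_nonneg g))
    refine (hM.oneNorm_le a).trans ?_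
    rw [mul_assoc]
    exact mul_le_mul_of_nonneg_left (hM.majorantNorm_le_interNorm a) hc

/-- This makes the `L²` norm admissible as `ν` in the spectral radius comparison. -/
lemma twoNorm_mul_le_opNorm (hmul : ∀ f g, (mul f g).1 =ᵐ[μ] conv μ f.1 g.1)
    (hT : ∀ f g, T f g =ᵐ[μ] conv μ f.1 g) (a b : weightedLpInterL2 μ ω p) :
    twoNorm (mul a b) ≤ ‖T a‖ * twoNorm b := by
  have h := (T a).le_opNorm ((memLp_two_coe b).toLp _)
  rw [Lp.norm_toLp] at h
  refine le_trans (le_of_eq ?_) h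
  rw [twoNorm, Lp.norm_def, eLpNorm_congr_ae (hmul a b), eLpNorm_congr_ae (hT _ _),
    conv_congr_ae EventuallyEq.rfl (memLp_two_coe b).coeFn_toLp]

end Structure

/-- The conclusions for a unimodular group, given a majorant of the weight. -/
lemma exists_convolution_algebra {G : Type*} [Group G] [TopologicalSpace G] [IsTopologicalGroup G]
    [LocallyCompactSpace G] [T2Space G] [MeasurableSpace G] [BorelSpace G]
    (μ : Measure G) [μ.IsHaarMeasure] [μ.Regular] [SigmaFinite μ] [μ.IsMulRightInvariant]
    [μ.IsInvInvariant] (hmod : ∀ x : G, Measure.modularCharacter x = 1)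
    {ω σ : G → ℝ} (hω : IsWeight μ ω) {p : ℝ≥0∞} (hp1 : 1 ≤ p) (hp : p ≠ ∞) {θ c : ℝ} {K : ℝ≥0∞}
    (hM : IsMajorant μ ω σ p θ c K) :
    ∃ (mul : weightedLpInterL2 μ ω p → weightedLpInterL2 μ ω p → weightedLpInterL2 μ ω p)
      (star : weightedLpInterL2 μ ω p → weightedLpInterL2 μ ω p)
      (T : weightedLpInterL2 μ ω p → (Lp ℂ 2 μ →L[ℂ] Lp ℂ 2 μ)),
      (∀ f g : weightedLpInterL2 μ ω p,
        IsConvolution μ (f : G →ₘ[μ] ℂ) (g : G →ₘ[μ] ℂ) (mul f g : G →ₘ[μ] ℂ)) ∧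
      (∀ f : weightedLpInterL2 μ ω p,
        ((star f : G →ₘ[μ] ℂ) : G → ℂ) =ᵐ[μ] groupStar ((f : G →ₘ[μ] ℂ) : G → ℂ)) ∧
      IsBanachStarAlgebra (interNorm μ ω p) mul star ∧
      (∀ (f : weightedLpInterL2 μ ω p) (g : Lp ℂ 2 μ),
        IsConvolution μ (f : G →ₘ[μ] ℂ) g (T f g)) ∧
      IsStarEmbedding (interNorm μ ω p) mul star T ∧
      IsQuasiInverseClosed mul T ∧
      (∀ f : weightedLpInterL2 μ ω p, quasiSpectralRadius mul f = spectralRadius ℂ (T f)) := by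
  have := sigmaCompactSpace_of_sigmaFinite μ
  have hφ := isMeasurableModel_toBaire μ
  have : SFinite (μ.map (toBaire G)) := inferInstance
  choose mul hmul using fun f g : weightedLpInterL2 μ ω p =>
    exists_weightedLpInterL2 (hM.memLp_conv_mul_weight hφ hω hp1 hp f g)
      (memLp_conv hφ one_le_two ENNReal.ofNat_ne_top (hM.memLp_one f) (memLp_two_coe g))
  choose star hstar using fun f : weightedLpInterL2 μ ω p =>
    exists_weightedLpInterL2 (memLp_conj_inv_mul_weight hω f) (memLp_conj_inv f)
  have hT := fun (f : weightedLpInterL2 μ ω p) (g : Lp ℂ 2 μ) =>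
    coeFn_convOp hφ (hM.memLp_one f) g
  have hA := isBanachStarAlgebra_of_ae_eq_conv hM hφ hω hp1 hp hmul hstar
  have hE := isStarEmbedding_of_ae_eq_conv hM hφ
    (fun f => ae_eq_zero_of_conv_eq_zero hφ) hmul hstar hT
  refine ⟨mul, star, fun f => convOp hφ (hM.memLp_one f), fun f g => ?_, fun f => ?_, hA,
    fun f g => ?_, hE, ?_⟩
  · exact isConvolution_of_ae_eq hφ one_le_two ENNReal.ofNat_ne_top (hM.memLp_one f)
      (memLp_two_coe g) (hmul f g)
  · refine (hstar f).trans (ae_of_all _ fun x => ?_)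
    simp [groupStar, hmod]
  · exact isConvolution_of_ae_eq hφ one_le_two ENNReal.ofNat_ne_top (hM.memLp_one f)
      (Lp.memLp g) (hT f g)
  · refine isQuasiInverseClosed_and_spectralRadius_eq hA hE twoNorm twoNorm_nonneg
      (twoNorm_mul_le_opNorm hmul hT) (2 * K.toReal + c⁻¹ * K.toReal) θ ?_ hM.theta_pos
      hM.theta_lt_one fun f => hM.interNorm_sq_le hφ hω hp1 hp (hmul f f)
    have := inv_nonneg.2 hM.pos.le
    have : 0 ≤ K.toReal := ENNReal.toReal_nonneg
    positivity

end WeightedConv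

theorem proposition5p4 {G : Type*} [Group G] [TopologicalSpace G] [IsTopologicalGroup G]
    [LocallyCompactSpace G] [T2Space G] [MeasurableSpace G] [BorelSpace G]
    (μ : Measure G) [μ.IsHaarMeasure] [μ.Regular]
    (ω : G → ℝ) (hω : WeightedConv.IsWeight μ ω) (hω1 : ∀ x, 1 ≤ ω x)
    (p q : ℝ≥0∞) (hp1 : 1 ≤ p) (hp : p ≠ ∞) (hpq : p.HolderConjugate q)
    (u : G → ℝ) (hu : AEMeasurable u μ) (hu0 : ∀ x, 0 ≤ u x) (hub : ∃ M : ℝ, ∀ x, u x ≤ M)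
    (s r : ℝ) (hs : ENNReal.ofReal s < q) (hr : 0 < r)
    (hσ : ∃ c : ℝ, 0 < c ∧ ∀ x, c ≤ ω x * u x)
    (hωu : ∀ x y, ω (x * y) / (ω x * ω y) ≤ u x + u y)
    (hint : Integrable (fun x => u x ^ s * ω x ^ r) μ) :
    ∃ (mul : WeightedConv.weightedLpInterL2 μ ω p → WeightedConv.weightedLpInterL2 μ ω p →
          WeightedConv.weightedLpInterL2 μ ω p)
      (star : WeightedConv.weightedLpInterL2 μ ω p → WeightedConv.weightedLpInterL2 μ ω p)
      (T : WeightedConv.weightedLpInterL2 μ ω p → (Lp ℂ 2 μ →L[ℂ] Lp ℂ 2 μ)),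
      -- the product is convolution, the involution is the usual one
      (∀ f g : WeightedConv.weightedLpInterL2 μ ω p,
        WeightedConv.IsConvolution μ (f : G →ₘ[μ] ℂ) (g : G →ₘ[μ] ℂ)
        (mul f g : G →ₘ[μ] ℂ)) ∧
      (∀ f : WeightedConv.weightedLpInterL2 μ ω p,
        ((star f : G →ₘ[μ] ℂ) : G → ℂ) =ᵐ[μ]
        WeightedConv.groupStar ((f : G →ₘ[μ] ℂ) : G → ℂ)) ∧
      -- with these operations and the norm `max`, a Banach `*`-algebra
      WeightedConv.IsBanachStarAlgebra (WeightedConv.interNorm μ ω p) mul star ∧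
      -- `T f` is convolution by `f` on `L^2(G)`, and `T` is the inclusion into `B(L^2(G))`
      (∀ (f : WeightedConv.weightedLpInterL2 μ ω p) (g : Lp ℂ 2 μ),
        WeightedConv.IsConvolution μ (f : G →ₘ[μ] ℂ) g (T f g)) ∧
      WeightedConv.IsStarEmbedding (WeightedConv.interNorm μ ω p) mul star T ∧
      -- quasi-inverse closedness and equality of the spectral radii
      WeightedConv.IsQuasiInverseClosed mul T ∧
      (∀ f : WeightedConv.weightedLpInterL2 μ ω p,
        WeightedConv.quasiSpectralRadius mul f = spectralRadius ℂ (T f)) := by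
  obtain ⟨M, hM⟩ := hub
  obtain ⟨c, hc, hcu⟩ := hσ
  have hu1 : ∀ x, 0 < u x := fun x => by
    refine lt_of_le_of_ne (hu0 x) fun h => ?_
    have := hcu x
    rw [← h, mul_zero] at this
    linarith
  have hω0 : ∀ x, 0 < ω x := fun x => one_pos.trans_le (hω1 x)
  have : SigmaFinite μ := WeightedConv.sigmaFinite_of_integrable_pos hint fun x =>
    mul_pos (Real.rpow_pos_of_pos (hu1 x) _) (Real.rpow_pos_of_pos (hω0 x) _)
  -- Enlarging `s` is harmless as `u` is bounded; it ensures `r / s' < 1` and a positive decay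
  -- exponent `t = s' - r`.
  set s' := max s (r + 1) with hs'
  have hrs : r < s' := (lt_add_one r).trans_le (le_max_right _ _)
  have hint1 := WeightedConv.integrable_rpow_mul_rpow_of_le hω.aemeasurable hω1 hu hu1 hM
    (le_max_left s (r + 1)) le_rfl hint
  have hint2 := WeightedConv.integrable_rpow_neg_of_le_mul hω.aemeasurable hω1 hc hcu
    (hr.trans hrs).le hint1
  have hmod := WeightedConv.modularCharacter_eq_one_of_forall_le
    (WeightedConv.modularCharacter_le_one hω hω1 hu1 hr hrs hωu hint1 hint2)
  have : μ.IsMulRightInvariant :=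
    WeightedConv.isMulRightInvariant_of_modularCharacter_eq_one hmod
  have : μ.IsInvInvariant := WeightedConv.isInvInvariant_of_isMulRightInvariant
  -- The case `p = 1` uses the enlarged exponent `s'`; for `p > 1` the original `s` is kept, since
  -- `s < q` is essential there.
  rcases eq_or_lt_of_le hp1 with rfl | hp1'
  · obtain ⟨C, hC, hωC⟩ := WeightedConv.exists_weight_mul_le hω hω1 hu1 hr hrs hωu hint1
    obtain ⟨σ, θ, c, K, hK⟩ := WeightedConv.exists_isMajorant_one hω.aemeasurable hω1
      (div_pos hr (hr.trans hrs)) ((div_lt_one (hr.trans hrs)).2 hrs) (sub_pos.2 hrs) hC hωC hint2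
    exact WeightedConv.exists_convolution_algebra μ hmod hω le_rfl hp hK
  · obtain ⟨σ, θ, c, K, hK⟩ := WeightedConv.exists_isMajorant_of_one_lt hω.aemeasurable hω1 hp1' hp
      hpq hu hu1 hM hs hr hc hcu hωu hint
    exact WeightedConv.exists_convolution_algebra μ hmod hω hp1 hp hK
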